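/- Let $1\le i,\ell\le n-1$ be integers with $i+\ell\le n$, and let $m=\min\{i,\ell\}$. Let $G_{n,i}$ be the Grassmann manifold of $i$-dimensional linear subspaces of $\mathbb R^n$, with its $\mathrm O(n)$-invariant measure $d\xi$ of total mass $1$. Let $\mathbb R^\ell=\mathrm{span}(e_{n-\ell+1},\dots,e_n)$ and $$K_\ell=\left\{\begin{bmatrix} a&0\\0&b\end{bmatrix}\ :\ a\in \mathrm O(n-\ell),\ b\in \mathrm O(\ell)\right\}\subset \mathrm O(n).$$ To $\xi\in G_{n,i}$ assign the point $\boldsymbol\lambda(\xi)=(\lambda_1,\dots,\lambda_m)$ of $$\Lambda_m=\{(\lambda_1,\dots,\lambda_m): 1\ge\lambda_1\ge\dots\ge\lambda_m\ge0\}$$ formed by the eigenvalues of the matrix $\Theta^t\,\mathrm{Pr}_{\mathbb R^\ell}\,\Theta$ if $i\le\ell$, and of $\Psi^t\,\mathrm{Pr}_{\xi}\,\Psi$ if $i>\ell$, where the columns of the $n\times i$ matrix $\Theta$ and of the $n\times \ell$ matrix $\Psi$ form arbitrary fixed orthonormal bases of $\xi$ and of $\mathbb R^\ell$, and $\mathrm{Pr}$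 denotes orthogonal projection (the numbers $\arccos\sqrt{\lambda_j}$ are known as the canonical angles between $\xi$ and $\mathbb R^\ell$). On $\Lambda_m$ put $$d\nu(\boldsymbol\lambda)=\prod_{1\le j<k\le m}(\lambda_j-\lambda_k)\prod_{j=1}^m\lambda_j^{\alpha}(1-\lambda_j)^{\beta}\,d\lambda_j,\qquad \alpha=\frac{|\ell-i|-1}{2},\quad \beta=\frac{n-\ell-i-1}{2}.$$ An integrable (real- or complex-valued) function $f$ on $G_{n,i}$ is $K_\ell$-invariant if and only if there is a function $f_0\in L^1(\Lambda_m;d\nu)$ such that $f(\xi)=f_0(\boldsymbol\lambda(\xi))$. This holds both for functions defined everywhere, with invariance and representation at every $\xi$, and for functions up to null sets, with invariance under each element of $K_\ell$ and representation for almost every $\xi$. Moreover, whenever $f_0\in L^1(\Lambda_m;d\nu)$ and $f(\xi)=f_0(\boldsymbol\lambda(\xi))$ for almost every $\xi$, the function $f$ is integrable and $$\int_{G_{n,i}}f(\xi)\,d\xi=c\int_{\Lambda_m}f_0(\boldsymbol\lambda)\,d\nu(\boldsymbol\lambda),\qquad c=c_m\cdot\begin{cases}\dfrac{\Gamma_i(n/2)}{\Gamma_i(\ell/2)\,\Gamma_i((n-\ell)/2)}&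 \text{if } i\le\ell,\\[2ex] \dfrac{\Gamma_\ell(n/2)}{\Gamma_\ell(i/2)\,\Gamma_\ell((n-i)/2)}&\text{if } i\ge\ell,\end{cases}$$ where $\Gamma_k(a)=\pi^{k(k-1)/4}\prod_{j=0}^{k-1}\Gamma(a-j/2)$ is the Siegel gamma function and $c_m=\pi^{(m^2+m)/4}\Big(\prod_{j=1}^m\Gamma(j/2)\Big)^{-1}$. -/

import Mathlib

open MeasureTheory
open scoped Matrix

noncomputable section

namespace InvGrass

/-- The orthogonal group `O(n)`, as a group of real matrices. -/
abbrev On (n : ℕ) : Type := Matrix.orthogonalGroup (Fin n) ℝ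

/-- The matrix of the orthogonal projection `Pr_V` of `ℝⁿ` onto `V` in the standard basis. -/
def projMatrix {n : ℕ} (V : Submodule ℝ (EuclideanSpace ℝ (Fin n))) :
    Matrix (Fin n) (Fin n) ℝ :=
  Matrix.of fun a b => V.starProjection (EuclideanSpace.single b (1 : ℝ)) a

/-- The coordinate subspace `ℝ^k` of `ℝⁿ` spanned by the last `k` coordinate unit vectors. -/
def coordSubspace (n k : ℕ) : Submodule ℝ (EuclideanSpace ℝ (Fin n)) :=
  Submodule.span ℝ {x | ∃ j : Fin n, n ≤ (j : ℕ) + k ∧ x = EuclideanSpace.single j (1 : ℝ)}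

/-- The Grassmannian `G_{n,i}` of `i`-dimensional linear subspaces of `ℝⁿ`. -/
def Gr (n i : ℕ) : Type :=
  {ξ : Submodule ℝ (EuclideanSpace ℝ (Fin n)) // Module.finrank ℝ ξ = i}

/-- The usual topology: a subspace is identified with the orthogonal projection onto it. -/
instance (n i : ℕ) : TopologicalSpace (Gr n i) :=
  TopologicalSpace.induced (fun ξ => projMatrix ξ.1) inferInstance

instance (n i : ℕ) : MeasurableSpace (Gr n i) := borel _

instance (n i : ℕ) : BorelSpace (Gr n i) := ⟨rfl⟩

instance (n : ℕ) : MeasurableSpace (On n) := borel _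

instance (n : ℕ) : BorelSpace (On n) := ⟨rfl⟩

theorem toEuclideanLin_injective {n : ℕ} (γ : On n) :
    Function.Injective (Matrix.toEuclideanLin (γ : Matrix (Fin n) (Fin n) ℝ)) := by
  apply Function.LeftInverse.injective
    (g := Matrix.toEuclideanLin ((γ⁻¹ : On n) : Matrix (Fin n) (Fin n) ℝ))
  intro x
  simp [Matrix.toLpLin_apply, Matrix.mulVec_mulVec]

/-- The action of `O(n)` on `G_{n,i}`: `γ • ξ` is the image of `ξ` under `x ↦ γ x`. -/
instance (n i : ℕ) : MulAction (On n) (Gr n i) where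
  smul γ ξ := ⟨ξ.1.map (Matrix.toEuclideanLin (γ : Matrix (Fin n) (Fin n) ℝ)), by
    rw [← LinearEquiv.finrank_eq (Submodule.equivMapOfInjective _
      (toEuclideanLin_injective γ) ξ.1), ξ.2]⟩
  one_smul ξ := by
    apply Subtype.ext
    change ξ.1.map (Matrix.toEuclideanLin (1 : Matrix (Fin n) (Fin n) ℝ)) = ξ.1
    simp
  mul_smul γ δ ξ := by
    apply Subtype.ext
    change ξ.1.map (Matrix.toEuclideanLin ((γ : Matrix (Fin n) (Fin n) ℝ) *
        (δ : Matrix (Fin n) (Fin n) ℝ))) =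
      (ξ.1.map (Matrix.toEuclideanLin (δ : Matrix (Fin n) (Fin n) ℝ))).map
        (Matrix.toEuclideanLin (γ : Matrix (Fin n) (Fin n) ℝ))
    rw [← Submodule.map_comp]
    congr 1
    ext x : 1
    simp [Matrix.toLpLin_apply, Matrix.mulVec_mulVec]

theorem finrank_coordSubspace {n k : ℕ} (h : k ≤ n) :
    Module.finrank ℝ (coordSubspace n k) = k := by
  have hset : {x : EuclideanSpace ℝ (Fin n) | ∃ j : Fin n, n ≤ (j : ℕ) + k ∧
      x = EuclideanSpace.single j (1 : ℝ)} =
      Set.range fun t : Fin k =>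
        EuclideanSpace.single (⟨n - k + t, by omega⟩ : Fin n) (1 : ℝ) := by
    ext x
    constructor
    · rintro ⟨j, hj, rfl⟩
      exact ⟨⟨(j : ℕ) - (n - k), by omega⟩, by
        have hj' : (⟨n - k + ((j : ℕ) - (n - k)), by omega⟩ : Fin n) = j :=
          Fin.ext (by change n - k + ((j : ℕ) - (n - k)) = j; omega)
        change EuclideanSpace.single (⟨n - k + ((j : ℕ) - (n - k)), _⟩ : Fin n) (1 : ℝ) = _
        rw [hj']⟩
    · rintro ⟨t, rfl⟩
      exact ⟨_, by simp; omega, rfl⟩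
  have hinj : Function.Injective fun t : Fin k => (⟨n - k + t, by omega⟩ : Fin n) := by
    intro s t hst
    simp only [Fin.mk.injEq] at hst
    exact Fin.ext (by omega)
  have hli := ((EuclideanSpace.basisFun (Fin n) ℝ).orthonormal.linearIndependent).comp _ hinj
  have := finrank_span_eq_card hli
  rw [coordSubspace, hset]
  have hfun : (fun t : Fin k =>
      EuclideanSpace.single (⟨n - k + t, by omega⟩ : Fin n) (1 : ℝ)) =
      (EuclideanSpace.basisFun (Fin n) ℝ) ∘ fun t : Fin k => (⟨n - k + t, by omega⟩ : Fin n) := by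
    funext t
    exact (EuclideanSpace.basisFun_apply (Fin n) ℝ _).symm
  rw [hfun, this, Fintype.card_fin]

/-- `ℝ^i` as a point of `G_{n,i}`. -/
def basePoint {n i : ℕ} (h : i ≤ n) : Gr n i := ⟨coordSubspace n i, finrank_coordSubspace h⟩

instance (n : ℕ) : CompactSpace (On n) := by
  refine isCompact_iff_compactSpace.1 ?_
  have hK : IsCompact {A : Matrix (Fin n) (Fin n) ℝ | ∀ a b, A a b ∈ Set.Icc (-1 : ℝ) 1} := by
    have := isCompact_univ_pi fun _ : Fin n => isCompact_univ_pi fun _ : Fin n =>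
      (isCompact_Icc : IsCompact (Set.Icc (-1 : ℝ) 1))
    have heq : {A : Matrix (Fin n) (Fin n) ℝ | ∀ a b, A a b ∈ Set.Icc (-1 : ℝ) 1} =
        Set.univ.pi fun _ : Fin n => Set.univ.pi fun _ : Fin n => Set.Icc (-1 : ℝ) 1 := by
      refine Set.ext fun A => ?_
      exact ⟨fun h a _ b _ => h a b, fun h a b => h a trivial b trivial⟩
    rw [heq]
    exact this
  refine hK.of_isClosed_subset isClosed_unitary fun A hA a b => ?_
  exact abs_le.1 (entry_norm_bound_of_unitary hA a b)

/-- The Haar measure of `O(n)` of total mass one. -/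
def haarOn (n : ℕ) : Measure (On n) := Measure.haarMeasure ⊤

/-- The `O(n)`-invariant measure `dξ` of total mass one on `G_{n,i}`: the image of the
normalized Haar measure of `O(n)` under the orbit map `γ ↦ γ ℝ^i`. -/
def grMeasure {n i : ℕ} (h : i ≤ n) : Measure (Gr n i) :=
  (haarOn n).map fun γ => γ • basePoint h

theorem projMatrix_smul {n i : ℕ} (γ : On n) (ξ : Gr n i) :
    projMatrix (γ • ξ).1 = (γ : Matrix (Fin n) (Fin n) ℝ) * projMatrix ξ.1 *
      (γ : Matrix (Fin n) (Fin n) ℝ)ᵀ := by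
  have hmul : (γ : Matrix (Fin n) (Fin n) ℝ)ᵀ * (γ : Matrix (Fin n) (Fin n) ℝ) = 1 :=
    (Matrix.mem_orthogonalGroup_iff' (Fin n) ℝ).1 γ.2
  have hmul' : (γ : Matrix (Fin n) (Fin n) ℝ) * (γ : Matrix (Fin n) (Fin n) ℝ)ᵀ = 1 :=
    (Matrix.mem_orthogonalGroup_iff (Fin n) ℝ).1 γ.2
  let L : EuclideanSpace ℝ (Fin n) ≃ₗᵢ[ℝ] EuclideanSpace ℝ (Fin n) :=
    LinearEquiv.isometryOfInner
      (LinearEquiv.ofLinearMap (Matrix.toEuclideanLin (γ : Matrix (Fin n) (Fin n) ℝ))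
        (Matrix.toEuclideanLin (γ : Matrix (Fin n) (Fin n) ℝ)ᵀ)
        (by ext x : 1; simp [Matrix.toLpLin_apply, Matrix.mulVec_mulVec, hmul'])
        (by ext x : 1; simp [Matrix.toLpLin_apply, Matrix.mulVec_mulVec, hmul]))
      (fun x y => by
        simp [EuclideanSpace.inner_eq_star_dotProduct, Matrix.toLpLin_apply,
          Matrix.dotProduct_mulVec, ← Matrix.mulVec_transpose, Matrix.mulVec_mulVec, hmul])
  have hLs : ∀ x, L.symm x = Matrix.toEuclideanLin (γ : Matrix (Fin n) (Fin n) ℝ)ᵀ x :=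
    fun _ => rfl
  have key : ∀ x, (γ • ξ).1.starProjection x = L (ξ.1.starProjection (L.symm x)) :=
    fun x => Submodule.starProjection_map_apply L ξ.1 x
  have hP : ∀ (V : Submodule ℝ (EuclideanSpace ℝ (Fin n))) x,
      V.starProjection x = Matrix.toEuclideanLin (projMatrix V) x := by
    intro V
    suffices h : (V.starProjection : EuclideanSpace ℝ (Fin n) →ₗ[ℝ] EuclideanSpace ℝ (Fin n)) =
        Matrix.toEuclideanLin (projMatrix V) from fun x => LinearMap.congr_fun h x
    refine (EuclideanSpace.basisFun (Fin n) ℝ).toBasis.ext fun b => ?_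
    ext a
    simp [projMatrix, Matrix.toLpLin_apply]
  ext a b
  change (γ • ξ).1.starProjection (EuclideanSpace.single b (1 : ℝ)) a = _
  rw [key, hP, hLs]
  change (Matrix.toEuclideanLin (γ : Matrix (Fin n) (Fin n) ℝ) _) a = _
  simp only [Matrix.toLpLin_apply, Matrix.mulVec_mulVec, PiLp.ofLp_single,
    Matrix.mulVec_single_one]
  rfl

theorem continuous_smul_left {n i : ℕ} (γ : On n) :
    Continuous fun ξ : Gr n i => γ • ξ := by
  refine continuous_induced_rng.2 ?_
  have h : Continuous fun ξ : Gr n i => projMatrix ξ.1 := continuous_induced_dom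
  simp only [Function.comp_def, projMatrix_smul]
  fun_prop

theorem continuous_orbit {n i : ℕ} (ξ : Gr n i) : Continuous fun γ : On n => γ • ξ := by
  refine continuous_induced_rng.2 ?_
  simp only [Function.comp_def, projMatrix_smul]
  fun_prop

instance (n : ℕ) : IsProbabilityMeasure (haarOn n) :=
  ⟨by simpa [haarOn] using Measure.haarMeasure_self (K₀ := (⊤ : TopologicalSpace.PositiveCompacts (On n)))⟩

instance (n : ℕ) : (haarOn n).IsMulLeftInvariant := by
  unfold haarOn; infer_instance

theorem isProbabilityMeasure_grMeasure {n i : ℕ} (h : i ≤ n) :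
    IsProbabilityMeasure (grMeasure h) :=
  Measure.isProbabilityMeasure_map (continuous_orbit _).measurable.aemeasurable

theorem grMeasure_map_smul {n i : ℕ} (h : i ≤ n) (γ : On n) :
    (grMeasure h).map (fun ξ => γ • ξ) = grMeasure h := by
  unfold grMeasure
  rw [Measure.map_map (continuous_smul_left γ).measurable (continuous_orbit _).measurable]
  conv_rhs => rw [← map_mul_left_eq_self (haarOn n) γ]
  rw [Measure.map_map (continuous_orbit _).measurable (measurable_const_mul γ)]
  congr 1
  funext δ
  simp [mul_smul]

/-- The identification of the `n` coordinates with `n - ℓ` first and `ℓ` last coordinates. -/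
def splitEquiv {n ℓ : ℕ} (h : ℓ ≤ n) : Fin (n - ℓ) ⊕ Fin ℓ ≃ Fin n :=
  finSumFinEquiv.trans (finCongr (Nat.sub_add_cancel h))

/-- `γ ∈ K_ℓ`: `γ` is block diagonal with blocks `a ∈ O(n - ℓ)` and `b ∈ O(ℓ)`. -/
def MemK {n ℓ : ℕ} (h : ℓ ≤ n) (γ : On n) : Prop :=
  ∃ (a : On (n - ℓ)) (b : On ℓ), (γ : Matrix (Fin n) (Fin n) ℝ) =
    Matrix.reindex (splitEquiv h) (splitEquiv h)
      (Matrix.fromBlocks (a : Matrix (Fin (n - ℓ)) (Fin (n - ℓ)) ℝ) 0 0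
        (b : Matrix (Fin ℓ) (Fin ℓ) ℝ))

/-- The `n × k` matrix whose columns are the vectors of an orthonormal basis of `U`. -/
def frameMatrix {n k : ℕ} {U : Submodule ℝ (EuclideanSpace ℝ (Fin n))}
    (b : OrthonormalBasis (Fin k) ℝ U) : Matrix (Fin n) (Fin k) ℝ :=
  Matrix.of fun a j => (b j : EuclideanSpace ℝ (Fin n)) a

/-- The matrix `Θᵗ Pr_V Θ`, where the columns of `Θ` form the orthonormal basis `b` of `U`. -/
def compress {n k : ℕ} {U : Submodule ℝ (EuclideanSpace ℝ (Fin n))}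
    (b : OrthonormalBasis (Fin k) ℝ U) (V : Submodule ℝ (EuclideanSpace ℝ (Fin n))) :
    Matrix (Fin k) (Fin k) ℝ :=
  (frameMatrix b)ᵀ * projMatrix V * frameMatrix b

theorem projMatrix_isHermitian {n : ℕ} (V : Submodule ℝ (EuclideanSpace ℝ (Fin n))) :
    (projMatrix V).IsHermitian := by
  ext a b
  have h := V.inner_starProjection_left_eq_right (EuclideanSpace.single a (1 : ℝ))
    (EuclideanSpace.single b (1 : ℝ))
  simpa [projMatrix, EuclideanSpace.inner_single_left, EuclideanSpace.inner_single_right] using h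

theorem compress_isHermitian {n k : ℕ} {U : Submodule ℝ (EuclideanSpace ℝ (Fin n))}
    (b : OrthonormalBasis (Fin k) ℝ U) (V : Submodule ℝ (EuclideanSpace ℝ (Fin n))) :
    (compress b V).IsHermitian := by
  have := Matrix.isHermitian_conjTranspose_mul_mul (frameMatrix b) (projMatrix_isHermitian V)
  simpa [compress, Matrix.conjTranspose_eq_transpose_of_trivial] using this

/-- The eigenvalues of a symmetric `k × k` matrix, with multiplicity, in decreasing order. -/
def eigs {k : ℕ} {A : Matrix (Fin k) (Fin k) ℝ} (hA : A.IsHermitian) (j : Fin k) : ℝ :=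
  hA.eigenvalues₀ (Fin.cast (Fintype.card_fin k).symm j)

/-- The point `(λ_1, …, λ_m)`, `m = min {i, ℓ}`, assigned to `ξ ∈ G_{n,i}`: the eigenvalues
in decreasing order of `Θᵗ Pr_{ℝ^ℓ} Θ` if `i ≤ ℓ`, and of `Ψᵗ Pr_ξ Ψ` if `i > ℓ`, where the
columns of `Θ` and `Ψ` are orthonormal bases of `ξ` and of `ℝ^ℓ`. -/
def lam {n i ℓ : ℕ} (ξ : Gr n i) (Θ : OrthonormalBasis (Fin i) ℝ ξ.1)
    (Ψ : OrthonormalBasis (Fin ℓ) ℝ (coordSubspace n ℓ)) (j : Fin (min i ℓ)) : ℝ :=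
  if h : i ≤ ℓ then
    eigs (compress_isHermitian Θ (coordSubspace n ℓ)) (Fin.cast (min_eq_left h) j)
  else
    eigs (compress_isHermitian Ψ ξ.1) (Fin.cast (min_eq_right (le_of_not_ge h)) j)

/-- The simplex `Λ_m = {1 ≥ λ_1 ≥ … ≥ λ_m ≥ 0}`. -/
def simplex (m : ℕ) : Set (Fin m → ℝ) :=
  {x | Antitone x ∧ ∀ j, 0 ≤ x j ∧ x j ≤ 1}

/-- The measure `∏_{j<k} (λ_j - λ_k) ∏_j λ_j^α (1 - λ_j)^β dλ_j` on `Λ_m`. -/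
def nu (m : ℕ) (α β : ℝ) : Measure (Fin m → ℝ) :=
  (volume.restrict (simplex m)).withDensity fun x =>
    ENNReal.ofReal ((∏ j, ∏ k ∈ Finset.Ioi j, (x j - x k)) *
      ∏ j, x j ^ α * (1 - x j) ^ β)

/-- The Siegel gamma function `Γ_m(a) = π^{m(m-1)/4} ∏_{j=0}^{m-1} Γ(a - j/2)`. -/
def siegelGamma (m : ℕ) (a : ℝ) : ℝ :=
  Real.pi ^ ((m : ℝ) * ((m : ℝ) - 1) / 4) * ∏ j ∈ Finset.range m, Real.Gamma (a - (j : ℝ) / 2)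

/-- The constant `c_m = π^{(m²+m)/4} (∏_{j=1}^m Γ(j/2))⁻¹`. -/
def cOrd (m : ℕ) : ℝ :=
  Real.pi ^ (((m : ℝ) ^ 2 + m) / 4) / ∏ j ∈ Finset.Icc 1 m, Real.Gamma ((j : ℝ) / 2)

/-- The constant `c` of the integral formula. -/
def cConst (n i ℓ : ℕ) : ℝ :=
  cOrd (min i ℓ) *
    if i ≤ ℓ then
      siegelGamma i (n / 2) / (siegelGamma i (ℓ / 2) * siegelGamma i (((n : ℝ) - ℓ) / 2))
    else
      siegelGamma ℓ (n / 2) / (siegelGamma ℓ (i / 2) * siegelGamma ℓ (((n : ℝ) - i) / 2))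

end InvGrass

end

/-! ### Residues at the nodes and interlacing roots -/

noncomputable section

namespace InvGrass

open Polynomial

/-! Everything rests on one identity of measures: the image of the invariant measure under `lam` is
`cConst n i ℓ • nu` (`map_angles_grMeasure`). The integral formula is then a change of variables.
For the characterization of invariant functions, the fibres of `lam` are exactly the `K_ℓ`-orbits
(`charpoly_memK_smul`, `exists_memK_smul_eq`), so an invariant `f` factors through `lam`. The factor
is measurable because images of compact sets are compact (`aestronglyMeasurable_map_of_comp`).
Invariance up to null sets is reduced to invariance everywhere by averaging over `K_ℓ`
(`exists_invariant_ae_eq`).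

The law of the angles is found by induction on the number `k` of coordinates spanning `ℝ^k`
(`lintegral_spec_haarOn`). Let `P` project onto a random `i`-plane and let `x` be the squared
cosines relative to `ℝ^k`. The leading block of `1 - P` of size `n - k` has eigenvalues `1`, the
`x_j`, and `0`, with multiplicities `n - i - k`, `1`, `i - k` (`charpoly_corner`). Haar measure is
unchanged by an independent rotation of the first `n - k` coordinates, and this rotation conjugates
that block. Deleting its last row and column gives the block that encodes the squared cosines
relative to `ℝ^{k+1}`. So one needs the law of the eigenvalues of a corner of a randomly rotated
symmetric matrix.

That law is the Dixon–Anderson density (`lintegral_corner_eigenvalues`). The characteristic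
polynomial of the corner is `∑ w_q² ∏_{l≠q} (X - α_l)`, where `w` is the last row of the rotation in
an eigenbasis. This row is a normalized Gaussian vector (`lintegral_row_haarOn`). Grouping its
squares by eigenvalue gives independent gamma weights, up to a common scale that does not move the
roots. The bijection between (total weight, interlacing roots) and weights has an explicit Jacobian
(`abs_det_residueJac`), and the total weight splits off as an independent factor
(`lintegral_pi_gammaMeasure`).

To close the induction, the Jacobi density in `x` times the density of `b` given `x` equals a Jacobi
density in `b` times a Dixon–Anderson density of `x` given `b` with all exponents `-1/2`
(`jac_mul_transition`). The mass of the latter does not depend on `b` (`lintegral_interlace_half`),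
so integrating out `x` leaves a Jacobi density and an explicit constant (`lawConst_succ`). -/

/-- The Vandermonde product `∏_{j<k} (x_j - x_k)`. -/
def vdm {m : ℕ} (x : Fin m → ℝ) : ℝ := ∏ j, ∏ k ∈ Finset.Ioi j, (x j - x k)

theorem vdm_pos {m : ℕ} {x : Fin m → ℝ} (hx : StrictAnti x) : 0 < vdm x :=
  Finset.prod_pos fun _ _ => Finset.prod_pos fun _ hk =>
    sub_pos.2 (hx (Finset.mem_Ioi.1 hk))

theorem abs_det_vandermonde {m : ℕ} (x : Fin m → ℝ) :
    |(Matrix.vandermonde x).det| = |vdm x| := by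
  rw [Matrix.det_vandermonde, vdm]
  simp only [Finset.abs_prod]
  exact Finset.prod_congr rfl fun _ _ => Finset.prod_congr rfl fun _ _ => abs_sub_comm _ _

/-- The product of all differences of distinct entries is the squared Vandermonde product. -/
theorem prod_prod_erase_abs {m : ℕ} (x : Fin m → ℝ) :
    ∏ j, ∏ k ∈ Finset.univ.erase j, |x j - x k| = |vdm x| ^ 2 := by
  have h1 : ∀ j : Fin m, ∏ k ∈ Finset.univ.erase j, |x j - x k| =
      (∏ k ∈ Finset.Iio j, |x j - x k|) * ∏ k ∈ Finset.Ioi j, |x j - x k| := by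
    intro j
    rw [← Finset.prod_union]
    · congr 1
      ext k
      simp [lt_or_lt_iff_ne]
    · rw [Finset.disjoint_left]
      intro k hk hk'
      simp only [Finset.mem_Iio, Finset.mem_Ioi] at hk hk'
      exact lt_asymm hk hk'
  simp only [h1, Finset.prod_mul_distrib]
  have h2 : ∏ j, ∏ k ∈ Finset.Iio j, |x j - x k| = ∏ j, ∏ k ∈ Finset.Ioi j, |x j - x k| := by
    rw [Finset.prod_comm' (s' := fun j => Finset.Ioi j) (t' := Finset.univ) (by simp)]
    exact Finset.prod_congr rfl fun _ _ => Finset.prod_congr rfl fun _ _ => abs_sub_comm _ _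
  rw [h2, ← sq, vdm]
  simp only [Finset.abs_prod]

theorem prod_erase_eq_prod_succAbove {K : ℕ} (f : Fin (K + 1) → ℝ) (j : Fin (K + 1)) :
    ∏ k ∈ Finset.univ.erase j, f k = ∏ l, f (j.succAbove l) := by
  have : (Finset.univ.erase j : Finset (Fin (K + 1))) = Finset.univ.map j.succAboveEmb := by
    ext k
    simp [Fin.exists_succAbove_eq_iff]
  rw [this, Finset.prod_map]
  rfl

/-- Evaluation at the nodes is the Vandermonde matrix applied to coefficient vectors. The lemma is
used at two systems of nodes: one makes the evaluation matrix triangular and yields the coefficient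
determinant, the other is `δ` and yields the Jacobian. -/
theorem det_eval_eq_det_vandermonde_mul {N : ℕ} (v : Fin N → ℝ) (p : Fin N → ℝ[X])
    (hp : ∀ c, (p c).degree < N) :
    (Matrix.of fun r c => (p c).eval (v r)).det =
      (Matrix.vandermonde v).det * (Matrix.of fun r c : Fin N => (p c).coeff r).det := by
  rw [← Matrix.det_mul]
  congr 1
  ext r c
  rcases Nat.eq_zero_or_pos N with rfl | hN
  · exact r.elim0
  · have : (p c).natDegree < N := by
      by_cases h0 : p c = 0
      · simpa [h0] using hN
      · exact (Polynomial.natDegree_lt_iff_degree_lt h0).2 (hp c)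
    rw [Matrix.of_apply, Polynomial.eval_eq_sum_range' this, Matrix.mul_apply,
      Finset.sum_range]
    simp [Matrix.vandermonde, mul_comm]

/-- The sequences that strictly interlace the decreasing sequence `δ`. -/
def interlace {K : ℕ} (δ : Fin (K + 1) → ℝ) : Set (Fin K → ℝ) :=
  {b | ∀ l, δ l.succ < b l ∧ b l < δ l.castSucc}

theorem strictAnti_of_mem_interlace {K : ℕ} {δ : Fin (K + 1) → ℝ} (hδ : StrictAnti δ)
    {b : Fin K → ℝ} (hb : b ∈ interlace δ) : StrictAnti b := by
  intro l m hlm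
  refine (hb m).2.trans_le (le_trans ?_ (hb l).1.le)
  exact hδ.antitone (by rw [Fin.succ_le_castSucc_iff]; exact hlm)

theorem isOpen_interlace {K : ℕ} (δ : Fin (K + 1) → ℝ) : IsOpen (interlace δ) := by
  simp only [interlace, Set.ofPred_forall]
  exact isOpen_iInter_of_finite fun l =>
    (isOpen_lt continuous_const (continuous_apply l)).inter
      (isOpen_lt (continuous_apply l) continuous_const)

/-- The quotient of a factor `δ_j - b_l` by the matching factor of `∏_{k ≠ j} (δ_j - δ_k)`. -/
def ratio {K : ℕ} (δ : Fin (K + 1) → ℝ) (b : Fin K → ℝ) (j : Fin (K + 1)) (l : Fin K) : ℝ :=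
  (δ j - b l) / (δ j - δ (j.succAbove l))

theorem ratio_pos {K : ℕ} {δ : Fin (K + 1) → ℝ} (hδ : StrictAnti δ) {b : Fin K → ℝ}
    (hb : b ∈ interlace δ) (j : Fin (K + 1)) (l : Fin K) : 0 < ratio δ b j l := by
  rw [ratio]
  rcases lt_or_ge l.castSucc j with h | h
  · rw [Fin.succAbove_of_castSucc_lt _ _ h]
    have h1 := (hb l).1
    have h2 : δ j ≤ δ l.succ := hδ.antitone (Fin.castSucc_lt_iff_succ_le.1 h)
    exact div_pos_of_neg_of_neg (by linarith) (sub_neg.2 (hδ h))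
  · rw [Fin.succAbove_of_le_castSucc _ _ h]
    have h1 := (hb l).2
    have h2 : δ l.castSucc ≤ δ j := hδ.antitone h
    exact div_pos (by linarith) (sub_pos.2 (hδ (h.trans_lt Fin.castSucc_lt_succ)))

/-- The residues of `T ∏ (X - b_l) / ∏ (X - δ_j)`, where `x = (T, b_1, …, b_K)`. -/
def residue {K : ℕ} (δ : Fin (K + 1) → ℝ) (x : Fin (K + 1) → ℝ) (j : Fin (K + 1)) : ℝ :=
  x 0 * ∏ l, ratio δ (Fin.tail x) j l

/-- The polynomial `∑_j y_j ∏_{k ≠ j} (X - δ_k)`. -/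
def nodePoly {K : ℕ} (δ y : Fin (K + 1) → ℝ) : ℝ[X] :=
  ∑ j, C (y j) * ∏ l, (X - C (δ (j.succAbove l)))

theorem degree_prod_X_sub_C {ι : Type*} (s : Finset ι) (b : ι → ℝ) :
    (∏ l ∈ s, (X - C (b l))).degree = (s.card : WithBot ℕ) := by
  rw [Polynomial.degree_prod]
  simp

theorem degree_C_mul_prod_lt {K : ℕ} (T : ℝ) (b : Fin K → ℝ) :
    (C T * ∏ l, (X - C (b l))).degree < ((K + 1 : ℕ) : WithBot ℕ) := by
  refine (Polynomial.degree_mul_le _ _).trans_lt ?_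
  rw [degree_prod_X_sub_C]
  simp only [Finset.card_univ, Fintype.card_fin]
  refine (add_le_add_left Polynomial.degree_C_le _).trans_lt ?_
  rw [zero_add]
  exact_mod_cast Nat.lt_succ_self K

theorem coeff_prod_X_sub_C {K : ℕ} (b : Fin K → ℝ) :
    (∏ l, (X - C (b l))).coeff K = 1 := by
  have h3 : (∏ l, (X - C (b l))).natDegree = K := by
    rw [Polynomial.natDegree_prod_of_monic _ _ fun l _ => monic_X_sub_C _]
    simp
  have := (monic_prod_X_sub_C b Finset.univ).coeff_natDegree
  rwa [h3] at this

theorem degree_nodePoly_lt {K : ℕ} (δ y : Fin (K + 1) → ℝ) :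
    (nodePoly δ y).degree < ((K + 1 : ℕ) : WithBot ℕ) :=
  (Polynomial.degree_sum_le _ _).trans_lt <|
    (Finset.sup_lt_iff (by exact_mod_cast WithBot.bot_lt_coe (K + 1))).2
      fun _ _ => degree_C_mul_prod_lt _ _

theorem coeff_nodePoly {K : ℕ} (δ y : Fin (K + 1) → ℝ) : (nodePoly δ y).coeff K = ∑ j, y j := by
  rw [nodePoly, Polynomial.finsetSum_coeff]
  refine Finset.sum_congr rfl fun j _ => ?_
  rw [Polynomial.coeff_C_mul, coeff_prod_X_sub_C, mul_one]

theorem eval_nodePoly {K : ℕ} (δ y : Fin (K + 1) → ℝ) (j : Fin (K + 1)) :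
    (nodePoly δ y).eval (δ j) = y j * ∏ l, (δ j - δ (j.succAbove l)) := by
  rw [nodePoly, Polynomial.eval_finsetSum, Finset.sum_eq_single j]
  · simp [Polynomial.eval_prod]
  · intro k _ hk
    obtain ⟨l, hl⟩ := Fin.exists_succAbove_eq hk.symm
    rw [Polynomial.eval_mul, Polynomial.eval_prod,
      Finset.prod_eq_zero (Finset.mem_univ l) (by simp [hl]), mul_zero]
  · simp

theorem prod_node_ne_zero {K : ℕ} {δ : Fin (K + 1) → ℝ} (hδ : Function.Injective δ)
    (j : Fin (K + 1)) : ∏ l, (δ j - δ (j.succAbove l)) ≠ 0 :=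
  Finset.prod_ne_zero_iff.2 fun l _ =>
    sub_ne_zero.2 fun h => Fin.succAbove_ne j l (hδ h).symm

/-- `y` consists of the residues of `(T, b)` iff `∑ y_j ∏_{k≠j} (X - δ_k) = T ∏ (X - b_l)`. -/
theorem nodePoly_eq_iff {K : ℕ} {δ : Fin (K + 1) → ℝ} (hδ : Function.Injective δ)
    (y x : Fin (K + 1) → ℝ) :
    nodePoly δ y = C (x 0) * ∏ l, (X - C (Fin.tail x l)) ↔ y = residue δ x := by
  have key : ∀ j, (y j * ∏ l, (δ j - δ (j.succAbove l)) = x 0 * ∏ l, (δ j - Fin.tail x l)) ↔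
      y j = residue δ x j := by
    intro j
    rw [residue]
    simp only [ratio, Finset.prod_div_distrib]
    rw [← mul_div_assoc, eq_div_iff (prod_node_ne_zero hδ j)]
  constructor
  · intro h
    funext j
    rw [← key, ← eval_nodePoly, h]
    simp [Polynomial.eval_prod]
  · intro h
    refine Polynomial.eq_of_degrees_lt_of_eval_index_eq (v := δ) Finset.univ hδ.injOn ?_ ?_ ?_
    · simpa using degree_nodePoly_lt δ y
    · simpa using degree_C_mul_prod_lt (x 0) (Fin.tail x)
    · intro j _
      rw [eval_nodePoly, (key j).2 (congrFun h j)]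
      simp [Polynomial.eval_prod]

/-- Compare the coefficients of `X ^ K` in `∑ y_j ∏_{k≠j} (X - δ_k) = T ∏ (X - b_l)`. This identity
turns the product of the factors `exp(-y_j)` into a function of `T` alone. -/
theorem sum_residue {K : ℕ} {δ : Fin (K + 1) → ℝ} (hδ : Function.Injective δ)
    (x : Fin (K + 1) → ℝ) : ∑ j, residue δ x j = x 0 := by
  have h := (nodePoly_eq_iff hδ (residue δ x) x).2 rfl
  have h2 := congrArg (fun p => Polynomial.coeff p K) h
  simp only [coeff_nodePoly] at h2
  rw [h2, Polynomial.coeff_C_mul, coeff_prod_X_sub_C, mul_one]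

/-- The domain of the Dixon–Anderson change of variables. -/
def daDomain {K : ℕ} (δ : Fin (K + 1) → ℝ) : Set (Fin (K + 1) → ℝ) :=
  {x | 0 < x 0 ∧ Fin.tail x ∈ interlace δ}

theorem residue_pos {K : ℕ} {δ : Fin (K + 1) → ℝ} (hδ : StrictAnti δ) {x : Fin (K + 1) → ℝ}
    (hx : x ∈ daDomain δ) (j : Fin (K + 1)) : 0 < residue δ x j :=
  mul_pos hx.1 (Finset.prod_pos fun l _ => ratio_pos hδ hx.2 j l)

/-- The residues determine the polynomial `T ∏ (X - b_l)`, hence `T` and the set of roots. The gaps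
between consecutive nodes are disjoint, so a root lying in gap `l` can only be the `l`-th one. -/
theorem injOn_residue {K : ℕ} {δ : Fin (K + 1) → ℝ} (hδ : StrictAnti δ) :
    Set.InjOn (residue δ) (daDomain δ) := by
  intro x hx x' hx' h
  have h0 : x 0 = x' 0 := by
    rw [← sum_residue hδ.injective x, h, sum_residue hδ.injective x']
  have hp : C (x 0) * ∏ l, (X - C (Fin.tail x l)) = C (x' 0) * ∏ l, (X - C (Fin.tail x' l)) := by
    rw [← (nodePoly_eq_iff hδ.injective (residue δ x) x).2 rfl,
      (nodePoly_eq_iff hδ.injective (residue δ x) x').2 h]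
  have ht : ∀ l, Fin.tail x l = Fin.tail x' l := by
    intro l
    have h2 := congrArg (Polynomial.eval (Fin.tail x l)) hp
    simp only [Polynomial.eval_mul, Polynomial.eval_C, Polynomial.eval_prod,
      Polynomial.eval_sub, Polynomial.eval_X] at h2
    rw [Finset.prod_eq_zero (Finset.mem_univ l) (sub_self _), mul_zero, eq_comm, mul_eq_zero,
      or_iff_right hx'.1.ne', Finset.prod_eq_zero_iff] at h2
    obtain ⟨m, -, hm⟩ := h2
    rw [sub_eq_zero] at hm
    have h3 := hx.2 l
    have h4 := hx'.2 m
    rw [← hm] at h4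
    have hlm : l = m := by
      rcases lt_trichotomy l m with hlt | heq | hgt
      · have := hδ.antitone (Fin.succ_le_castSucc_iff.2 hlt)
        linarith [h3.1, h4.2]
      · exact heq
      · have := hδ.antitone (Fin.succ_le_castSucc_iff.2 hgt)
        linarith [h3.2, h4.1]
    rw [hlm] at hm ⊢
    exact hm
  funext j
  refine Fin.cases h0 (fun l => ht l) j

/-- For two consecutive nodes, the differences to any third node have the same sign, while the
differences to each other have opposite signs. This is the sign change that puts a root in every
gap. -/
theorem prod_node_mul_neg {K : ℕ} {δ : Fin (K + 1) → ℝ} (hδ : StrictAnti δ) (l : Fin K) :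
    (∏ m, (δ l.castSucc - δ (l.castSucc.succAbove m))) *
      ∏ m, (δ l.succ - δ (l.succ.succAbove m)) < 0 := by
  rw [← Finset.prod_mul_distrib, ← Finset.mul_prod_erase _ _ (Finset.mem_univ l)]
  refine mul_neg_of_neg_of_pos ?_ (Finset.prod_pos fun m hm => ?_)
  · have h : δ l.succ < δ l.castSucc := hδ Fin.castSucc_lt_succ
    simp only [Fin.succAbove_castSucc_self, Fin.succAbove_succ_self]
    nlinarith
  · have hml : m ≠ l := Finset.ne_of_mem_erase hm
    rcases lt_or_gt_of_ne hml with h | h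
    · have h1 : m.castSucc < l.castSucc := h
      have h2 : m.castSucc < l.succ := h1.trans Fin.castSucc_lt_succ
      rw [Fin.succAbove_of_castSucc_lt _ _ h1, Fin.succAbove_of_castSucc_lt _ _ h2]
      exact mul_pos_of_neg_of_neg (sub_neg.2 (hδ h1)) (sub_neg.2 (hδ h2))
    · have h1 : l.castSucc ≤ m.castSucc := h.le
      have h2 : l.succ ≤ m.castSucc := Fin.succ_le_castSucc_iff.2 h
      rw [Fin.succAbove_of_le_castSucc _ _ h1, Fin.succAbove_of_le_castSucc _ _ h2]
      exact mul_pos (sub_pos.2 (hδ (h1.trans_lt Fin.castSucc_lt_succ)))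
        (sub_pos.2 (hδ (h2.trans_lt Fin.castSucc_lt_succ)))

/-- For positive weights the polynomial `∑_j y_j ∏_{k≠j} (X - δ_k)` has interlacing roots. -/
theorem exists_interlace {K : ℕ} {δ : Fin (K + 1) → ℝ} (hδ : StrictAnti δ)
    {y : Fin (K + 1) → ℝ} (hy : ∀ j, 0 < y j) :
    ∃ x ∈ daDomain δ, residue δ x = y := by
  have hroot : ∀ l : Fin K, ∃ b ∈ Set.Ioo (δ l.succ) (δ l.castSucc),
      (nodePoly δ y).eval b = 0 := by
    intro l
    have hlt : δ l.succ < δ l.castSucc := hδ Fin.castSucc_lt_succ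
    have hcont : ContinuousOn (fun t => (nodePoly δ y).eval t)
        (Set.Icc (δ l.succ) (δ l.castSucc)) := (nodePoly δ y).continuous.continuousOn
    have hneg : (nodePoly δ y).eval (δ l.castSucc) * (nodePoly δ y).eval (δ l.succ) < 0 := by
      rw [eval_nodePoly, eval_nodePoly]
      have := mul_neg_of_pos_of_neg (mul_pos (hy l.castSucc) (hy l.succ)) (prod_node_mul_neg hδ l)
      nlinarith
    rcases mul_neg_iff.1 hneg with ⟨h1, h2⟩ | ⟨h1, h2⟩
    · obtain ⟨b, hb, hb0⟩ := intermediate_value_Ioo hlt.le hcont ⟨h2, h1⟩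
      exact ⟨b, hb, hb0⟩
    · obtain ⟨b, hb, hb0⟩ := intermediate_value_Ioo' hlt.le hcont ⟨h1, h2⟩
      exact ⟨b, hb, hb0⟩
  choose b hb hb0 using hroot
  have hbI : b ∈ interlace δ := fun l => hb l
  have hbinj := (strictAnti_of_mem_interlace hδ hbI).injective
  -- The value of `T` is forced by the leading coefficient. With it, the two polynomials agree at
  -- the `K` roots and their difference has degree below `K`.
  refine ⟨Fin.cons (∑ j, y j) b, ⟨?_, by simpa using hbI⟩, ?_⟩
  · simpa using Finset.sum_pos (fun j _ => hy j) Finset.univ_nonempty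
  · refine ((nodePoly_eq_iff hδ.injective y _).1 ?_).symm
    simp only [Fin.cons_zero, Fin.tail_cons]
    refine Polynomial.eq_of_degree_sub_lt_of_eval_index_eq (v := b) Finset.univ hbinj.injOn ?_ ?_
    · rw [Polynomial.degree_lt_iff_coeff_zero]
      intro m hm
      simp only [Finset.card_univ, Fintype.card_fin] at hm
      rcases hm.eq_or_lt with rfl | hm
      · rw [Polynomial.coeff_sub, coeff_nodePoly, Polynomial.coeff_C_mul, coeff_prod_X_sub_C,
          mul_one, sub_self]
      · have h1 := Polynomial.coeff_eq_zero_of_degree_lt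
          ((degree_nodePoly_lt δ y).trans_le (by exact_mod_cast hm : ((K + 1 : ℕ) : WithBot ℕ) ≤ m))
        have h2 := Polynomial.coeff_eq_zero_of_degree_lt
          ((degree_C_mul_prod_lt (∑ j, y j) b).trans_le
            (by exact_mod_cast hm : ((K + 1 : ℕ) : WithBot ℕ) ≤ m))
        rw [Polynomial.coeff_sub, h1, h2, sub_zero]
    · intro l _
      rw [hb0, Polynomial.eval_mul, Polynomial.eval_prod,
        Finset.prod_eq_zero (Finset.mem_univ l) (by simp), mul_zero]

theorem image_residue {K : ℕ} {δ : Fin (K + 1) → ℝ} (hδ : StrictAnti δ) :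
    residue δ '' daDomain δ = {y | ∀ j, 0 < y j} := by
  ext y
  constructor
  · rintro ⟨x, hx, rfl⟩ j
    exact residue_pos hδ hx j
  · intro hy
    obtain ⟨x, hx, h⟩ := exists_interlace hδ hy
    exact ⟨x, hx, h⟩

theorem isOpen_daDomain {K : ℕ} (δ : Fin (K + 1) → ℝ) : IsOpen (daDomain δ) :=
  (isOpen_lt continuous_const (continuous_apply 0)).inter
    ((isOpen_interlace δ).preimage (by unfold Fin.tail; fun_prop))

end InvGrass

end

/-! ### The Jacobian and the Dixon–Anderson integral -/

noncomputable section

namespace InvGrass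

open Polynomial

/-- The partial derivatives of `T ∏ (X - b_l)` with respect to `T, b_1, …, b_K`. -/
def partialPoly {K : ℕ} (T : ℝ) (b : Fin K → ℝ) : Fin (K + 1) → ℝ[X] :=
  Fin.cons (∏ l, (X - C (b l))) fun l => C (-T) * ∏ m ∈ Finset.univ.erase l, (X - C (b m))

theorem degree_partialPoly_lt {K : ℕ} (T : ℝ) (b : Fin K → ℝ) (c : Fin (K + 1)) :
    (partialPoly T b c).degree < ((K + 1 : ℕ) : WithBot ℕ) := by
  refine Fin.cases ?_ (fun l => ?_) c
  · simpa [partialPoly] using degree_C_mul_prod_lt 1 b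
  · simp only [partialPoly, Fin.cons_succ]
    refine (Polynomial.degree_mul_le _ _).trans_lt ?_
    rw [degree_prod_X_sub_C]
    refine (add_le_add_left Polynomial.degree_C_le _).trans_lt ?_
    rw [zero_add]
    have : (Finset.univ.erase l).card ≤ K := by
      simp
    exact_mod_cast Nat.lt_succ_of_le this

theorem vdm_cons {K : ℕ} (z : ℝ) (b : Fin K → ℝ) :
    vdm (Fin.cons z b : Fin (K + 1) → ℝ) = (∏ l, (z - b l)) * vdm b := by
  simp [vdm, Fin.prod_univ_succ, Fin.prod_Ioi_succ]

/-- Evaluate at `b_1, …, b_K` and one auxiliary node `z` above them all. Each partial derivative in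
`b_l` vanishes at every other root, and the partial derivative in `T` vanishes at all of them, so
the evaluation matrix is triangular. Dividing its determinant by the Vandermonde determinant of `(z,
b)` removes `z`. -/
theorem abs_det_coeff_partialPoly {K : ℕ} {T : ℝ} (hT : 0 < T) {b : Fin K → ℝ}
    (hb : StrictAnti b) :
    |(Matrix.of fun r c : Fin (K + 1) => (partialPoly T b c).coeff r).det| = T ^ K * vdm b := by
  obtain ⟨z, hz⟩ : ∃ z : ℝ, ∀ l, b l < z := by
    obtain ⟨M, hM⟩ := (Set.finite_range b).bddAbove
    exact ⟨M + 1, fun l => (hM ⟨l, rfl⟩).trans_lt (lt_add_one M)⟩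
  have hz' : 0 < ∏ l, (z - b l) := Finset.prod_pos fun l _ => sub_pos.2 (hz l)
  have hV := vdm_pos hb
  have hE := det_eval_eq_det_vandermonde_mul (Fin.cons z b : Fin (K + 1) → ℝ)
    (partialPoly T b) (degree_partialPoly_lt T b)
  have htri : (Matrix.of fun r c => (partialPoly T b c).eval
      ((Fin.cons z b : Fin (K + 1) → ℝ) r)).IsUpperTriangular := by
    intro r c hcr
    simp only [id_eq] at hcr
    rw [Matrix.of_apply]
    obtain ⟨r', rfl⟩ := Fin.exists_succ_eq.2 (Fin.ne_zero_of_lt hcr)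
    rw [Fin.cons_succ]
    revert hcr
    refine Fin.cases (fun _ => ?_) (fun l hl => ?_) c
    · simp only [partialPoly, Fin.cons_zero, Polynomial.eval_prod]
      exact Finset.prod_eq_zero (Finset.mem_univ r') (by simp)
    · have hne : r' ≠ l := fun h => by subst h; exact lt_irrefl _ hl
      simp only [partialPoly, Fin.cons_succ, Polynomial.eval_prod, Polynomial.eval_mul]
      rw [Finset.prod_eq_zero (Finset.mem_erase.2 ⟨hne, Finset.mem_univ r'⟩) (by simp), mul_zero]
  rw [Matrix.det_of_isUpperTriangular htri, Fin.prod_univ_succ] at hE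
  have hE' := congrArg abs hE
  rw [abs_mul, abs_mul, abs_det_vandermonde, vdm_cons, abs_mul, abs_of_pos hz', abs_of_pos hV]
    at hE'
  simp only [Matrix.of_apply, Fin.cons_zero, Fin.cons_succ, partialPoly, Polynomial.eval_prod,
    Polynomial.eval_mul, Polynomial.eval_sub, Polynomial.eval_X, Polynomial.eval_C,
    Finset.prod_mul_distrib, Finset.abs_prod, abs_mul, abs_neg, abs_of_pos hT] at hE'
  rw [prod_prod_erase_abs, abs_of_pos hV, Finset.prod_const, Finset.card_univ,
    Fintype.card_fin] at hE'
  simp only [← Finset.abs_prod, abs_of_pos hz'] at hE'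
  have hne : (∏ l, (z - b l)) * vdm b ≠ 0 := (mul_pos hz' hV).ne'
  refine mul_left_cancel₀ hne (hE'.symm.trans ?_)
  ring

/-- The Jacobian matrix of the residue map. -/
def residueJac {K : ℕ} (δ x : Fin (K + 1) → ℝ) : Matrix (Fin (K + 1)) (Fin (K + 1)) ℝ :=
  Matrix.of fun j c => (∏ l, (δ j - δ (j.succAbove l)))⁻¹ *
    (partialPoly (x 0) (Fin.tail x) c).eval (δ j)

/-- The row factors `1 / ∏_{k≠j} (δ_j - δ_k)` contribute `vdm δ ^ (-2)`, and passing from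
coefficients to values at `δ` contributes `vdm δ`. -/
theorem abs_det_residueJac {K : ℕ} {δ x : Fin (K + 1) → ℝ} (hδ : StrictAnti δ)
    (hx : x ∈ daDomain δ) :
    |(residueJac δ x).det| = x 0 ^ K * (vdm (Fin.tail x) / vdm δ) := by
  have h1 := Matrix.det_mul_column (fun j => (∏ l, (δ j - δ (j.succAbove l)))⁻¹)
    (Matrix.of fun j c => (partialPoly (x 0) (Fin.tail x) c).eval (δ j))
  simp only [Matrix.of_apply] at h1
  rw [residueJac, h1, det_eval_eq_det_vandermonde_mul _ _ (degree_partialPoly_lt _ _), abs_mul,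
    abs_mul, abs_det_vandermonde, abs_det_coeff_partialPoly hx.1
      (strictAnti_of_mem_interlace hδ hx.2), Finset.prod_inv_distrib, abs_inv]
  have h2 : ∏ j, ∏ l, |δ j - δ (j.succAbove l)| = vdm δ ^ 2 := by
    rw [← abs_of_pos (vdm_pos hδ), ← prod_prod_erase_abs]
    exact Finset.prod_congr rfl fun j _ =>
      (prod_erase_eq_prod_succAbove (fun k => |δ j - δ k|) j).symm
  simp only [Finset.abs_prod]
  rw [h2, abs_of_pos (vdm_pos hδ)]
  have := (vdm_pos hδ).ne'
  field_simp

theorem hasFDerivAt_residue {K : ℕ} (δ x : Fin (K + 1) → ℝ) :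
    HasFDerivAt (residue δ) (LinearMap.toContinuousLinearMap (Matrix.toLin' (residueJac δ x))) x := by
  have hrw : residue δ = fun x j => (∏ l, (δ j - δ (j.succAbove l)))⁻¹ *
      (x 0 * ∏ l : Fin K, (δ j - x l.succ)) := by
    funext x j
    simp only [residue, ratio, Finset.prod_div_distrib, Fin.tail]
    ring
  rw [hrw]
  have hcomp : ∀ j, HasFDerivAt (fun x : Fin (K + 1) → ℝ =>
      (∏ l, (δ j - δ (j.succAbove l)))⁻¹ * (x 0 * ∏ l : Fin K, (δ j - x l.succ)))
      ((ContinuousLinearMap.proj j).comp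
        (LinearMap.toContinuousLinearMap (Matrix.toLin' (residueJac δ x)))) x := by
    intro j
    have h0 : HasFDerivAt (fun x : Fin (K + 1) → ℝ => x 0)
      (ContinuousLinearMap.proj (R := ℝ) (φ := fun _ : Fin (K + 1) => ℝ) 0) x := hasFDerivAt_apply 0 x
    have h1 : ∀ l ∈ (Finset.univ : Finset (Fin K)), HasFDerivAt
      (fun x : Fin (K + 1) → ℝ => δ j - x l.succ)
      (-ContinuousLinearMap.proj (R := ℝ) (φ := fun _ : Fin (K + 1) => ℝ) l.succ) x :=
      fun l _ => (hasFDerivAt_apply l.succ x).const_sub (δ j)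
    have h2 := (h0.mul (HasFDerivAt.finsetProd h1)).const_mul (∏ l, (δ j - δ (j.succAbove l)))⁻¹
    refine h2.congr_fderiv ?_
    ext v
    simp [residueJac, Matrix.mulVec, dotProduct, Fin.sum_univ_succ, partialPoly,
      Polynomial.eval_prod, Fin.tail, Finset.mul_sum]
    rw [add_comm]
    congr 1
    · ring
    · exact congrArg Neg.neg (Finset.sum_congr rfl fun l _ => by ring)
  exact hasFDerivAt_pi'.2 hcomp

theorem lintegral_fin_succ {N : ℕ} (F : (Fin (N + 1) → ℝ) → ENNReal) :
    ∫⁻ x, F x = ∫⁻ p : ℝ × (Fin N → ℝ), F (Fin.cons p.1 p.2) := by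
  have h := (volume_preserving_piFinSuccAbove (fun _ : Fin (N + 1) => ℝ) 0).symm
  rw [← h.lintegral_comp_emb (MeasurableEquiv.measurableEmbedding _) F]
  refine lintegral_congr fun p => congrArg F ?_
  funext j
  refine Fin.cases ?_ (fun l => ?_) j <;>
    simp [MeasurableEquiv.piFinSuccAbove_symm_apply, Fin.insertNthEquiv]

theorem lintegral_prod_fin {N : ℕ} {f : Fin N → ℝ → ENNReal} (hf : ∀ j, Measurable (f j)) :
    ∫⁻ x : Fin N → ℝ, ∏ j, f j (x j) = ∏ j, ∫⁻ t, f j t := by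
  induction N with
  | zero => simp [volume_pi]
  | succ N ih =>
    have hm : Measurable fun x : Fin N → ℝ => ∏ j, f j.succ (x j) :=
      Finset.measurable_prod _ fun j _ => (hf _).comp (measurable_pi_apply j)
    rw [lintegral_fin_succ]
    simp only [Fin.prod_univ_succ, Fin.cons_zero, Fin.cons_succ]
    rw [Measure.volume_eq_prod, lintegral_prod_mul (hf 0).aemeasurable hm.aemeasurable,
      ih fun j => hf j.succ]

theorem pi_withDensity {N : ℕ} {f : Fin N → ℝ → ENNReal} (hf : ∀ j, Measurable (f j))
    [∀ j, SigmaFinite ((volume : Measure ℝ).withDensity (f j))] :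
    Measure.pi (fun j => (volume : Measure ℝ).withDensity (f j)) =
      (volume : Measure (Fin N → ℝ)).withDensity fun x => ∏ j, f j (x j) := by
  refine Measure.pi_eq fun s hs => ?_
  rw [withDensity_apply _ (MeasurableSet.univ_pi hs), ← lintegral_indicator (MeasurableSet.univ_pi hs)]
  have : ∀ x : Fin N → ℝ, (Set.univ.pi s).indicator (fun x => ∏ j, f j (x j)) x =
      ∏ j, (s j).indicator (f j) (x j) := by
    intro x
    by_cases hx : x ∈ Set.univ.pi s
    · rw [Set.indicator_of_mem hx]
      exact Finset.prod_congr rfl fun j _ => (Set.indicator_of_mem (hx j trivial) _).symm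
    · rw [Set.indicator_of_notMem hx]
      simp only [Set.mem_pi, Set.mem_univ, true_imp_iff, not_forall] at hx
      obtain ⟨j, hj⟩ := hx
      exact (Finset.prod_eq_zero (Finset.mem_univ j) (Set.indicator_of_notMem hj _)).symm
  simp only [this]
  rw [lintegral_prod_fin fun j => (hf j).indicator (hs j)]
  exact Finset.prod_congr rfl fun j _ => by
    rw [lintegral_indicator (hs j), withDensity_apply _ (hs j)]

theorem lintegral_rpow_mul_exp_neg {s : ℝ} (hs : 0 < s) :
    ∫⁻ t in Set.Ioi (0 : ℝ), ENNReal.ofReal (t ^ (s - 1) * Real.exp (-t)) =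
      ENNReal.ofReal (Real.Gamma s) := by
  rw [Real.Gamma_eq_integral hs, ofReal_integral_eq_lintegral_ofReal]
  · simp only [mul_comm]
  · exact Real.GammaIntegral_convergent hs
  · filter_upwards [ae_restrict_mem measurableSet_Ioi] with t ht
    have : (0 : ℝ) < t := ht
    simp only [Pi.zero_apply]
    positivity

/-- The joint law of the interlacing roots of `∑_j y_j ∏_{k≠j} (X - δ_k)` for independent
gamma-distributed weights `y_j`. -/
theorem lintegral_pi_gammaMeasure {K : ℕ} {δ : Fin (K + 1) → ℝ} (hδ : StrictAnti δ)
    {s : Fin (K + 1) → ℝ} (hs : ∀ j, 0 < s j) {F : (Fin (K + 1) → ℝ) → ENNReal}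
    {φ : (Fin K → ℝ) → ENNReal} (hφ : Measurable φ)
    (hF : ∀ x ∈ daDomain δ, F (residue δ x) = φ (Fin.tail x)) :
    ∫⁻ y, F y ∂(Measure.pi fun j => ProbabilityTheory.gammaMeasure (s j) 1) =
      ENNReal.ofReal (Real.Gamma (∑ j, s j) / ∏ j, Real.Gamma (s j)) *
        ∫⁻ b in interlace δ, φ b *
          ENNReal.ofReal (vdm b / vdm δ * ∏ j, ∏ l, ratio δ b j l ^ (s j - 1)) := by
  have hprob : ∀ j, IsProbabilityMeasure (ProbabilityTheory.gammaMeasure (s j) 1) :=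
    fun j => ProbabilityTheory.isProbabilityMeasure_gammaMeasure (hs j) one_pos
  have hmeas : ∀ j, Measurable (ProbabilityTheory.gammaPDF (s j) 1) :=
    fun j => (ProbabilityTheory.measurable_gammaPDFReal _ _).ennreal_ofReal
  have hS : 0 < ∑ j, s j := Finset.sum_pos (fun j _ => hs j) Finset.univ_nonempty
  have hG : 0 < ∏ j, Real.Gamma (s j) := Finset.prod_pos fun j _ => Real.Gamma_pos_of_pos (hs j)
  have hsf : ∀ j, SigmaFinite ((volume : Measure ℝ).withDensity
      (ProbabilityTheory.gammaPDF (s j) 1)) := fun j => by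
    have := hprob j
    unfold ProbabilityTheory.gammaMeasure at this
    infer_instance
  have hpi : (Measure.pi fun j => ProbabilityTheory.gammaMeasure (s j) 1) =
      (volume : Measure (Fin (K + 1) → ℝ)).withDensity
        fun x => ∏ j, ProbabilityTheory.gammaPDF (s j) 1 (x j) := by
    unfold ProbabilityTheory.gammaMeasure
    exact pi_withDensity hmeas
  have hpos : MeasurableSet {y : Fin (K + 1) → ℝ | ∀ j, 0 < y j} := by
    simp only [Set.ofPred_forall]
    exact MeasurableSet.iInter fun j => measurableSet_lt measurable_const (measurable_pi_apply j)
  have hsupp : ∀ᵐ y : Fin (K + 1) → ℝ, y ∉ {y : Fin (K + 1) → ℝ | ∀ j, 0 < y j} →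
      (∏ j, ProbabilityTheory.gammaPDF (s j) 1 (y j)) = 0 := by
    have h0 : ∀ᵐ y : Fin (K + 1) → ℝ, ∀ j, y j ≠ 0 := by
      rw [ae_all_iff]
      intro j
      rw [ae_iff]
      simpa [volume_pi] using Measure.pi_hyperplane (fun _ : Fin (K + 1) => (volume : Measure ℝ)) j 0
    filter_upwards [h0] with y hy hy'
    simp only [not_forall, not_lt] at hy'
    obtain ⟨j, hj⟩ := hy'
    exact Finset.prod_eq_zero (Finset.mem_univ j)
      (ProbabilityTheory.gammaPDF_of_neg (lt_of_le_of_ne hj (hy j)))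
  have hmp : Measurable fun x : Fin (K + 1) → ℝ => ∏ j, ProbabilityTheory.gammaPDF (s j) 1 (x j) :=
    Finset.measurable_prod _ fun j _ => (hmeas j).comp (measurable_pi_apply j)
  -- `F` is prescribed only on the image of `daDomain δ` and no measurability is assumed for it,
  -- hence the version for arbitrary integrands with a finite density.
  rw [hpi, lintegral_withDensity_eq_lintegral_mul_non_measurable _ hmp
    (Filter.Eventually.of_forall fun x => ENNReal.prod_lt_top fun j _ => ENNReal.ofReal_lt_top)]
  have hset : ∫⁻ y, ((fun x : Fin (K + 1) → ℝ => ∏ j, ProbabilityTheory.gammaPDF (s j) 1 (x j)) * F) y =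
      ∫⁻ y in {y : Fin (K + 1) → ℝ | ∀ j, 0 < y j},
        (∏ j, ProbabilityTheory.gammaPDF (s j) 1 (y j)) * F y := by
    rw [← lintegral_indicator hpos]
    refine lintegral_congr_ae ?_
    filter_upwards [hsupp] with y hy
    by_cases h : y ∈ {y : Fin (K + 1) → ℝ | ∀ j, 0 < y j}
    · rw [Set.indicator_of_mem h]; rfl
    · rw [Set.indicator_of_notMem h, Pi.mul_apply, hy h, zero_mul]
  rw [hset, ← image_residue hδ, lintegral_image_eq_lintegral_abs_det_fderiv_mul volume
    (isOpen_daDomain δ).measurableSet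
    (fun x _ => (hasFDerivAt_residue δ x).hasFDerivWithinAt) (injOn_residue hδ)]
  have hpull : ∀ x ∈ daDomain δ,
      ENNReal.ofReal |(LinearMap.toContinuousLinearMap (Matrix.toLin' (residueJac δ x))).det| *
        ((∏ j, ProbabilityTheory.gammaPDF (s j) 1 (residue δ x j)) * F (residue δ x)) =
      ENNReal.ofReal (x 0 ^ (∑ j, s j - 1) * Real.exp (-x 0)) *
        (ENNReal.ofReal (1 / ∏ j, Real.Gamma (s j)) * (φ (Fin.tail x) *
          ENNReal.ofReal (vdm (Fin.tail x) / vdm δ *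
            ∏ j, ∏ l, ratio δ (Fin.tail x) j l ^ (s j - 1)))) := by
    intro x hx
    have hx0 : 0 < x 0 := hx.1
    have hr : ∀ j l, 0 < ratio δ (Fin.tail x) j l := ratio_pos hδ hx.2
    have hpdf : ∀ j, ProbabilityTheory.gammaPDF (s j) 1 (residue δ x j) =
        ENNReal.ofReal (1 / Real.Gamma (s j) * (x 0 ^ (s j - 1) *
          ∏ l, ratio δ (Fin.tail x) j l ^ (s j - 1)) * Real.exp (-residue δ x j)) := by
      intro j
      rw [ProbabilityTheory.gammaPDF_of_nonneg (residue_pos hδ hx j).le, Real.one_rpow, one_mul]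
      congr 3
      rw [residue, Real.mul_rpow hx0.le (Finset.prod_pos fun l _ => hr j l).le,
        Real.finsetProd_rpow _ _ fun l _ => (hr j l).le]
    have hnn : ∀ j, 0 ≤ 1 / Real.Gamma (s j) * (x 0 ^ (s j - 1) *
          ∏ l, ratio δ (Fin.tail x) j l ^ (s j - 1)) * Real.exp (-residue δ x j) := by
      intro j
      have := Real.Gamma_pos_of_pos (hs j)
      have : 0 < ∏ l, ratio δ (Fin.tail x) j l ^ (s j - 1) :=
        Finset.prod_pos fun l _ => Real.rpow_pos_of_pos (hr j l) _
      positivity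
    have hdet : |(LinearMap.toContinuousLinearMap (Matrix.toLin' (residueJac δ x))).det| =
        x 0 ^ K * (vdm (Fin.tail x) / vdm δ) := by
      rw [LinearMap.det_toContinuousLinearMap, LinearMap.det_toLin', abs_det_residueJac hδ hx]
    -- The Jacobian supplies `T ^ K` and the `K + 1` gamma densities supply `T ^ (s_j - 1)`.
    -- Together they form a gamma density of shape `∑ s_j`.
    have hpow : x 0 ^ K * ∏ j, x 0 ^ (s j - 1) = x 0 ^ (∑ j, s j - 1) := by
      rw [← Real.rpow_sum_of_pos hx0, ← Real.rpow_natCast, ← Real.rpow_add hx0]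
      congr 1
      simp
      ring
    have hexp : ∏ j, Real.exp (-residue δ x j) = Real.exp (-x 0) := by
      rw [← Real.exp_sum, Finset.sum_neg_distrib, sum_residue hδ.injective]
    have hv : 0 ≤ vdm (Fin.tail x) / vdm δ :=
      (div_pos (vdm_pos (strictAnti_of_mem_interlace hδ hx.2)) (vdm_pos hδ)).le
    have hP : 0 ≤ ∏ j, ∏ l, ratio δ (Fin.tail x) j l ^ (s j - 1) :=
      Finset.prod_nonneg fun j _ => Finset.prod_nonneg fun l _ => (Real.rpow_pos_of_pos (hr j l) _).le
    rw [hdet, hF x hx]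
    simp only [hpdf]
    rw [← ENNReal.ofReal_prod_of_nonneg fun j _ => hnn j, ← mul_assoc,
      ← ENNReal.ofReal_mul (by positivity), mul_comm (φ _), ← mul_assoc, ← mul_assoc,
      ← ENNReal.ofReal_mul (by positivity), ← ENNReal.ofReal_mul (by positivity)]
    congr 2
    simp only [Finset.prod_mul_distrib]
    rw [hexp, ← hpow]
    simp only [Finset.prod_div_distrib, Finset.prod_const_one]
    ring
  rw [setLIntegral_congr_fun (isOpen_daDomain δ).measurableSet hpull,
    ← lintegral_indicator (isOpen_daDomain δ).measurableSet, lintegral_fin_succ]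
  -- The integrand is a function of `T` times a function of `b`, that is, the total weight is
  -- independent of the roots. The `T`-integral produces the factor `Γ(∑ s_j)`.
  have hsplit : ∀ p : ℝ × (Fin K → ℝ), (daDomain δ).indicator (fun x : Fin (K + 1) → ℝ =>
      ENNReal.ofReal (x 0 ^ (∑ j, s j - 1) * Real.exp (-x 0)) *
        (ENNReal.ofReal (1 / ∏ j, Real.Gamma (s j)) * (φ (Fin.tail x) *
          ENNReal.ofReal (vdm (Fin.tail x) / vdm δ *
            ∏ j, ∏ l, ratio δ (Fin.tail x) j l ^ (s j - 1))))) (Fin.cons p.1 p.2) =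
      (Set.Ioi (0 : ℝ)).indicator (fun t => ENNReal.ofReal (t ^ (∑ j, s j - 1) * Real.exp (-t))) p.1
      * (interlace δ).indicator (fun b => ENNReal.ofReal (1 / ∏ j, Real.Gamma (s j)) * (φ b *
          ENNReal.ofReal (vdm b / vdm δ * ∏ j, ∏ l, ratio δ b j l ^ (s j - 1)))) p.2 := by
    rintro ⟨t, b⟩
    by_cases ht : 0 < t <;> by_cases hb : b ∈ interlace δ <;>
      simp [Set.indicator, daDomain, ht, hb]
  have hmt : Measurable (fun b : Fin K → ℝ => φ b *
          ENNReal.ofReal (vdm b / vdm δ * ∏ j, ∏ l, ratio δ b j l ^ (s j - 1))) := by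
    unfold vdm ratio
    fun_prop
  simp only [hsplit]
  rw [Measure.volume_eq_prod, lintegral_prod_mul, lintegral_indicator measurableSet_Ioi,
    lintegral_rpow_mul_exp_neg hS, lintegral_indicator (isOpen_interlace δ).measurableSet,
    lintegral_const_mul _ hmt, ← mul_assoc, ← ENNReal.ofReal_mul (Real.Gamma_pos_of_pos hS).le,
    mul_one_div]
  · exact (Measurable.indicator (by fun_prop) measurableSet_Ioi).aemeasurable
  · exact ((hmt.const_mul _).indicator (isOpen_interlace δ).measurableSet).aemeasurable

end InvGrass

end

/-! ### Haar measure, Gaussian vectors and gamma variables -/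

noncomputable section

namespace InvGrass

open ProbabilityTheory

theorem isHaarMeasure_haarOn (n : ℕ) : (haarOn n).IsHaarMeasure := by
  unfold haarOn; infer_instance

/-- A right translate of a Haar probability measure is again one, and there is only one. -/
instance (n : ℕ) : (haarOn n).IsMulRightInvariant := by
  refine ⟨fun g => ?_⟩
  have := isHaarMeasure_haarOn n
  have h1 : IsProbabilityMeasure ((haarOn n).map (· * g)) :=
    Measure.isProbabilityMeasure_map (measurable_mul_const g).aemeasurable
  exact Measure.isHaarMeasure_eq_of_isProbabilityMeasure _ _

/-- The inverted measure is left invariant, hence a multiple of `haarOn n`, and comparing total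
masses gives the factor `1`. Inversion later exchanges the roles of the fixed and the random
subspace. -/
instance (n : ℕ) : (haarOn n).IsInvInvariant := by
  refine ⟨?_⟩
  have := isHaarMeasure_haarOn n
  have h1 : IsProbabilityMeasure ((haarOn n).inv) :=
    Measure.isProbabilityMeasure_map measurable_inv.aemeasurable
  have h2 := Measure.isMulInvariant_eq_smul_of_compactSpace (haarOn n).inv (haarOn n)
  have h3 := congrArg (fun μ : Measure (On n) => μ Set.univ) h2
  simp only [measure_univ, Measure.smul_apply, ENNReal.smul_def, smul_eq_mul, mul_one] at h3
  have h4 : Measure.haarScalarFactor (haarOn n).inv (haarOn n) = 1 := by exact_mod_cast h3.symm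
  rw [h2, h4, one_smul]

theorem lintegral_fun_norm {E : Type*} [NormedAddCommGroup E] [NormedSpace ℝ E]
    [MeasurableSpace E] [BorelSpace E] [FiniteDimensional ℝ E] [Nontrivial E] (μ : Measure E)
    [μ.IsAddHaarMeasure] (f : ℝ → ENNReal) (hf : Measurable f) :
    ∫⁻ x, f ‖x‖ ∂μ = μ.toSphere Set.univ *
      ∫⁻ r in Set.Ioi (0 : ℝ), ENNReal.ofReal (r ^ (Module.finrank ℝ E - 1)) * f r := by
  calc ∫⁻ x, f ‖x‖ ∂μ = ∫⁻ x : ({(0)}ᶜ : Set E), f (‖x.1‖) ∂(μ.comap (↑)) := by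
        rw [lintegral_subtype_comap (measurableSet_singleton _).compl fun x ↦ f (‖x‖),
          restrict_compl_singleton]
    _ = ∫⁻ x, f x.2 ∂μ.toSphere.prod (.volumeIoiPow (Module.finrank ℝ E - 1)) := by
      simpa using μ.measurePreserving_homeomorphUnitSphereProd.lintegral_comp_emb
        (Homeomorph.measurableEmbedding _) (f ∘ Subtype.val ∘ Prod.snd)
    _ = μ.toSphere Set.univ * ∫⁻ x : Set.Ioi (0 : ℝ), f x
          ∂.volumeIoiPow (Module.finrank ℝ E - 1) := by
      rw [lintegral_prod _ (by fun_prop)]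
      simp [mul_comm]
    _ = _ := by
      congr 1
      rw [Measure.volumeIoiPow, lintegral_withDensity_eq_lintegral_mul _ (by fun_prop)
        (by fun_prop)]
      exact lintegral_subtype_comap measurableSet_Ioi
        fun a : ℝ => ENNReal.ofReal (a ^ (Module.finrank ℝ E - 1)) * f a

theorem pi_gaussianReal_eq {m : ℕ} :
    (Measure.pi fun _ : Fin m => gaussianReal 0 1) =
      (volume : Measure (Fin m → ℝ)).withDensity fun x =>
        ENNReal.ofReal (((√(2 * Real.pi))⁻¹) ^ m * Real.exp (-(∑ j, x j ^ 2) / 2)) := by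
  have h1 : gaussianReal 0 1 = (volume : Measure ℝ).withDensity (gaussianPDF 0 1) :=
    gaussianReal_of_var_ne_zero 0 one_ne_zero
  have h2 : IsProbabilityMeasure ((volume : Measure ℝ).withDensity (gaussianPDF 0 1)) := by
    rw [← h1]; infer_instance
  rw [h1, pi_withDensity fun _ => measurable_gaussianPDF 0 1]
  congr 1
  funext x
  simp only [gaussianPDF]
  rw [← ENNReal.ofReal_prod_of_nonneg fun j _ => gaussianPDFReal_nonneg _ _ _]
  congr 1
  simp only [gaussianPDFReal, Finset.prod_mul_distrib, Finset.prod_const, Finset.card_univ,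
    Fintype.card_fin, ← Real.exp_sum]
  simp [Finset.sum_div, neg_div]

/-- The substitution `y = r² / 2`, which carries the radial Gaussian density to a gamma density. -/
theorem lintegral_half_sq (f : ℝ → ENNReal) :
    ∫⁻ y in Set.Ioi (0 : ℝ), f y = ∫⁻ r in Set.Ioi (0 : ℝ), ENNReal.ofReal r * f (r ^ 2 / 2) := by
  have himg : (fun r : ℝ => r ^ 2 / 2) '' Set.Ioi 0 = Set.Ioi 0 := by
    ext y
    constructor
    · rintro ⟨r, hr, rfl⟩
      have : (0 : ℝ) < r := hr
      exact (by positivity : (0 : ℝ) < r ^ 2 / 2)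
    · intro hy
      have hy' : (0 : ℝ) < y := hy
      refine ⟨√(2 * y), Real.sqrt_pos.2 (by positivity), ?_⟩
      simp only
      rw [Real.sq_sqrt (by positivity)]
      ring
  have hinj : Set.InjOn (fun r : ℝ => r ^ 2 / 2) (Set.Ioi 0) := by
    intro r hr s hs h
    have hr' : (0 : ℝ) < r := hr
    have hs' : (0 : ℝ) < s := hs
    simp only at h
    exact (sq_eq_sq₀ hr'.le hs'.le).1 (by linarith)
  conv_lhs => rw [← himg]
  rw [lintegral_image_eq_lintegral_abs_deriv_mul measurableSet_Ioi (f' := fun r => r)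
    (fun r _ => by
      have := ((hasDerivAt_pow 2 r).div_const 2).hasDerivWithinAt (s := Set.Ioi 0)
      simpa using this) hinj]
  refine setLIntegral_congr_fun measurableSet_Ioi fun r hr => ?_
  have hr' : (0 : ℝ) < r := hr
  simp only [abs_of_pos hr']

/-- Half the sum of the squares of `m` independent standard Gaussian variables has the gamma
distribution with shape `m / 2`. -/
theorem map_half_sum_sq {m : ℕ} (hm : 0 < m) :
    (Measure.pi fun _ : Fin m => gaussianReal 0 1).map (fun x => (∑ j, x j ^ 2) / 2) =
      gammaMeasure ((m : ℝ) / 2) 1 := by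
  have hmeas : Measurable fun x : Fin m → ℝ => (∑ j, x j ^ 2) / 2 := by fun_prop
  have hm2 : (0 : ℝ) < (m : ℝ) / 2 := by positivity
  have hp1 : IsProbabilityMeasure ((Measure.pi fun _ : Fin m => gaussianReal 0 1).map
      (fun x => (∑ j, x j ^ 2) / 2)) := Measure.isProbabilityMeasure_map hmeas.aemeasurable
  have hp2 := isProbabilityMeasure_gammaMeasure hm2 one_pos
  have hpdf : Measurable (gammaPDF ((m : ℝ) / 2) 1) :=
    (measurable_gammaPDFReal _ _).ennreal_ofReal
  have : Nontrivial (EuclideanSpace ℝ (Fin m)) := by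
    have : Nonempty (Fin m) := ⟨⟨0, hm⟩⟩
    infer_instance
  -- Polar coordinates show that the two laws are proportional. The area of the sphere never has to
  -- be known, since both laws are probability measures.
  obtain ⟨c, hc⟩ : ∃ c : ENNReal, ∀ f : ℝ → ENNReal, Measurable f →
      ∫⁻ t, f t ∂((Measure.pi fun _ : Fin m => gaussianReal 0 1).map
        (fun x => (∑ j, x j ^ 2) / 2)) = c * ∫⁻ t, f t ∂(gammaMeasure ((m : ℝ) / 2) 1) := by
    refine ⟨(volume : Measure (EuclideanSpace ℝ (Fin m))).toSphere Set.univ *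
      ENNReal.ofReal (((√(2 * Real.pi))⁻¹) ^ m * 2 ^ ((m : ℝ) / 2 - 1) *
        Real.Gamma ((m : ℝ) / 2)), fun f hf => ?_⟩
    have hG := Real.Gamma_pos_of_pos hm2
    rw [lintegral_map hf hmeas, pi_gaussianReal_eq,
      lintegral_withDensity_eq_lintegral_mul _ (by fun_prop) (by fun_prop),
      ← (PiLp.volume_preserving_ofLp (Fin m)).lintegral_comp (by fun_prop)]
    have h1 : ∀ x : EuclideanSpace ℝ (Fin m),
        ((fun x : Fin m → ℝ => ENNReal.ofReal (((√(2 * Real.pi))⁻¹) ^ m *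
          Real.exp (-(∑ j, x j ^ 2) / 2))) * fun x : Fin m → ℝ => f ((∑ j, x j ^ 2) / 2))
          (WithLp.ofLp x) =
        (fun r : ℝ => ENNReal.ofReal (((√(2 * Real.pi))⁻¹) ^ m * Real.exp (-r ^ 2 / 2)) *
          f (r ^ 2 / 2)) ‖x‖ := by
      intro x
      simp only [Pi.mul_apply, EuclideanSpace.real_norm_sq_eq]
    refine (lintegral_congr h1).trans ?_
    rw [lintegral_fun_norm (volume : Measure (EuclideanSpace ℝ (Fin m)))
      (fun r : ℝ => ENNReal.ofReal (((√(2 * Real.pi))⁻¹) ^ m * Real.exp (-r ^ 2 / 2)) *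
          f (r ^ 2 / 2)) (by fun_prop), finrank_euclideanSpace, Fintype.card_fin,
      mul_assoc, gammaMeasure, lintegral_withDensity_eq_lintegral_mul _ hpdf hf]
    congr 1
    have h2 : ∫⁻ y, (gammaPDF ((m : ℝ) / 2) 1 * f) y = ∫⁻ y in Set.Ioi (0 : ℝ),
        (gammaPDF ((m : ℝ) / 2) 1 * f) y := by
      rw [← lintegral_add_compl _ (measurableSet_Ioi (a := (0 : ℝ))), Set.compl_Ioi,
        ← setLIntegral_congr Iio_ae_eq_Iic, setLIntegral_congr_fun (g := fun _ => 0)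
          measurableSet_Iio, lintegral_zero, add_zero]
      intro y hy
      simp only [Pi.mul_apply]
      rw [gammaPDF_of_neg hy, zero_mul]
    rw [h2, lintegral_half_sq (gammaPDF ((m : ℝ) / 2) 1 * f), ← lintegral_const_mul' _ _ ENNReal.ofReal_ne_top]
    refine setLIntegral_congr_fun measurableSet_Ioi fun r hr => ?_
    have hr' : (0 : ℝ) < r := hr
    simp only [Pi.mul_apply]
    rw [gammaPDF_of_nonneg (by positivity)]
    rw [← mul_assoc, ← mul_assoc, ← mul_assoc, ← ENNReal.ofReal_mul (by positivity),
      ← ENNReal.ofReal_mul (by positivity), ← ENNReal.ofReal_mul (by positivity)]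
    congr 2
    have h3 : r ^ (m - 1) = r * (2 ^ ((m : ℝ) / 2 - 1) * (r ^ 2 / 2) ^ ((m : ℝ) / 2 - 1)) := by
      rw [← Real.mul_rpow (by positivity) (by positivity), mul_div_cancel₀ _ (two_ne_zero),
        ← Real.rpow_natCast r 2, ← Real.rpow_mul hr'.le, ← Real.rpow_natCast]
      nth_rewrite 2 [← Real.rpow_one r]
      rw [← Real.rpow_add hr']
      congr 1
      rw [Nat.cast_sub hm]
      push_cast
      ring
    rw [h3, Real.one_rpow, one_mul]
    field_simp
  have hc1 : c = 1 := by
    have := hc (fun _ => 1) measurable_const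
    simpa using this.symm
  refine Measure.ext_of_lintegral _ fun f hf => ?_
  rw [hc f hf, hc1, one_mul]

end InvGrass

end

/-! ### Rows of Haar distributed orthogonal matrices -/

noncomputable section

namespace InvGrass

open ProbabilityTheory

instance (n : ℕ) : SecondCountableTopology (On n) := by
  have : SecondCountableTopology (Matrix (Fin n) (Fin n) ℝ) :=
    inferInstanceAs (SecondCountableTopology (Fin n → Fin n → ℝ))
  exact TopologicalSpace.Subtype.secondCountableTopology _

theorem measurable_coe_On (n : ℕ) (a b : Fin n) :
    Measurable fun h : On n => (h : Matrix (Fin n) (Fin n) ℝ) a b := by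
  refine Continuous.measurable ?_
  have : Continuous fun h : On n => (h : Matrix (Fin n) (Fin n) ℝ) := continuous_subtype_val
  exact (continuous_apply b).comp ((continuous_apply a).comp this)

/-- A row of an orthogonal matrix. -/
def rowOn {N : ℕ} (e : Fin N) (h : On N) : Fin N → ℝ :=
  fun k => (h : Matrix (Fin N) (Fin N) ℝ) e k

theorem measurable_rowOn {N : ℕ} (e : Fin N) : Measurable (rowOn e) :=
  measurable_pi_iff.2 fun k => measurable_coe_On N e k

/-- Multiplication by an orthogonal matrix is a linear isometry of Euclidean space, and the standard
Gaussian measure is invariant under those. -/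
theorem measurePreserving_vecMul_gaussian {N : ℕ} (h : On N) :
    MeasurePreserving (fun x : Fin N → ℝ => x ᵥ* (h : Matrix (Fin N) (Fin N) ℝ))
      (Measure.pi fun _ => gaussianReal 0 1) (Measure.pi fun _ => gaussianReal 0 1) := by
  have hmul : (h : Matrix (Fin N) (Fin N) ℝ)ᵀ * (h : Matrix (Fin N) (Fin N) ℝ) = 1 :=
    (Matrix.mem_orthogonalGroup_iff' (Fin N) ℝ).1 h.2
  have hmul' : (h : Matrix (Fin N) (Fin N) ℝ) * (h : Matrix (Fin N) (Fin N) ℝ)ᵀ = 1 :=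
    (Matrix.mem_orthogonalGroup_iff (Fin N) ℝ).1 h.2
  let L : EuclideanSpace ℝ (Fin N) ≃ₗᵢ[ℝ] EuclideanSpace ℝ (Fin N) :=
    LinearEquiv.isometryOfInner
      (LinearEquiv.ofLinearMap (Matrix.toEuclideanLin (h : Matrix (Fin N) (Fin N) ℝ)ᵀ)
        (Matrix.toEuclideanLin (h : Matrix (Fin N) (Fin N) ℝ))
        (by ext x : 1; simp [Matrix.toLpLin_apply, Matrix.mulVec_mulVec, hmul])
        (by ext x : 1; simp [Matrix.toLpLin_apply, Matrix.mulVec_mulVec, hmul']))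
      (fun x y => by
        simp [EuclideanSpace.inner_eq_star_dotProduct, Matrix.toLpLin_apply,
          Matrix.dotProduct_mulVec, ← Matrix.mulVec_transpose, Matrix.mulVec_mulVec, hmul'])
  have hL : ∀ x : Fin N → ℝ, x ᵥ* (h : Matrix (Fin N) (Fin N) ℝ) =
      WithLp.ofLp (L (WithLp.toLp 2 x)) := by
    intro x
    change _ = (h : Matrix (Fin N) (Fin N) ℝ)ᵀ *ᵥ x
    rw [Matrix.mulVec_transpose]
  have hfun : (fun x : Fin N → ℝ => x ᵥ* (h : Matrix (Fin N) (Fin N) ℝ)) =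
      WithLp.ofLp ∘ L ∘ WithLp.toLp 2 := funext hL
  have hmo : Measurable (WithLp.ofLp : EuclideanSpace ℝ (Fin N) → Fin N → ℝ) := by fun_prop
  have hmt : Measurable (WithLp.toLp 2 : (Fin N → ℝ) → EuclideanSpace ℝ (Fin N)) := by fun_prop
  have hmL : Measurable L := L.continuous.measurable
  refine ⟨?_, ?_⟩
  · rw [hfun]
    exact hmo.comp (hmL.comp hmt)
  · rw [hfun, ← Measure.map_map hmo (hmL.comp hmt), ← Measure.map_map hmL hmt,
      map_pi_eq_stdGaussian, stdGaussian_map, ← map_pi_eq_stdGaussian, Measure.map_map hmo hmt]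
    exact Measure.map_id

theorem exists_On_row {N : ℕ} (e : Fin N) {x : Fin N → ℝ} (hx : ∑ j, x j ^ 2 = 1) :
    ∃ u : On N, rowOn e u = x := by
  have hnorm : ‖(WithLp.toLp 2 x : EuclideanSpace ℝ (Fin N))‖ = 1 := by
    rw [← sq_eq_sq₀ (norm_nonneg _) zero_le_one, EuclideanSpace.real_norm_sq_eq]
    simpa using hx
  have hon : Orthonormal ℝ (({e} : Set (Fin N)).domRestrict
      fun _ => (WithLp.toLp 2 x : EuclideanSpace ℝ (Fin N))) := by
    refine ⟨fun i => hnorm, fun i j hij => absurd (Subsingleton.elim i j) hij⟩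
  obtain ⟨b, hb⟩ := hon.exists_orthonormalBasis_extension_of_card_eq (by simp)
  refine ⟨⟨Matrix.of fun j k => b j k, ?_⟩, ?_⟩
  · rw [Matrix.mem_orthogonalGroup_iff]
    ext j k
    have := orthonormal_iff_ite.1 b.orthonormal k j
    simp only [EuclideanSpace.inner_eq_star_dotProduct, dotProduct] at this
    simp only [Matrix.mul_apply, Matrix.of_apply, Matrix.one_apply]
    simpa [eq_comm] using this
  · funext k
    simp [rowOn, hb e rfl]

/-- A row of a Haar distributed orthogonal matrix is a normalized Gaussian vector. -/
theorem lintegral_row_haarOn {N : ℕ} (e : Fin N) {Φ : (Fin N → ℝ) → ENNReal} (hΦ : Measurable Φ)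
    (hhom : ∀ (c : ℝ) (x : Fin N → ℝ), 0 < c → Φ (c • x) = Φ x) :
    ∫⁻ h : On N, Φ (rowOn e h) ∂(haarOn N) =
      ∫⁻ x, Φ x ∂(Measure.pi fun _ => gaussianReal 0 1) := by
  have hjm : Measurable fun p : (Fin N → ℝ) × On N =>
      Φ (p.1 ᵥ* (p.2 : Matrix (Fin N) (Fin N) ℝ)) := by
    refine hΦ.comp (measurable_pi_iff.2 fun k => ?_)
    simp only [Matrix.vecMul, dotProduct]
    exact Finset.measurable_sum _ fun j _ =>
      ((measurable_pi_apply j).comp measurable_fst).mul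
        ((measurable_coe_On N j k).comp measurable_snd)
  -- The double integral of `Φ (x h)` over Gaussian `x` and Haar `h` is evaluated in both orders.
  -- Integrating over `x` first uses the rotation invariance of the Gaussian measure.
  have h1 : ∫⁻ x, ∫⁻ h, Φ (x ᵥ* (h : Matrix (Fin N) (Fin N) ℝ)) ∂(haarOn N)
      ∂(Measure.pi fun _ => gaussianReal 0 1) =
      ∫⁻ x, Φ x ∂(Measure.pi fun _ => gaussianReal 0 1) := by
    rw [lintegral_lintegral_swap hjm.aemeasurable]
    simp only [(measurePreserving_vecMul_gaussian _).lintegral_comp hΦ]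
    simp
  -- For fixed `x ≠ 0`, write `x = c • rowOn e u` with `c = |x|`. Homogeneity of `Φ` removes `c`,
  -- and left invariance of Haar measure removes `u`.
  have h2 : ∀ᵐ x ∂(Measure.pi fun _ : Fin N => gaussianReal 0 1),
      ∫⁻ h, Φ (x ᵥ* (h : Matrix (Fin N) (Fin N) ℝ)) ∂(haarOn N) =
      ∫⁻ h : On N, Φ (rowOn e h) ∂(haarOn N) := by
    have hne : ∀ᵐ x ∂(Measure.pi fun _ : Fin N => gaussianReal 0 1), x e ≠ 0 := by
      have : NullSingletonClass (gaussianReal 0 1) := nullSingletonClass_gaussianReal one_ne_zero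
      rw [ae_iff]
      simpa using Measure.pi_hyperplane (fun _ : Fin N => gaussianReal 0 1) e 0
    filter_upwards [hne] with x hx
    have hpos : 0 < ∑ j, x j ^ 2 :=
      Finset.sum_pos' (fun j _ => sq_nonneg _) ⟨e, Finset.mem_univ e, by positivity⟩
    set c := √(∑ j, x j ^ 2) with hc
    have hc0 : 0 < c := Real.sqrt_pos.2 hpos
    obtain ⟨u, hu⟩ := exists_On_row e (x := c⁻¹ • x) (by
      simp only [Pi.smul_apply, smul_eq_mul, mul_pow, ← Finset.mul_sum]
      rw [hc, inv_pow, Real.sq_sqrt hpos.le, inv_mul_cancel₀ hpos.ne'])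
    have hxu : x = c • rowOn e u := by
      rw [hu, smul_inv_smul₀ hc0.ne']
    have h3 : ∀ h : On N, Φ (x ᵥ* (h : Matrix (Fin N) (Fin N) ℝ)) =
        Φ (rowOn e (u * h)) := by
      intro h
      conv_lhs => rw [hxu, Matrix.smul_vecMul, hhom _ _ hc0]
      rfl
    simp only [h3]
    exact lintegral_mul_left_eq_self
      (fun h : On N => Φ (rowOn e h)) u
  rw [← h1, lintegral_congr_ae h2]
  simp

theorem measurePreserving_sigmaUncurry {J : Type*} [Fintype J] {m : J → ℕ} (μ : Measure ℝ)
    [SigmaFinite μ] :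
    MeasurePreserving (fun (x : ∀ j, Fin (m j) → ℝ) (p : Σ j, Fin (m j)) => x p.1 p.2)
      (Measure.pi fun j => Measure.pi fun _ : Fin (m j) => μ) (Measure.pi fun _ => μ) := by
  have hm : Measurable fun (x : ∀ j, Fin (m j) → ℝ) (p : Σ j, Fin (m j)) => x p.1 p.2 := by
    fun_prop
  refine ⟨hm, (Measure.pi_eq fun s hs => ?_).symm⟩
  rw [Measure.map_apply hm (MeasurableSet.univ_pi hs)]
  have : (fun (x : ∀ j, Fin (m j) → ℝ) (p : Σ j, Fin (m j)) => x p.1 p.2) ⁻¹' Set.univ.pi s =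
      Set.univ.pi fun j => Set.univ.pi fun t => s ⟨j, t⟩ := by
    ext x
    simp only [Set.mem_preimage, Set.mem_pi, Set.mem_univ, true_imp_iff]
    exact ⟨fun h j t => h ⟨j, t⟩, fun h p => h p.1 p.2⟩
  rw [this, Measure.pi_pi]
  simp only [Measure.pi_pi]
  rw [← Finset.univ_sigma_univ, Finset.prod_sigma]

/-- Grouped sums of squares of independent Gaussian variables are independent gamma variables. -/
theorem lintegral_group_sq {J N : ℕ} {m : Fin J → ℕ} (hm : ∀ j, 0 < m j)
    (σ : Fin N ≃ Σ j, Fin (m j)) {G : (Fin J → ℝ) → ENNReal} (hG : Measurable G) :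
    ∫⁻ x : Fin N → ℝ, G (fun j => (∑ t, x (σ.symm ⟨j, t⟩) ^ 2) / 2)
        ∂(Measure.pi fun _ => gaussianReal 0 1) =
      ∫⁻ y, G y ∂(Measure.pi fun j => gammaMeasure ((m j : ℝ) / 2) 1) := by
  have h1 := (measurePreserving_piCongrLeft (fun _ : Fin N => gaussianReal 0 1) σ.symm)
  rw [← h1.lintegral_comp (by fun_prop)]
  rw [← (measurePreserving_sigmaUncurry (m := m) (gaussianReal 0 1)).lintegral_comp (by fun_prop)]
  have hp : ∀ j, IsProbabilityMeasure (gammaMeasure ((m j : ℝ) / 2) 1) := fun j =>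
    isProbabilityMeasure_gammaMeasure (by have := hm j; positivity) one_pos
  have h2 : (Measure.pi fun j => gammaMeasure ((m j : ℝ) / 2) 1) =
      (Measure.pi fun j => Measure.pi fun _ : Fin (m j) => gaussianReal 0 1).map
        fun x j => (∑ t, x j t ^ 2) / 2 := by
    have : ∀ j, gammaMeasure ((m j : ℝ) / 2) 1 =
      (Measure.pi fun _ : Fin (m j) => gaussianReal 0 1).map
        fun x => (∑ t, x t ^ 2) / 2 := fun j => (map_half_sum_sq (hm j)).symm
    simp only [this] at hp ⊢
    rw [Measure.pi_map_pi (f := fun j (x : Fin (m j) → ℝ) => (∑ t, x t ^ 2) / 2)]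
    exact fun j => Measurable.aemeasurable (by fun_prop)
  rw [h2, lintegral_map hG (by fun_prop)]
  refine lintegral_congr fun x => ?_
  congr 1
  funext j
  congr 1
  refine Finset.sum_congr rfl fun t _ => ?_
  rw [MeasurableEquiv.coe_piCongrLeft, Equiv.piCongrLeft_apply_apply]

end InvGrass

end

/-! ### Eigenvalues of a corner of a randomly rotated symmetric matrix -/

noncomputable section

namespace InvGrass

open ProbabilityTheory Polynomial

theorem On_mul_transpose {n : ℕ} (h : On n) :
    (h : Matrix (Fin n) (Fin n) ℝ) * (h : Matrix (Fin n) (Fin n) ℝ)ᵀ = 1 :=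
  (Matrix.mem_orthogonalGroup_iff (Fin n) ℝ).1 h.2

theorem On_transpose_mul {n : ℕ} (h : On n) :
    (h : Matrix (Fin n) (Fin n) ℝ)ᵀ * (h : Matrix (Fin n) (Fin n) ℝ) = 1 :=
  (Matrix.mem_orthogonalGroup_iff' (Fin n) ℝ).1 h.2

/-- Antitone sequences are determined by the monic polynomial whose roots they are. -/
theorem eq_of_prod_X_sub_C_eq {K : ℕ} {a b : Fin K → ℝ} (ha : Antitone a) (hb : Antitone b)
    (h : ∏ l, (X - C (a l)) = ∏ l, (X - C (b l))) : a = b := by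
  have hr := congrArg Polynomial.roots h
  rw [Polynomial.roots_prod _ _ (Finset.prod_ne_zero_iff.2 fun p _ => X_sub_C_ne_zero _),
    Polynomial.roots_prod _ _ (Finset.prod_ne_zero_iff.2 fun p _ => X_sub_C_ne_zero _)] at hr
  simp only [Polynomial.roots_X_sub_C, Multiset.bind_singleton, Fin.univ_val_map,
    Multiset.coe_eq_coe] at hr
  exact List.ofFn_injective (hr.eq_of_sortedGE ha.sortedGE_ofFn hb.sortedGE_ofFn)

theorem exists_equiv_of_map_eq {α β γ : Type*} [Fintype α] [Fintype β] [DecidableEq γ]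
    {f : α → γ} {g : β → γ}
    (h : Multiset.map f Finset.univ.val = Multiset.map g Finset.univ.val) :
    ∃ e : α ≃ β, ∀ a, g (e a) = f a := by
  have hc : ∀ c, Nonempty ({a // f a = c} ≃ {b // g b = c}) := by
    intro c
    have h1 := congrArg (Multiset.count c) h
    rw [Multiset.count_map, Multiset.count_map] at h1
    refine ⟨Fintype.equivOfCardEq ?_⟩
    rw [Fintype.card_subtype, Fintype.card_subtype]
    simpa [Finset.card, eq_comm, Finset.filter] using h1
  exact ⟨Equiv.ofFiberEquiv fun c => (hc c).some, fun a => Equiv.ofFiberEquiv_map _ a⟩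

/-- A symmetric matrix is diagonalized by an orthogonal matrix, with the eigenvalues in any
prescribed order. -/
theorem exists_diagonalization {N : ℕ} {ι : Type*} [Fintype ι]
    {A : Matrix (Fin N) (Fin N) ℝ} (hA : A.IsHermitian) {δ : ι → ℝ}
    (hχ : A.charpoly = ∏ p, (X - C (δ p))) :
    ∃ (σ : Fin N ≃ ι) (U : On N), A = (U : Matrix (Fin N) (Fin N) ℝ) *
      Matrix.diagonal (fun q => δ (σ q)) * (U : Matrix (Fin N) (Fin N) ℝ)ᵀ := by
  have hr := hA.roots_charpoly_eq_eigenvalues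
  rw [hχ, Polynomial.roots_prod _ _ (Finset.prod_ne_zero_iff.2 fun p _ => X_sub_C_ne_zero _)] at hr
  simp only [Polynomial.roots_X_sub_C, Multiset.bind_singleton] at hr
  obtain ⟨σ, hσ⟩ := exists_equiv_of_map_eq hr.symm
  refine ⟨σ, hA.eigenvectorUnitary, ?_⟩
  have := hA.spectral_theorem
  rw [Unitary.conjStarAlgAut_apply] at this
  conv_lhs => rw [this]
  have h2 : (RCLike.ofReal ∘ hA.eigenvalues : Fin N → ℝ) = fun q => δ (σ q) :=
    funext fun q => (hσ q).symm
  rw [h2]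
  rfl

theorem adjugate_conj {N : ℕ} {R : Type*} [CommRing R] {V : Matrix (Fin N) (Fin N) R}
    (hV : V * Vᵀ = 1) (Y : Matrix (Fin N) (Fin N) R) :
    (V * Y * Vᵀ).adjugate = V * Y.adjugate * Vᵀ := by
  have hV' : Vᵀ * V = 1 := mul_eq_one_comm.1 hV
  have h1 : V.adjugate = V.det • Vᵀ := by
    calc V.adjugate = V.adjugate * (V * Vᵀ) := by rw [hV, mul_one]
      _ = V.det • Vᵀ := by rw [← mul_assoc, Matrix.adjugate_mul, smul_mul_assoc, one_mul]
  have h2 : Vᵀ.adjugate = V.det • V := by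
    rw [← Matrix.adjugate_transpose, h1, Matrix.transpose_smul, Matrix.transpose_transpose]
  have hd : V.det * V.det = 1 := by
    have := congrArg Matrix.det hV
    rwa [Matrix.det_mul, Matrix.det_transpose, Matrix.det_one] at this
  rw [Matrix.adjugate_mul_distrib, Matrix.adjugate_mul_distrib, h1, h2]
  simp only [smul_mul_assoc, mul_smul_comm, smul_smul, hd, one_smul, mul_assoc]

/-- The characteristic polynomial of a principal submatrix, in terms of a diagonalization. -/
theorem charpoly_submatrix_castSucc {M : ℕ} {W : Matrix (Fin (M + 1)) (Fin (M + 1)) ℝ}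
    (hVV : W * Wᵀ = 1) (α : Fin (M + 1) → ℝ) :
    ((W * Matrix.diagonal α * Wᵀ).submatrix Fin.castSucc Fin.castSucc).charpoly =
      ∑ q, C (W (Fin.last M) q ^ 2) * ∏ l ∈ Finset.univ.erase q, (X - C (α l)) := by
  set W' : Matrix (Fin (M + 1)) (Fin (M + 1)) ℝ[X] := W.map C with hW'
  have hVV' : W' * W'ᵀ = 1 := by
    rw [hW', Matrix.transpose_map.symm, ← Matrix.map_mul, hVV]
    simp
  have hchar : Matrix.charmatrix (W * Matrix.diagonal α * Wᵀ) =
      W' * Matrix.diagonal (fun q => X - C (α q)) * W'ᵀ := by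
    have hd : Matrix.diagonal (fun q => X - C (α q)) =
        Matrix.scalar (Fin (M + 1)) (X : ℝ[X]) - (Matrix.diagonal α).map C := by
      ext a b
      by_cases hab : a = b
      · subst hab; simp
      · simp [hab]
    rw [hd, mul_sub, sub_mul, Matrix.charmatrix, RingHom.mapMatrix_apply, Matrix.map_mul,
      Matrix.map_mul, Matrix.transpose_map]
    congr 1
    rw [← (Matrix.scalar_commute (X : ℝ[X]) (fun r => Commute.all _ _) W').eq, mul_assoc, hVV',
      mul_one]
  have hsub : Matrix.charmatrix ((W * Matrix.diagonal α * Wᵀ).submatrix Fin.castSucc Fin.castSucc) =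
      (Matrix.charmatrix (W * Matrix.diagonal α * Wᵀ)).submatrix Fin.castSucc Fin.castSucc := by
    ext a b : 1
    by_cases hab : a = b
    · subst hab; simp
    · simp [hab]
  -- The characteristic polynomial of the corner is the last diagonal entry of the adjugate of the
  -- full characteristic matrix. The adjugate commutes with orthogonal conjugation and is explicit
  -- for diagonal matrices.
  have hadj := Matrix.adjugate_fin_succ_eq_det_submatrix
    (Matrix.charmatrix (W * Matrix.diagonal α * Wᵀ)) (Fin.last M) (Fin.last M)
  rw [Fin.succAbove_last, ← hsub, Even.neg_one_pow ⟨_, rfl⟩, one_mul] at hadj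
  rw [Matrix.charpoly, ← hadj, hchar, adjugate_conj hVV', Matrix.adjugate_diagonal,
    Matrix.mul_apply]
  refine Finset.sum_congr rfl fun q _ => ?_
  rw [Matrix.mul_diagonal, Matrix.transpose_apply]
  simp only [hW', Matrix.map_apply, C_pow]
  ring

/-- A node of multiplicity `m_j` leaves the common factor `(X - δ_j) ^ (m_j - 1)` in every summand.
What remains is a sum over distinct nodes whose weights are the grouped sums of squares. -/
theorem sum_erase_eq_nodePoly {K N : ℕ} {m : Fin (K + 1) → ℕ} (hm : ∀ j, 0 < m j)
    (δ : Fin (K + 1) → ℝ) (σ : Fin N ≃ Σ j, Fin (m j)) (v : Fin N → ℝ) :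
    ∑ q, C (v q ^ 2) * ∏ l ∈ Finset.univ.erase q, (X - C (δ (σ l).1)) =
      (∏ j, (X - C (δ j)) ^ (m j - 1)) *
        nodePoly δ (fun j => ∑ t, v (σ.symm ⟨j, t⟩) ^ 2) := by
  have hprod : ∏ l, (X - C (δ (σ l).1)) = ∏ j, (X - C (δ j)) ^ m j := by
    rw [Equiv.prod_comp σ (fun p => X - C (δ p.1)), ← Finset.univ_sigma_univ, Finset.prod_sigma]
    simp
  have hq : ∀ p : Σ j, Fin (m j), ∏ l ∈ Finset.univ.erase (σ.symm p), (X - C (δ (σ l).1)) =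
      (∏ j, (X - C (δ j)) ^ (m j - 1)) * ∏ l, (X - C (δ (p.1.succAbove l))) := by
    intro p
    refine mul_left_cancel₀ (X_sub_C_ne_zero (δ p.1)) ?_
    have h1 := Finset.mul_prod_erase Finset.univ (fun l => X - C (δ (σ l).1))
      (Finset.mem_univ (σ.symm p))
    simp only [Equiv.apply_symm_apply] at h1
    rw [h1, hprod, mul_left_comm, ← Fin.prod_univ_succAbove (fun k => X - C (δ k)) p.1,
      ← Finset.prod_mul_distrib]
    exact Finset.prod_congr rfl fun j _ => by rw [← pow_succ, Nat.sub_add_cancel (hm j)]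
  rw [← Equiv.sum_comp σ.symm]
  simp only [hq]
  rw [← Finset.univ_sigma_univ, Finset.sum_sigma, nodePoly, Finset.mul_sum]
  refine Finset.sum_congr rfl fun j _ => ?_
  rw [map_sum, Finset.sum_mul, Finset.mul_sum]
  exact Finset.sum_congr rfl fun t _ => by ring

/-- The roots are not explicit functions of the weights. Their measurable dependence comes from the
residue map being injective and differentiable on a measurable set. -/
theorem measurableEmbedding_residue {K : ℕ} {δ : Fin (K + 1) → ℝ} (hδ : StrictAnti δ) :
    MeasurableEmbedding ((daDomain δ).domRestrict (residue δ)) :=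
  measurableEmbedding_of_fderivWithin (isOpen_daDomain δ).measurableSet
    (fun x _ => (hasFDerivAt_residue δ x).hasFDerivWithinAt) (injOn_residue hδ)

/-- A function of the interlacing roots, as a function of the residues. -/
def rootFun {K : ℕ} (δ : Fin (K + 1) → ℝ) (φ : (Fin K → ℝ) → ENNReal) :
    (Fin (K + 1) → ℝ) → ENNReal :=
  Function.extend ((daDomain δ).domRestrict (residue δ)) (fun x => φ (Fin.tail x.1)) fun _ => 0

theorem rootFun_residue {K : ℕ} {δ : Fin (K + 1) → ℝ} (hδ : StrictAnti δ)
    (φ : (Fin K → ℝ) → ENNReal) {x : Fin (K + 1) → ℝ} (hx : x ∈ daDomain δ) :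
    rootFun δ φ (residue δ x) = φ (Fin.tail x) :=
  (measurableEmbedding_residue hδ).injective.extend_apply _ _ (⟨x, hx⟩ : daDomain δ)

theorem measurable_rootFun {K : ℕ} {δ : Fin (K + 1) → ℝ} (hδ : StrictAnti δ)
    {φ : (Fin K → ℝ) → ENNReal} (hφ : Measurable φ) : Measurable (rootFun δ φ) :=
  (measurableEmbedding_residue hδ).measurable_extend
    (hφ.comp (measurable_pi_iff.2 fun l =>
      (measurable_pi_apply l.succ).comp measurable_subtype_coe)) measurable_const

/-- Scaling all residues scales `T` and leaves the roots fixed. This is the homogeneity that lets a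
normalized Gaussian vector be replaced by a Gaussian one. -/
theorem rootFun_smul {K : ℕ} {δ : Fin (K + 1) → ℝ} (hδ : StrictAnti δ)
    (φ : (Fin K → ℝ) → ENNReal) {c : ℝ} (hc : 0 < c) (y : Fin (K + 1) → ℝ) :
    rootFun δ φ (c • y) = rootFun δ φ y := by
  have hmem : ∀ z : Fin (K + 1) → ℝ,
      (∃ a, (daDomain δ).domRestrict (residue δ) a = z) ↔ ∀ j, 0 < z j := by
    intro z
    have := Set.ext_iff.1 (image_residue hδ) z
    rw [Set.mem_image] at this
    rw [show (∀ j, 0 < z j) ↔ z ∈ {y : Fin (K + 1) → ℝ | ∀ j, 0 < y j} from Iff.rfl, ← this]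
    exact ⟨fun ⟨a, ha⟩ => ⟨a.1, a.2, ha⟩, fun ⟨a, h1, h2⟩ => ⟨⟨a, h1⟩, h2⟩⟩
  by_cases hy : ∀ j, 0 < y j
  · obtain ⟨⟨x, hx⟩, rfl⟩ := (hmem y).2 hy
    have hx' : (Fin.cons (c * x 0) (Fin.tail x) : Fin (K + 1) → ℝ) ∈ daDomain δ :=
      ⟨by simpa using mul_pos hc hx.1, by simpa using hx.2⟩
    have hr : c • residue δ x = residue δ (Fin.cons (c * x 0) (Fin.tail x) : Fin (K + 1) → ℝ) := by
      funext j
      simp [residue, mul_assoc]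
    change rootFun δ φ (c • residue δ x) = rootFun δ φ (residue δ x)
    rw [hr, rootFun_residue hδ φ hx', rootFun_residue hδ φ hx, Fin.tail_cons]
  · have hy' : ¬ ∀ j, 0 < (c • y) j := fun h => hy fun j => pos_of_mul_pos_right (h j) hc.le
    rw [rootFun, Function.extend_apply' _ _ _ fun h => hy ((hmem y).1 h),
      Function.extend_apply' _ _ _ fun h => hy' ((hmem _).1 h)]

/-- If `∑_j y_j ∏_{k≠j} (X - δ_k)` has positive weights and is proportional to `∏ (X - e_l)`,
then `rootFun` recovers the value of `φ` at `e`. -/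
theorem rootFun_eq {K : ℕ} {δ : Fin (K + 1) → ℝ} (hδ : StrictAnti δ)
    (φ : (Fin K → ℝ) → ENNReal) {y : Fin (K + 1) → ℝ} (hy : ∀ j, 0 < y j) {e : Fin K → ℝ}
    (he : Antitone e) (h : nodePoly δ y = ∏ l, (X - C (e l))) : rootFun δ φ y = φ e := by
  obtain ⟨x, hx, rfl⟩ := exists_interlace hδ hy
  rw [rootFun_residue hδ φ hx]
  rw [(nodePoly_eq_iff hδ.injective _ x).2 rfl] at h
  have h0 := congrArg (fun p => Polynomial.coeff p K) h
  simp only [Polynomial.coeff_C_mul, coeff_prod_X_sub_C, mul_one] at h0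
  rw [h0, map_one, one_mul] at h
  rw [eq_of_prod_X_sub_C_eq (strictAnti_of_mem_interlace hδ hx.2).antitone he h]

/-- The indicator of a coordinate hyperplane is invariant under positive scaling, so the statement
reduces to the Gaussian measure, which does not charge hyperplanes. Nonzero entries make all grouped
weights positive, hence the roots strictly interlacing. -/
theorem ae_rowOn_ne_zero {N : ℕ} (e : Fin N) :
    ∀ᵐ h : On N ∂(haarOn N), ∀ q, rowOn e h q ≠ 0 := by
  rw [ae_all_iff]
  intro q
  have hs : MeasurableSet {x : Fin N → ℝ | x q = 0} :=
    measurableSet_eq_fun (measurable_pi_apply q) measurable_const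
  have h1 := lintegral_row_haarOn e
    (Φ := Set.indicator {x : Fin N → ℝ | x q = 0} 1) (measurable_one.indicator hs) (by
      intro c x hc
      simp [Set.indicator, hc.ne'])
  have : NullSingletonClass (gaussianReal 0 1) := nullSingletonClass_gaussianReal one_ne_zero
  rw [lintegral_indicator_one hs,
    Measure.pi_hyperplane (fun _ : Fin N => gaussianReal 0 1) q 0] at h1
  have h2 := (lintegral_eq_zero_iff ((measurable_one.indicator hs).comp (measurable_rowOn e))).1 h1
  filter_upwards [h2] with h hh h0
  simp [Set.indicator, h0] at hh

/-- If the principal submatrix of a rotated diagonal matrix has eigenvalues `e` besides the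
diagonal entries, the row of the rotation determines `e` as interlacing roots. -/
theorem rootFun_row_eq {K M : ℕ} {δ : Fin (K + 1) → ℝ} (hδ : StrictAnti δ)
    {m : Fin (K + 1) → ℕ} (hm : ∀ j, 0 < m j) (σ : Fin (M + 1) ≃ Σ j, Fin (m j))
    {W : Matrix (Fin (M + 1)) (Fin (M + 1)) ℝ} (hWW : W * Wᵀ = 1)
    (hW0 : ∀ q, W (Fin.last M) q ≠ 0) {e : Fin K → ℝ} (he : Antitone e)
    (heχ : ((W * Matrix.diagonal (fun q => δ (σ q).1) * Wᵀ).submatrix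
      Fin.castSucc Fin.castSucc).charpoly =
        (∏ j, (X - C (δ j)) ^ (m j - 1)) * ∏ l, (X - C (e l)))
    (φ : (Fin K → ℝ) → ENNReal) :
    rootFun δ φ (fun j => (∑ t, W (Fin.last M) (σ.symm ⟨j, t⟩) ^ 2) / 2) = φ e := by
  rw [charpoly_submatrix_castSucc hWW, sum_erase_eq_nodePoly hm] at heχ
  have h2 := mul_left_cancel₀ (Finset.prod_ne_zero_iff.2 fun j _ =>
    pow_ne_zero _ (X_sub_C_ne_zero _)) heχ
  have hpos : ∀ j, 0 < ∑ t, W (Fin.last M) (σ.symm ⟨j, t⟩) ^ 2 := fun j =>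
    Finset.sum_pos (fun t _ => by have := hW0 (σ.symm ⟨j, t⟩); positivity)
      ⟨⟨0, hm j⟩, Finset.mem_univ _⟩
  rw [← rootFun_eq hδ φ hpos he h2, ← rootFun_smul hδ φ (by norm_num : (0 : ℝ) < 1 / 2)
    fun j => ∑ t, W (Fin.last M) (σ.symm ⟨j, t⟩) ^ 2]
  congr 1
  funext j
  simp only [Pi.smul_apply, smul_eq_mul]
  ring

/-- The law of the eigenvalues of the principal submatrix of a randomly rotated symmetric matrix
with eigenvalues `δ_j` of multiplicities `m_j`. -/
theorem lintegral_corner_eigenvalues {K M : ℕ} {δ : Fin (K + 1) → ℝ} (hδ : StrictAnti δ)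
    {m : Fin (K + 1) → ℕ} (hm : ∀ j, 0 < m j)
    {A : Matrix (Fin (M + 1)) (Fin (M + 1)) ℝ} (hA : A.IsHermitian)
    (hχ : A.charpoly = ∏ j, (X - C (δ j)) ^ m j)
    {e : On (M + 1) → Fin K → ℝ} (he : ∀ h, Antitone (e h))
    (heχ : ∀ h : On (M + 1), (((h : Matrix (Fin (M + 1)) (Fin (M + 1)) ℝ) * A *
      (h : Matrix (Fin (M + 1)) (Fin (M + 1)) ℝ)ᵀ).submatrix Fin.castSucc Fin.castSucc).charpoly =
        (∏ j, (X - C (δ j)) ^ (m j - 1)) * ∏ l, (X - C (e h l)))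
    {φ : (Fin K → ℝ) → ENNReal} (hφ : Measurable φ) :
    ∫⁻ h, φ (e h) ∂(haarOn (M + 1)) =
      ENNReal.ofReal (Real.Gamma (∑ j, (m j : ℝ) / 2) / ∏ j, Real.Gamma ((m j : ℝ) / 2)) *
        ∫⁻ b in interlace δ, φ b *
          ENNReal.ofReal (vdm b / vdm δ * ∏ j, ∏ l, ratio δ b j l ^ ((m j : ℝ) / 2 - 1)) := by
  obtain ⟨σ, U, hU⟩ := exists_diagonalization (ι := Σ j, Fin (m j)) hA (δ := fun p => δ p.1) (by
    rw [hχ, ← Finset.univ_sigma_univ, Finset.prod_sigma]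
    simp)
  set Φ : (Fin (M + 1) → ℝ) → ENNReal := fun x =>
    rootFun δ φ (fun j => (∑ t, x (σ.symm ⟨j, t⟩) ^ 2) / 2) with hΦ
  have hΦm : Measurable Φ := (measurable_rootFun hδ hφ).comp (by fun_prop)
  have hhom : ∀ (c : ℝ) (x : Fin (M + 1) → ℝ), 0 < c → Φ (c • x) = Φ x := by
    intro c x hc
    simp only [hΦ]
    rw [← rootFun_smul hδ φ (by positivity : 0 < c ^ 2) fun j => (∑ t, x (σ.symm ⟨j, t⟩) ^ 2) / 2]
    congr 1
    funext j
    simp only [Pi.smul_apply, smul_eq_mul, mul_pow, ← Finset.mul_sum]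
    ring
  -- With `A = U D Uᵀ`, the matrix `h A hᵀ` is `D` conjugated by `h U`. By right invariance, `h U`
  -- is Haar distributed like `h`.
  have hne : ∀ᵐ h : On (M + 1) ∂(haarOn (M + 1)), ∀ q, rowOn (Fin.last M) (h * U) q ≠ 0 := by
    have h1 := (measurePreserving_mul_right (haarOn (M + 1)) U).quasiMeasurePreserving.ae
      (p := fun h => ∀ q, rowOn (Fin.last M) h q ≠ 0) (ae_rowOn_ne_zero (Fin.last M))
    exact h1
  have hmain : ∀ᵐ h : On (M + 1) ∂(haarOn (M + 1)), φ (e h) =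
      Φ (rowOn (Fin.last M) (h * U)) := by
    filter_upwards [hne] with h hh
    have h1 := heχ h
    have h2 : ((h * U : On (M + 1)) : Matrix (Fin (M + 1)) (Fin (M + 1)) ℝ) *
        Matrix.diagonal (fun q => δ (σ q).1) *
        ((h * U : On (M + 1)) : Matrix (Fin (M + 1)) (Fin (M + 1)) ℝ)ᵀ =
        (h : Matrix (Fin (M + 1)) (Fin (M + 1)) ℝ) * A *
        (h : Matrix (Fin (M + 1)) (Fin (M + 1)) ℝ)ᵀ := by
      rw [hU, show ((h * U : On (M + 1)) : Matrix (Fin (M + 1)) (Fin (M + 1)) ℝ) =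
        (h : Matrix (Fin (M + 1)) (Fin (M + 1)) ℝ) * (U : Matrix (Fin (M + 1)) (Fin (M + 1)) ℝ)
        from rfl, Matrix.transpose_mul]
      simp only [mul_assoc]
    rw [← h2] at h1
    have h3 := rootFun_row_eq hδ hm σ (On_mul_transpose (h * U)) hh (he h) h1 φ
    rw [← h3]
    rfl
  rw [lintegral_congr_ae hmain, lintegral_mul_right_eq_self
    (fun h : On (M + 1) => Φ (rowOn (Fin.last M) h)) U,
    lintegral_row_haarOn _ hΦm hhom, lintegral_group_sq hm σ (measurable_rootFun hδ hφ)]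
  exact lintegral_pi_gammaMeasure hδ (fun j => by have := hm j; positivity) hφ
    fun x hx => rootFun_residue hδ φ hx

end InvGrass

end

/-! ### Projections, compressions and their spectra -/

noncomputable section

namespace InvGrass

open Polynomial

theorem frameMatrix_transpose_mul {n k : ℕ} {U : Submodule ℝ (EuclideanSpace ℝ (Fin n))}
    (b : OrthonormalBasis (Fin k) ℝ U) : (frameMatrix b)ᵀ * frameMatrix b = 1 := by
  ext s t
  have h := orthonormal_iff_ite.1 b.orthonormal t s
  rw [Submodule.coe_inner, EuclideanSpace.inner_eq_star_dotProduct] at h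
  simp only [dotProduct, star_trivial, Pi.star_apply] at h
  simp only [Matrix.mul_apply, Matrix.transpose_apply, frameMatrix, Matrix.of_apply,
    Matrix.one_apply]
  rw [h]
  simp [eq_comm]

theorem frameMatrix_mul_transpose {n k : ℕ} {U : Submodule ℝ (EuclideanSpace ℝ (Fin n))}
    (b : OrthonormalBasis (Fin k) ℝ U) : frameMatrix b * (frameMatrix b)ᵀ = projMatrix U := by
  ext r c
  simp only [projMatrix, Matrix.of_apply, Matrix.mul_apply, Matrix.transpose_apply, frameMatrix]
  rw [b.starProjection_eq_sum_rankOne]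
  simp [mul_comm, EuclideanSpace.inner_single_right]

theorem projMatrix_mul_self {n : ℕ} (U : Submodule ℝ (EuclideanSpace ℝ (Fin n))) :
    projMatrix U * projMatrix U = projMatrix U := by
  have b := stdOrthonormalBasis ℝ U
  rw [← frameMatrix_mul_transpose b, Matrix.mul_assoc, ← Matrix.mul_assoc (frameMatrix b)ᵀ,
    frameMatrix_transpose_mul, Matrix.one_mul]

theorem projMatrix_transpose {n : ℕ} (U : Submodule ℝ (EuclideanSpace ℝ (Fin n))) :
    (projMatrix U)ᵀ = projMatrix U := by
  have := projMatrix_isHermitian U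
  rwa [Matrix.IsHermitian, Matrix.conjTranspose_eq_transpose_of_trivial] at this

/-- The product of the projections onto two subspaces has the same characteristic polynomial as
the compression, up to a power of `X`. -/
theorem X_pow_mul_charpoly_projMatrix_mul {n k : ℕ} {U : Submodule ℝ (EuclideanSpace ℝ (Fin n))}
    (b : OrthonormalBasis (Fin k) ℝ U) (V : Submodule ℝ (EuclideanSpace ℝ (Fin n))) :
    X ^ k * (projMatrix U * projMatrix V).charpoly = X ^ n * (compress b V).charpoly := by
  have h := Matrix.charpoly_mul_comm' (frameMatrix b) ((frameMatrix b)ᵀ * projMatrix V)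
  rw [← Matrix.mul_assoc, frameMatrix_mul_transpose] at h
  simpa [compress] using h

theorem charpoly_projMatrix {n k : ℕ} {U : Submodule ℝ (EuclideanSpace ℝ (Fin n))}
    (hU : Module.finrank ℝ U = k) :
    X ^ k * (projMatrix U).charpoly = X ^ n * (X - 1) ^ k := by
  have b : OrthonormalBasis (Fin k) ℝ U := (stdOrthonormalBasis ℝ U).reindex (finCongr hU)
  have h := Matrix.charpoly_mul_comm' (frameMatrix b) (frameMatrix b)ᵀ
  rw [frameMatrix_mul_transpose, frameMatrix_transpose_mul] at h
  simpa [Matrix.charpoly_one] using h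

theorem charpoly_eq_prod_eigs {k : ℕ} {A : Matrix (Fin k) (Fin k) ℝ} (hA : A.IsHermitian) :
    A.charpoly = ∏ j, (X - C (eigs hA j)) := by
  rw [hA.charpoly_eq]
  simp only [Matrix.IsHermitian.eigenvalues, eigs, RCLike.ofReal_real_eq_id, id]
  rw [← Equiv.prod_comp (Fintype.equivOfCardEq (Fintype.card_fin (Fintype.card (Fin k)))),
    ← Equiv.prod_comp (finCongr (Fintype.card_fin k).symm)]
  refine Finset.prod_congr rfl fun j _ => ?_
  rw [Equiv.symm_apply_apply]
  rfl

theorem antitone_eigs {k : ℕ} {A : Matrix (Fin k) (Fin k) ℝ} (hA : A.IsHermitian) :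
    Antitone (eigs hA) := fun _ _ h => hA.eigenvalues₀_antitone h

/-- Both `compress b V` and `1 - compress b V` are Gram matrices, of the columns of `Θ` projected to
`V` and to its orthogonal complement, so the eigenvalues lie in `[0, 1]`. -/
theorem compress_eigs_mem_simplex {n k : ℕ} {U : Submodule ℝ (EuclideanSpace ℝ (Fin n))}
    (b : OrthonormalBasis (Fin k) ℝ U) (V : Submodule ℝ (EuclideanSpace ℝ (Fin n))) :
    eigs (compress_isHermitian b V) ∈ simplex k := by
  refine ⟨antitone_eigs _, fun j => ?_⟩
  set hA := compress_isHermitian b V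
  have hB : compress b V = (projMatrix V * frameMatrix b)ᵀ * (projMatrix V * frameMatrix b) := by
    rw [Matrix.transpose_mul, projMatrix_transpose, compress, Matrix.mul_assoc _ (projMatrix V)
      (projMatrix V * _), ← Matrix.mul_assoc (projMatrix V) (projMatrix V), projMatrix_mul_self,
      Matrix.mul_assoc]
  have hB' : 1 - compress b V = ((1 - projMatrix V) * frameMatrix b)ᵀ *
      ((1 - projMatrix V) * frameMatrix b) := by
    have h2 : (1 - projMatrix V) * (1 - projMatrix V) = 1 - projMatrix V := by
      rw [mul_sub, sub_mul, sub_mul, projMatrix_mul_self]; simp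
    rw [Matrix.transpose_mul, Matrix.transpose_sub, Matrix.transpose_one, projMatrix_transpose,
      Matrix.mul_assoc, ← Matrix.mul_assoc (1 - projMatrix V), h2, Matrix.sub_mul, Matrix.mul_sub,
      Matrix.one_mul, frameMatrix_transpose_mul, compress, Matrix.mul_assoc]
  obtain ⟨q, hq⟩ : ∃ q, eigs hA j = hA.eigenvalues q :=
    ⟨Fintype.equivOfCardEq (Fintype.card_fin (Fintype.card (Fin k)))
      (Fin.cast (Fintype.card_fin k).symm j), by simp [Matrix.IsHermitian.eigenvalues, eigs]⟩
  have hP : (compress b V).PosSemidef := by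
    rw [hB, ← Matrix.conjTranspose_eq_transpose_of_trivial]
    exact Matrix.posSemidef_conjTranspose_mul_self (projMatrix V * frameMatrix b)
  have hP' : (1 - compress b V).PosSemidef := by
    rw [hB', ← Matrix.conjTranspose_eq_transpose_of_trivial]
    exact Matrix.posSemidef_conjTranspose_mul_self ((1 - projMatrix V) * frameMatrix b)
  rw [hq]
  refine ⟨hP.eigenvalues_nonneg q, ?_⟩
  have hv := hA.mulVec_eigenvectorBasis q
  set v : Fin k → ℝ := ⇑(hA.eigenvectorBasis q) with hvdef
  have h1 := hP'.dotProduct_mulVec_nonneg v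
  rw [Matrix.sub_mulVec, hv, Matrix.one_mulVec, dotProduct_sub, dotProduct_smul] at h1
  have hnorm : star v ⬝ᵥ v = 1 := by
    have := orthonormal_iff_ite.1 hA.eigenvectorBasis.orthonormal q q
    rw [EuclideanSpace.inner_eq_star_dotProduct] at this
    simpa using this
  rw [hnorm, smul_eq_mul, mul_one] at h1
  linarith

/-- The coordinate projection is diagonal. -/
theorem projMatrix_coordSubspace (n k : ℕ) :
    projMatrix (coordSubspace n k) =
      Matrix.diagonal fun j : Fin n => if n ≤ (j : ℕ) + k then (1 : ℝ) else 0 := by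
  ext a c
  simp only [projMatrix, Matrix.of_apply]
  by_cases hc : n ≤ (c : ℕ) + k
  · have hmem : EuclideanSpace.single c (1 : ℝ) ∈ coordSubspace n k :=
      Submodule.subset_span ⟨c, hc, rfl⟩
    rw [Submodule.starProjection_eq_self_iff.2 hmem]
    by_cases hac : a = c
    · subst hac; simp [hc]
    · simp [hac]
  · have hmem : EuclideanSpace.single c (1 : ℝ) ∈ (coordSubspace n k)ᗮ := by
      rw [Submodule.mem_orthogonal]
      intro u hu
      refine Submodule.span_induction (p := fun u _ => inner ℝ u
        (EuclideanSpace.single c (1 : ℝ)) = 0) ?_ (by simp) ?_ ?_ hu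
      · rintro x ⟨j, hj, rfl⟩
        have : c ≠ j := fun h => hc (h ▸ hj)
        simp [EuclideanSpace.inner_single_left, this.symm]
      · intro x y _ _ hx hy
        rw [inner_add_left, hx, hy, add_zero]
      · intro r x _ hx
        rw [inner_smul_left, hx, mul_zero]
    rw [(Submodule.starProjection_apply_eq_zero_iff _).2 hmem]
    by_cases hac : a = c
    · subst hac; simp [hc]
    · simp [hac]

/-- For an idempotent block matrix, the characteristic polynomial of one diagonal block determines
that of the other. -/
theorem charpoly_toBlocks_of_idempotent {a b : Type*} [Fintype a] [Fintype b] [DecidableEq a]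
    [DecidableEq b] {M : Matrix (a ⊕ b) (a ⊕ b) ℝ} (hM : M * M = M) :
    M.toBlocks₁₁.charpoly * (X * (X - 1)) ^ Fintype.card b =
      M.charpoly * (1 - M.toBlocks₂₂).charpoly := by
  set A := M.toBlocks₁₁ with hA
  set B := M.toBlocks₁₂ with hB
  set D := M.toBlocks₂₁ with hD
  set E := M.toBlocks₂₂ with hE
  have hMb : M = Matrix.fromBlocks A B D E := (Matrix.fromBlocks_toBlocks M).symm
  have hM2 := hM
  rw [hMb, Matrix.fromBlocks_multiply, Matrix.fromBlocks_inj] at hM2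
  obtain ⟨-, h12, -, h22⟩ := hM2
  -- Block elimination. Idempotency gives `AB + BE = B`, which kills the upper right block, and `DB
  -- + E² = E`, which makes the lower right block the scalar `X (X - 1)`.
  have hfac : Matrix.charmatrix M * Matrix.fromBlocks 1 (B.map C) 0
      (Matrix.charmatrix (1 - E)) =
      Matrix.fromBlocks (Matrix.charmatrix A) 0 (-(D.map C))
        (Matrix.scalar b (X * (X - 1) : ℝ[X])) := by
    have hc1 : Matrix.charmatrix M = Matrix.fromBlocks (Matrix.charmatrix A) (-(B.map C))
        (-(D.map C)) (Matrix.charmatrix E) := by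
      rw [hMb, Matrix.charmatrix_fromBlocks]
    rw [hc1, Matrix.fromBlocks_multiply]
    have h12' := congrArg (fun N => N.map (C : ℝ →+* ℝ[X])) h12
    have h22' := congrArg (fun N => N.map (C : ℝ →+* ℝ[X])) h22
    simp only [Matrix.map_add _ (map_add C), Matrix.map_mul] at h12' h22'
    simp only [Matrix.charmatrix, RingHom.mapMatrix_apply, Matrix.mul_one, Matrix.mul_zero,
      add_zero, Matrix.scalar_apply, ← Matrix.smul_one_eq_diagonal,
      Matrix.map_sub _ (map_sub C), Matrix.map_one _ (map_zero C) (map_one C)]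
    congr 1
    · simp only [Matrix.sub_mul, Matrix.mul_sub, Matrix.neg_mul, Matrix.smul_mul, Matrix.mul_smul,
        Matrix.one_mul, Matrix.mul_one, smul_neg]
      rw [eq_sub_of_add_eq h12']
      abel
    · simp only [Matrix.sub_mul, Matrix.mul_sub, Matrix.neg_mul, Matrix.smul_mul, Matrix.mul_smul,
        Matrix.one_mul, Matrix.mul_one]
      conv_lhs => rw [eq_sub_of_add_eq h22']
      simp only [smul_smul, smul_sub, mul_sub, mul_one, sub_smul]
      abel
  have hdet := congrArg Matrix.det hfac
  rw [Matrix.det_mul, Matrix.det_fromBlocks_zero₂₁, Matrix.det_fromBlocks_zero₁₂, Matrix.det_one,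
    one_mul] at hdet
  rw [Matrix.charpoly, Matrix.charpoly, Matrix.charpoly, hdet]
  simp

/-- `x` lists the squared cosines of the canonical angles between `ℝ^k` and the range of `P`. -/
def IsSpec {n k : ℕ} (P : Matrix (Fin n) (Fin n) ℝ) (x : Fin k → ℝ) : Prop :=
  x ∈ simplex k ∧
    X ^ k * (projMatrix (coordSubspace n k) * P).charpoly = X ^ n * ∏ j, (X - C (x j))

theorem isSpec_eigs {n k : ℕ} (b : OrthonormalBasis (Fin k) ℝ (coordSubspace n k))
    (V : Submodule ℝ (EuclideanSpace ℝ (Fin n))) :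
    IsSpec (projMatrix V) (eigs (compress_isHermitian b V)) :=
  ⟨compress_eigs_mem_simplex b V, by
    rw [X_pow_mul_charpoly_projMatrix_mul b V, charpoly_eq_prod_eigs (compress_isHermitian b V)]⟩

theorem splitEquiv_inl {n k : ℕ} (h : k ≤ n) (a : Fin (n - k)) :
    splitEquiv h (Sum.inl a) = Fin.castLE (Nat.sub_le n k) a :=
  Fin.ext (by simp [splitEquiv])

theorem splitEquiv_inr_val {n k : ℕ} (h : k ≤ n) (t : Fin k) :
    (splitEquiv h (Sum.inr t) : ℕ) = n - k + t := by
  simp [splitEquiv]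

theorem projMatrix_orthogonal {n : ℕ} (V : Submodule ℝ (EuclideanSpace ℝ (Fin n))) :
    projMatrix Vᗮ = 1 - projMatrix V := by
  ext a b
  simp only [projMatrix, Matrix.of_apply, Matrix.sub_apply]
  rw [Submodule.starProjection_orthogonal']
  by_cases hab : a = b
  · subst hab; simp
  · simp [hab]

theorem projMatrix_coordSubspace_submatrix {n k : ℕ} (h : k ≤ n) :
    (projMatrix (coordSubspace n k)).submatrix (splitEquiv h) (splitEquiv h) =
      Matrix.fromBlocks 0 0 0 1 := by
  rw [projMatrix_coordSubspace]
  ext a b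
  rcases a with a | a <;> rcases b with b | b
  · have : ¬ n ≤ (a : ℕ) + k := by omega
    by_cases hab : a = b
    · subst hab; simp [splitEquiv_inl, this]
    · simp [splitEquiv_inl, hab]
  · simp
  · simp
  · have : n ≤ (splitEquiv h (Sum.inr a) : ℕ) + k := by rw [splitEquiv_inr_val]; omega
    by_cases hab : a = b
    · subst hab; simp [this]
    · simp [hab]

theorem charpoly_submatrix_equiv {a b : Type*} [Fintype a] [Fintype b] [DecidableEq a]
    [DecidableEq b] (e : a ≃ b) (M : Matrix b b ℝ) : (M.submatrix e e).charpoly = M.charpoly :=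
  Matrix.charpoly_reindex e.symm M

/-- The spectrum of the leading principal block of the complementary projection. -/
theorem charpoly_corner {n i k : ℕ} (hki : k ≤ i) (hkn : k + i ≤ n) (ξ : Gr n i) {x : Fin k → ℝ}
    (hx : IsSpec (projMatrix ξ.1) x) :
    ((1 - projMatrix ξ.1).submatrix (Fin.castLE (Nat.sub_le n k))
      (Fin.castLE (Nat.sub_le n k))).charpoly =
      X ^ (i - k) * (X - 1) ^ (n - i - k) * ∏ j, (X - C (x j)) := by
  have hk : k ≤ n := by omega
  set e := splitEquiv hk with he
  set P := projMatrix ξ.1 with hP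
  have hX1 : (X - 1 : ℝ[X]) ≠ 0 := X_sub_C_ne_zero 1
  have hQ : (1 - P).charpoly = X ^ i * (X - 1) ^ (n - i) := by
    have hdim : Module.finrank ℝ ξ.1ᗮ = n - i := by
      have := Submodule.finrank_add_finrank_orthogonal ξ.1
      rw [ξ.2, finrank_euclideanSpace, Fintype.card_fin] at this
      omega
    have h := charpoly_projMatrix hdim
    rw [projMatrix_orthogonal] at h
    refine mul_left_cancel₀ (pow_ne_zero (n - i) X_ne_zero) (h.trans ?_)
    rw [← mul_assoc, ← pow_add, Nat.sub_add_cancel (by omega)]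
  have hidem : (1 - P) * (1 - P) = 1 - P := by
    rw [hP, ← projMatrix_orthogonal, projMatrix_mul_self]
  have hM : (1 - P).submatrix e e * (1 - P).submatrix e e = (1 - P).submatrix e e := by
    rw [Matrix.submatrix_mul_equiv, hidem]
  -- Applied to `1 - P`, so that the complement of its lower right block is the lower right block of
  -- `P`, whose eigenvalues are the `x_j`.
  have h1 := charpoly_toBlocks_of_idempotent hM
  rw [charpoly_submatrix_equiv, hQ, Fintype.card_fin] at h1
  have h11 : ((1 - P).submatrix e e).toBlocks₁₁ = (1 - P).submatrix (Fin.castLE (Nat.sub_le n k))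
      (Fin.castLE (Nat.sub_le n k)) := by
    ext a b
    simp only [Matrix.toBlocks₁₁, Matrix.of_apply, Matrix.submatrix_apply, he, splitEquiv_inl]
  have h22 : 1 - ((1 - P).submatrix e e).toBlocks₂₂ = (P.submatrix e e).toBlocks₂₂ := by
    ext a b
    by_cases hab : a = b
    · subst hab; simp [Matrix.toBlocks₂₂]
    · simp [Matrix.toBlocks₂₂, hab]
  have hD : (projMatrix (coordSubspace n k) * P).charpoly =
      X ^ (n - k) * ((P.submatrix e e).toBlocks₂₂).charpoly := by
    rw [← charpoly_submatrix_equiv e, ← Matrix.submatrix_mul_equiv _ _ e e e,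
      projMatrix_coordSubspace_submatrix]
    conv_lhs => rw [← Matrix.fromBlocks_toBlocks (P.submatrix e e)]
    rw [Matrix.fromBlocks_multiply]
    simp only [Matrix.zero_mul, Matrix.one_mul, zero_add, add_zero]
    rw [Matrix.charpoly_fromBlocks_zero₁₂, Matrix.charpoly_zero, Fintype.card_fin]
  have hx2 := hx.2
  rw [hD, ← mul_assoc, ← pow_add, Nat.add_sub_cancel' hk] at hx2
  have hx3 := mul_left_cancel₀ (pow_ne_zero n X_ne_zero) hx2
  rw [h11, h22, hx3] at h1
  refine mul_right_cancel₀ (pow_ne_zero k (mul_ne_zero X_ne_zero hX1)) (h1.trans ?_)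
  rw [mul_pow]
  obtain ⟨p, rfl⟩ := Nat.exists_eq_add_of_le hki
  obtain ⟨q, rfl⟩ := Nat.exists_eq_add_of_le hkn
  rw [show k + (k + p) + q - (k + p) = k + q by omega, Nat.add_sub_cancel_left,
    Nat.add_sub_cancel_left, pow_add, pow_add]
  ring

/-- The block diagonal orthogonal matrix with blocks `a` and `b`. -/
def embK {n k : ℕ} (h : k ≤ n) (a : On (n - k)) (b : On k) : On n :=
  ⟨Matrix.reindex (splitEquiv h) (splitEquiv h)
    (Matrix.fromBlocks (a : Matrix (Fin (n - k)) (Fin (n - k)) ℝ) 0 0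
      (b : Matrix (Fin k) (Fin k) ℝ)), by
    rw [Matrix.mem_orthogonalGroup_iff]
    rw [Matrix.transpose_reindex, Matrix.reindex_apply, Matrix.reindex_apply,
      Matrix.submatrix_mul_equiv, Matrix.fromBlocks_transpose, Matrix.fromBlocks_multiply]
    simp [On_mul_transpose]⟩

theorem memK_embK {n k : ℕ} (h : k ≤ n) (a : On (n - k)) (b : On k) : MemK h (embK h a b) :=
  ⟨a, b, rfl⟩

theorem exists_embK_of_memK {n k : ℕ} {h : k ≤ n} {γ : On n} (hγ : MemK h γ) :
    ∃ a b, γ = embK h a b := by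
  obtain ⟨a, b, hab⟩ := hγ
  exact ⟨a, b, Subtype.ext hab⟩

theorem continuous_embK {n k : ℕ} (h : k ≤ n) :
    Continuous fun p : On (n - k) × On k => embK h p.1 p.2 := by
  refine Continuous.subtype_mk ?_ _
  simp only [Matrix.reindex_apply]
  refine Continuous.matrix_submatrix ?_ _ _
  exact Continuous.matrix_fromBlocks (continuous_subtype_val.comp continuous_fst) continuous_const
    continuous_const (continuous_subtype_val.comp continuous_snd)

theorem embK_mul {n k : ℕ} (h : k ≤ n) (a a' : On (n - k)) (b b' : On k) :
    embK h (a * a') (b * b') = embK h a b * embK h a' b' := by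
  apply Subtype.ext
  change Matrix.reindex _ _ _ = Matrix.reindex _ _ _ * Matrix.reindex _ _ _
  rw [Matrix.reindex_apply, Matrix.reindex_apply, Matrix.reindex_apply,
    Matrix.submatrix_mul_equiv, Matrix.fromBlocks_multiply]
  simp

/-- A block diagonal matrix acts on the leading block through its first block alone. Rotating the
first `n - k` coordinates therefore rotates exactly the matrix whose corner is taken next. -/
theorem corner_embK_conj {n k : ℕ} (h : k ≤ n) (a : On (n - k)) (b : On k)
    (Q : Matrix (Fin n) (Fin n) ℝ) :
    ((embK h a b : Matrix (Fin n) (Fin n) ℝ) * Q * (embK h a b : Matrix (Fin n) (Fin n) ℝ)ᵀ).submatrix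
      (Fin.castLE (Nat.sub_le n k)) (Fin.castLE (Nat.sub_le n k)) =
    (a : Matrix (Fin (n - k)) (Fin (n - k)) ℝ) *
      Q.submatrix (Fin.castLE (Nat.sub_le n k)) (Fin.castLE (Nat.sub_le n k)) *
      (a : Matrix (Fin (n - k)) (Fin (n - k)) ℝ)ᵀ := by
  set e := splitEquiv h with he
  have h11 : ∀ N : Matrix (Fin n) (Fin n) ℝ, N.submatrix (Fin.castLE (Nat.sub_le n k))
      (Fin.castLE (Nat.sub_le n k)) = (N.submatrix e e).toBlocks₁₁ := by
    intro N
    ext a b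
    simp only [Matrix.toBlocks₁₁, Matrix.of_apply, Matrix.submatrix_apply, he, splitEquiv_inl]
  rw [h11, h11, ← Matrix.submatrix_mul_equiv _ _ e e e, ← Matrix.submatrix_mul_equiv _ _ e e e]
  have hs : (embK h a b : Matrix (Fin n) (Fin n) ℝ).submatrix e e =
      Matrix.fromBlocks (a : Matrix (Fin (n - k)) (Fin (n - k)) ℝ) 0 0
      (b : Matrix (Fin k) (Fin k) ℝ) := by
    ext x y
    simp [embK, he]
  rw [← Matrix.transpose_submatrix, hs]
  conv_lhs => rw [← Matrix.fromBlocks_toBlocks (Q.submatrix e e)]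
  rw [Matrix.fromBlocks_transpose, Matrix.fromBlocks_multiply, Matrix.fromBlocks_multiply,
    Matrix.toBlocks_fromBlocks₁₁]
  simp

end InvGrass

end

/-! ### The simplex, continuity of the angles, and the two interlacing conditions -/

noncomputable section

namespace InvGrass

open Polynomial

theorem isCompact_simplex (k : ℕ) : IsCompact (simplex k) := by
  have hK : IsCompact (Set.univ.pi fun _ : Fin k => Set.Icc (0 : ℝ) 1) :=
    isCompact_univ_pi fun _ => isCompact_Icc
  refine hK.of_isClosed_subset ?_ fun x hx j _ => hx.2 j
  have h1 : IsClosed {x : Fin k → ℝ | Antitone x} := by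
    simp only [Antitone, Set.ofPred_forall]
    exact isClosed_iInter fun a => isClosed_iInter fun b => isClosed_iInter fun _ =>
      isClosed_le (continuous_apply b) (continuous_apply a)
  have h2 : IsClosed {x : Fin k → ℝ | ∀ j, 0 ≤ x j ∧ x j ≤ 1} := by
    simp only [Set.ofPred_forall]
    exact isClosed_iInter fun j => (isClosed_le continuous_const (continuous_apply j)).inter
      (isClosed_le (continuous_apply j) continuous_const)
  exact h1.inter h2

/-- Decreasing eigenvalues depend continuously on the matrix. -/
theorem continuous_of_isSpec {Y : Type*} [TopologicalSpace Y] {n k : ℕ}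
    {R : Matrix (Fin n) (Fin n) ℝ} {P : Y → Matrix (Fin n) (Fin n) ℝ} (hP : Continuous P)
    {x : Y → Fin k → ℝ} (hx : ∀ y, x y ∈ simplex k ∧
      X ^ k * (R * P y).charpoly = X ^ n * ∏ j, (X - C (x y j))) : Continuous x := by
  have : CompactSpace (simplex k) := isCompact_iff_compactSpace.1 (isCompact_simplex k)
  -- The compact simplex embeds into a space of functions by evaluating `∏ (t - z_j)`, so continuity
  -- can be tested on those values, which are given by a determinant. The point `t = 0` is left out
  -- in order to divide by `t ^ n`.
  let ev : simplex k → {t : ℝ // t ≠ 0} → ℝ := fun z t => ∏ j, (t.1 - z.1 j)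
  have hev : Continuous ev := by
    refine continuous_pi fun t => continuous_finsetProd _ fun j _ => ?_
    exact continuous_const.sub ((continuous_apply j).comp continuous_subtype_val)
  have hinj : Function.Injective ev := by
    intro z w h
    refine Subtype.ext (eq_of_prod_X_sub_C_eq z.2.1 w.2.1 ?_)
    refine Polynomial.eq_of_infinite_eval_eq _ _ (Set.Infinite.mono (s := {0}ᶜ) ?_
      (Set.finite_singleton (0 : ℝ)).infinite_compl)
    intro t ht
    have := congrFun h ⟨t, ht⟩
    simpa [ev, Polynomial.eval_prod] using this
  have hemb := hev.isClosedEmbedding hinj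
  let x' : Y → simplex k := fun y => ⟨x y, (hx y).1⟩
  suffices h : Continuous x' from continuous_subtype_val.comp h
  rw [hemb.isInducing.continuous_iff]
  refine continuous_pi fun t => ?_
  have hform : ∀ y, (ev ∘ x') y t = (t.1 ^ n)⁻¹ * (t.1 ^ k *
      (Matrix.scalar (Fin n) t.1 - R * P y).det) := by
    intro y
    have h1 := congrArg (Polynomial.eval t.1) (hx y).2
    simp only [Polynomial.eval_mul, Polynomial.eval_pow, Polynomial.eval_X,
      Matrix.eval_charpoly, Polynomial.eval_prod, Polynomial.eval_sub, Polynomial.eval_C] at h1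
    rw [h1, ← mul_assoc, inv_mul_cancel₀ (pow_ne_zero n t.2), one_mul]
    rfl
  simp only [hform]
  refine continuous_const.mul (continuous_const.mul (Continuous.matrix_det ?_))
  exact continuous_const.sub (continuous_const.matrix_mul hP)

/-- The interior of the simplex. -/
def openSimplex (k : ℕ) : Set (Fin k → ℝ) := {x | StrictAnti x ∧ ∀ j, 0 < x j ∧ x j < 1}

theorem isOpen_openSimplex (k : ℕ) : IsOpen (openSimplex k) := by
  have h1 : IsOpen {x : Fin k → ℝ | StrictAnti x} := by
    simp only [StrictAnti, Set.ofPred_forall]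
    exact isOpen_iInter_of_finite fun a => isOpen_iInter_of_finite fun b =>
      isOpen_iInter_of_finite fun _ => isOpen_lt (continuous_apply b) (continuous_apply a)
  have h2 : IsOpen {x : Fin k → ℝ | ∀ j, 0 < x j ∧ x j < 1} := by
    simp only [Set.ofPred_forall]
    exact isOpen_iInter_of_finite fun j =>
      (isOpen_lt continuous_const (continuous_apply j)).inter
        (isOpen_lt (continuous_apply j) continuous_const)
  exact h1.inter h2

theorem openSimplex_subset (k : ℕ) : openSimplex k ⊆ simplex k :=
  fun _ hx => ⟨hx.1.antitone, fun j => ⟨(hx.2 j).1.le, (hx.2 j).2.le⟩⟩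

theorem volume_eq_coord {k : ℕ} {a b : Fin k} (hab : a ≠ b) :
    volume {x : Fin k → ℝ | x a = x b} = 0 := by
  let L : (Fin k → ℝ) →ₗ[ℝ] ℝ := LinearMap.proj (R := ℝ) (φ := fun _ : Fin k => ℝ) a -
    LinearMap.proj (R := ℝ) (φ := fun _ : Fin k => ℝ) b
  have hset : {x : Fin k → ℝ | x a = x b} = (LinearMap.ker L : Set (Fin k → ℝ)) := by
    ext x
    simp [L, sub_eq_zero]
  rw [hset]
  refine Measure.addHaar_submodule _ _ fun htop => ?_
  have : (Pi.single a (1 : ℝ) : Fin k → ℝ) ∈ LinearMap.ker L := by rw [htop]; trivial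
  simp [L, hab.symm] at this

/-- The boundary lies in finitely many hyperplanes `x_a = x_b`, `x_a = 0`, `x_a = 1`. On the
interior the Vandermonde factors and the bases of all real powers are positive. -/
theorem openSimplex_ae_eq (k : ℕ) :
    openSimplex k =ᵐ[(volume : Measure (Fin k → ℝ))] simplex k := by
  have h1 : ∀ᵐ x : Fin k → ℝ, ∀ a b, a ≠ b → x a ≠ x b := by
    simp only [ae_all_iff]
    intro a b hab
    rw [ae_iff]
    simpa using volume_eq_coord hab
  have h2 : ∀ c : ℝ, ∀ᵐ x : Fin k → ℝ, ∀ a, x a ≠ c := by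
    intro c
    rw [ae_all_iff]
    intro a
    rw [ae_iff]
    simpa [volume_pi] using Measure.pi_hyperplane (fun _ : Fin k => (volume : Measure ℝ)) a c
  filter_upwards [h1, h2 0, h2 1] with x hx h0 h1
  refine propext ⟨fun h => openSimplex_subset k h, fun h => ⟨fun a b hab => ?_, fun j => ?_⟩⟩
  · exact lt_of_le_of_ne (h.1 hab.le) (hx b a hab.ne')
  · exact ⟨lt_of_le_of_ne (h.2 j).1 (h0 j).symm, lt_of_le_of_ne (h.2 j).2 (h1 j)⟩

/-- The density of the Jacobi ensemble. -/
def jac {k : ℕ} (α β : ℝ) (x : Fin k → ℝ) : ℝ := vdm x * ∏ j, x j ^ α * (1 - x j) ^ β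

theorem measurable_jac {k : ℕ} (α β : ℝ) : Measurable (jac (k := k) α β) := by
  unfold jac vdm
  fun_prop

theorem lintegral_nu {k : ℕ} (α β : ℝ) {φ : (Fin k → ℝ) → ENNReal} (hφ : Measurable φ) :
    ∫⁻ x, φ x ∂(nu k α β) = ∫⁻ x in openSimplex k, φ x * ENNReal.ofReal (jac α β x) := by
  have hm : Measurable fun x : Fin k → ℝ => ENNReal.ofReal (jac α β x) :=
    (measurable_jac α β).ennreal_ofReal
  have h : nu k α β = (volume.restrict (openSimplex k)).withDensity
      fun x => ENNReal.ofReal (jac α β x) := by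
    rw [Measure.restrict_congr_set (openSimplex_ae_eq k)]
    rfl
  rw [h, lintegral_withDensity_eq_lintegral_mul _ hm hφ]
  simp only [Pi.mul_apply, mul_comm]

/-- The sequence `1, x_1, …, x_k, 0`. -/
def pad {k : ℕ} (x : Fin k → ℝ) : Fin (k + 2) → ℝ := Fin.cons 1 (Fin.snoc x 0 : Fin (k + 1) → ℝ)

@[simp] theorem pad_zero {k : ℕ} (x : Fin k → ℝ) : pad x 0 = 1 := rfl

@[simp] theorem pad_mid {k : ℕ} (x : Fin k → ℝ) (j : Fin k) : pad x j.castSucc.succ = x j := by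
  simp [pad]

theorem pad_mid' {k : ℕ} (x : Fin k → ℝ) (j : Fin k) : pad x j.succ.castSucc = x j := by
  rw [← Fin.succ_castSucc, pad_mid]

theorem pad_last {k : ℕ} (x : Fin k → ℝ) : pad x (Fin.last k).succ = 0 := by
  rw [pad, Fin.cons_succ, Fin.snoc_last]

/-- Interlacing of `b` with `1, x_1, …, x_k, 0` and of `x` with `b` are the same chain of
inequalities, apart from the outer bounds `b_0 < 1` and `0 < b_k`. -/
theorem mem_interlace_pad_iff {k : ℕ} {x : Fin k → ℝ} {b : Fin (k + 1) → ℝ} :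
    b ∈ interlace (pad x) ↔ (b 0 < 1 ∧ 0 < b (Fin.last k)) ∧ x ∈ interlace b := by
  constructor
  · intro h
    refine ⟨⟨by simpa using (h 0).2, pad_last x ▸ (h (Fin.last k)).1⟩, fun l => ⟨?_, ?_⟩⟩
    · have := (h l.succ).2
      rwa [pad_mid'] at this
    · have := (h l.castSucc).1
      rwa [pad_mid] at this
  · rintro ⟨⟨h0, h1⟩, h⟩ l
    constructor
    · refine Fin.lastCases ?_ (fun j => ?_) l
      · rw [pad_last]; exact h1
      · simpa using (h j).2
    · refine Fin.cases ?_ (fun j => ?_) l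
      · simpa using h0
      · rw [pad_mid']; exact (h j).1

theorem strictAnti_pad {k : ℕ} {x : Fin k → ℝ} (hx : x ∈ openSimplex k) : StrictAnti (pad x) := by
  rw [Fin.strictAnti_iff_succ_lt]
  intro l
  refine Fin.lastCases ?_ (fun j => ?_) l
  · rcases k with _ | k
    · rw [pad_last]
      exact one_pos
    · rw [pad_last, ← Fin.succ_last, pad_mid']
      exact (hx.2 _).1
  · rw [pad_mid]
    rcases k with _ | k
    · exact j.elim0
    · refine Fin.cases ?_ (fun t => ?_) j
      · simpa using (hx.2 0).2
      · rw [← Fin.succ_castSucc, pad_mid']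
        exact hx.1 Fin.castSucc_lt_succ

/-- The two ways to describe a pair of interlacing points of the simplices. -/
theorem openSimplex_interlace_iff {k : ℕ} {x : Fin k → ℝ} {b : Fin (k + 1) → ℝ} :
    (x ∈ openSimplex k ∧ b ∈ interlace (pad x)) ↔ (b ∈ openSimplex (k + 1) ∧ x ∈ interlace b) := by
  constructor
  · rintro ⟨hx, hb⟩
    have hδ := strictAnti_pad hx
    have hbs := strictAnti_of_mem_interlace hδ hb
    have h := mem_interlace_pad_iff.1 hb
    exact ⟨⟨hbs, fun j => ⟨h.1.2.trans_le (hbs.antitone (Fin.le_last j)),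
      (hbs.antitone (Fin.zero_le j)).trans_lt h.1.1⟩⟩, h.2⟩
  · rintro ⟨hb, hx⟩
    exact ⟨⟨strictAnti_of_mem_interlace hb.1 hx, fun j => ⟨(hb.2 _).1.trans (hx j).1,
      (hx j).2.trans (hb.2 _).2⟩⟩, mem_interlace_pad_iff.2 ⟨⟨(hb.2 _).2, (hb.2 _).1⟩, hx⟩⟩

end InvGrass

end

/-! ### Bayes' rule for Jacobi densities -/

noncomputable section

namespace InvGrass

open Polynomial

theorem vdm_snoc_zero {k : ℕ} (x : Fin k → ℝ) :
    vdm (Fin.snoc x 0 : Fin (k + 1) → ℝ) = vdm x * ∏ j, x j := by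
  have h : ∀ {m : ℕ} (y : Fin m → ℝ),
      vdm y = ∏ j, ∏ k, if j < k then y j - y k else 1 := by
    intro m y
    refine Finset.prod_congr rfl fun j _ => ?_
    rw [Finset.prod_ite, Finset.prod_const_one, mul_one]
    exact Finset.prod_congr (by ext; simp) fun _ _ => rfl
  rw [h, h, Fin.prod_univ_castSucc, ← Finset.prod_mul_distrib]
  have hl : (∏ k' : Fin (k + 1), if Fin.last k < k' then
      (Fin.snoc x 0 : Fin (k + 1) → ℝ) (Fin.last k) - (Fin.snoc x 0 : Fin (k + 1) → ℝ) k'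
      else 1) = 1 :=
    Finset.prod_eq_one fun k' _ => if_neg (not_lt.2 (Fin.le_last k'))
  rw [hl, mul_one]
  refine Finset.prod_congr rfl fun j _ => ?_
  rw [Fin.prod_univ_castSucc]
  simp [Fin.castSucc_lt_last]

theorem prod_univ_succ_castSucc {k : ℕ} (f : Fin (k + 2) → ℝ) :
    ∏ j, f j = f 0 * ((∏ j : Fin k, f j.castSucc.succ) * f (Fin.last k).succ) := by
  rw [Fin.prod_univ_succ, Fin.prod_univ_castSucc]

theorem vdm_pad {k : ℕ} (x : Fin k → ℝ) :
    vdm (pad x) = (∏ j, (1 - x j)) * (vdm x * ∏ j, x j) := by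
  rw [pad, vdm_cons, vdm_snoc_zero, Fin.prod_univ_castSucc]
  simp

theorem prod_ratio {K : ℕ} {δ : Fin (K + 1) → ℝ} (hδ : StrictAnti δ) {b : Fin K → ℝ}
    (hb : b ∈ interlace δ) (j : Fin (K + 1)) :
    ∏ l, ratio δ b j l = (∏ l, |δ j - b l|) / ∏ l, |δ j - δ (j.succAbove l)| := by
  rw [← Finset.prod_div_distrib]
  refine Finset.prod_congr rfl fun l _ => ?_
  rw [← abs_div, ← abs_of_pos (ratio_pos hδ hb j l)]
  rfl

theorem prod_prod_ratio {K : ℕ} {δ : Fin (K + 1) → ℝ} (hδ : StrictAnti δ) {b : Fin K → ℝ}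
    (hb : b ∈ interlace δ) :
    ∏ j, ∏ l, ratio δ b j l = (∏ j, ∏ l, |δ j - b l|) / vdm δ ^ 2 := by
  simp only [prod_ratio hδ hb, Finset.prod_div_distrib]
  rw [← sq_abs, ← prod_prod_erase_abs]
  congr 1
  exact Finset.prod_congr rfl fun j _ =>
    (prod_erase_eq_prod_succAbove (fun k => |δ j - δ k|) j).symm

theorem prod_prod_ratio_rpow {K : ℕ} {δ : Fin (K + 1) → ℝ} (hδ : StrictAnti δ) {b : Fin K → ℝ}
    (hb : b ∈ interlace δ) (s : Fin (K + 1) → ℝ) :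
    ∏ j, ∏ l, ratio δ b j l ^ s j = ∏ j, (∏ l, ratio δ b j l) ^ s j :=
  Finset.prod_congr rfl fun j _ =>
    Real.finsetProd_rpow _ _ (fun l _ => (ratio_pos hδ hb j l).le) _

theorem jac_eq {k : ℕ} (α β : ℝ) {x : Fin k → ℝ} (hx : x ∈ openSimplex k) :
    jac α β x = vdm x * ((∏ j, x j) ^ α * (∏ j, (1 - x j)) ^ β) := by
  rw [jac, Finset.prod_mul_distrib, Real.finsetProd_rpow _ _ (fun j _ => (hx.2 j).1.le),
    Real.finsetProd_rpow _ _ (fun j _ => (sub_pos.2 (hx.2 j).2).le)]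

/-- Writing every positive quantity as an exponential turns the identity into one that is linear in
the logarithms. -/
theorem rpow_density_identity {V W A B A' B' S : ℝ} (hV : 0 < V) (hW : 0 < W) (hA : 0 < A)
    (hB : 0 < B) (hA' : 0 < A') (hB' : 0 < B') (hS : 0 < S) (p q : ℝ) :
    V * (A ^ ((q - 1) / 2) * B ^ ((p - 1) / 2)) * (W / (B * (V * A)) *
      ((B' / B) ^ (p / 2 - 1) * ((S / (V ^ 2 * A * B)) ^ ((1 : ℝ) / 2 - 1) *
        (A' / A) ^ (q / 2 - 1)))) =
    W * (A' ^ (q / 2 - 1) * B' ^ (p / 2 - 1)) * (V / W * (S / W ^ 2) ^ ((1 : ℝ) / 2 - 1)) := by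
  have h : ∀ {t : ℝ}, 0 < t → ∃ v, t = Real.exp v := fun ht => ⟨_, (Real.exp_log ht).symm⟩
  obtain ⟨v, rfl⟩ := h hV
  obtain ⟨w, rfl⟩ := h hW
  obtain ⟨a, rfl⟩ := h hA
  obtain ⟨b, rfl⟩ := h hB
  obtain ⟨a', rfl⟩ := h hA'
  obtain ⟨b', rfl⟩ := h hB'
  obtain ⟨s, rfl⟩ := h hS
  simp only [← Real.exp_add, ← Real.exp_sub, ← Real.exp_mul, ← Real.exp_nat_mul]
  congr 1
  push_cast
  ring

/-- Bayes' rule for the two transition densities. -/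
theorem jac_mul_transition {k : ℕ} {x : Fin k → ℝ} (hx : x ∈ openSimplex k) {b : Fin (k + 1) → ℝ}
    (hb : b ∈ interlace (pad x)) (p q : ℝ) (s : Fin (k + 2) → ℝ) (hs0 : s 0 = p)
    (hs : ∀ j : Fin k, s j.castSucc.succ = 1) (hsl : s (Fin.last k).succ = q) :
    jac ((q - 1) / 2) ((p - 1) / 2) x *
      (vdm b / vdm (pad x) * ∏ j, ∏ l, ratio (pad x) b j l ^ (s j / 2 - 1)) =
    jac (q / 2 - 1) (p / 2 - 1) b *
      (vdm x / vdm b * ∏ l, ∏ j, ratio b x l j ^ ((1 : ℝ) / 2 - 1)) := by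
  obtain ⟨hb', hx'⟩ := openSimplex_interlace_iff.1 ⟨hx, hb⟩
  have hδ := strictAnti_pad hx
  set A := ∏ j, x j with hA
  set B := ∏ j, (1 - x j) with hB
  set A' := ∏ j, b j with hA'
  set B' := ∏ j, (1 - b j) with hB'
  set S := ∏ l, ∏ j, |b l - x j| with hS
  have pA : 0 < A := Finset.prod_pos fun j _ => (hx.2 j).1
  have pB : 0 < B := Finset.prod_pos fun j _ => sub_pos.2 (hx.2 j).2
  have pA' : 0 < A' := Finset.prod_pos fun j _ => (hb'.2 j).1
  have pB' : 0 < B' := Finset.prod_pos fun j _ => sub_pos.2 (hb'.2 j).2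
  have pV := vdm_pos hx.1
  have pW := vdm_pos hb'.1
  have pS : 0 < S := by
    refine Finset.prod_pos fun l _ => Finset.prod_pos fun j _ => abs_pos.2 fun h0 => ?_
    have := (ratio_pos hb'.1 hx' l j).ne'
    simp [ratio, h0] at this
  have hN0 : ∏ l, ratio (pad x) b 0 l = B' / B := by
    rw [prod_ratio hδ hb]
    congr 1
    · exact Finset.prod_congr rfl fun l _ => abs_of_pos (sub_pos.2 (hb'.2 l).2)
    · rw [Fin.prod_univ_castSucc]
      simp only [Fin.zero_succAbove, pad_mid, pad_last, pad_zero, sub_zero, abs_one, mul_one]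
      exact Finset.prod_congr rfl fun l _ => abs_of_pos (sub_pos.2 (hx.2 l).2)
  have hNl : ∏ l, ratio (pad x) b (Fin.last k).succ l = A' / A := by
    rw [prod_ratio hδ hb]
    congr 1
    · refine Finset.prod_congr rfl fun l _ => ?_
      rw [pad_last, zero_sub, abs_neg, abs_of_pos (hb'.2 l).1]
    · rw [Fin.prod_univ_succ]
      have hl : pad x (Fin.last (k + 1)) = 0 := pad_last x
      simp only [Nat.succ_eq_add_one, hl, zero_sub, abs_neg, Fin.succ_last, Fin.succAbove_last,
        pad_mid', Fin.castSucc_zero, pad_zero, abs_one, one_mul]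
      exact Finset.prod_congr rfl fun l _ => abs_of_pos (hx.2 l).1
  have hall := prod_prod_ratio hδ hb
  have hSall : ∏ j, ∏ l, |pad x j - b l| = B' * (S * A') := by
    rw [prod_univ_succ_castSucc]
    congr 1
    · exact Finset.prod_congr rfl fun l _ => abs_of_pos (sub_pos.2 (hb'.2 l).2)
    · congr 1
      · rw [hS, Finset.prod_comm]
        simp only [pad_mid]
        exact Finset.prod_congr rfl fun _ _ => Finset.prod_congr rfl fun _ _ => abs_sub_comm _ _
      · refine Finset.prod_congr rfl fun l _ => ?_
        rw [pad_last, zero_sub, abs_neg, abs_of_pos (hb'.2 l).1]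
  rw [hSall, prod_univ_succ_castSucc, hN0, hNl, vdm_pad] at hall
  -- The factors of the interior nodes are found only as a product, by dividing the total product of
  -- ratios by the contributions of the nodes `1` and `0`. This suffices because all interior
  -- exponents are equal.
  have hmid : ∏ j : Fin k, ∏ l, ratio (pad x) b j.castSucc.succ l = S / (vdm x ^ 2 * A * B) := by
    rw [← hA, ← hB] at hall
    rw [eq_div_iff (by positivity)]
    field_simp at hall
    linear_combination hall
  have hL : ∏ j, ∏ l, ratio (pad x) b j l ^ (s j / 2 - 1) = (B' / B) ^ (p / 2 - 1) *
      ((S / (vdm x ^ 2 * A * B)) ^ ((1 : ℝ) / 2 - 1) * (A' / A) ^ (q / 2 - 1)) := by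
    rw [prod_prod_ratio_rpow hδ hb (fun j => s j / 2 - 1), prod_univ_succ_castSucc]
    simp only [hs0, hs, hsl, hN0, hNl]
    rw [Real.finsetProd_rpow _ _ fun j _ =>
      Finset.prod_nonneg fun l _ => (ratio_pos hδ hb _ l).le, hmid]
  have hR : ∏ l, ∏ j, ratio b x l j ^ ((1 : ℝ) / 2 - 1) =
      (S / vdm b ^ 2) ^ ((1 : ℝ) / 2 - 1) := by
    rw [prod_prod_ratio_rpow hb'.1 hx' (fun _ => (1 : ℝ) / 2 - 1),
      Real.finsetProd_rpow _ _ fun j _ =>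
        Finset.prod_nonneg fun l _ => (ratio_pos hb'.1 hx' _ l).le, prod_prod_ratio hb'.1 hx']
  rw [hL, hR, jac_eq _ _ hx, jac_eq _ _ hb', vdm_pad]
  exact rpow_density_identity pV pW pA pB pA' pB' pS p q

/-- Tonelli for a region described as a family of slices in either variable. The set `D` of the
proof is that common region. -/
theorem setLIntegral_swap {X Y : Type*} [MeasurableSpace X] [MeasurableSpace Y] {μ : Measure X}
    {ν : Measure Y} [SFinite μ] [SFinite ν] {A : Set X} {B : X → Set Y} {A' : Set Y}
    {B' : Y → Set X} (hA : MeasurableSet A) (hB : ∀ x, MeasurableSet (B x))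
    (hA' : MeasurableSet A') (hB' : ∀ y, MeasurableSet (B' y))
    (hD : MeasurableSet {z : X × Y | z.2 ∈ A' ∧ z.1 ∈ B' z.2})
    (h : ∀ x y, (x ∈ A ∧ y ∈ B x) ↔ (y ∈ A' ∧ x ∈ B' y)) {G : X → Y → ENNReal}
    (hG : Measurable (Function.uncurry G)) :
    ∫⁻ x in A, ∫⁻ y in B x, G x y ∂ν ∂μ = ∫⁻ y in A', ∫⁻ x in B' y, G x y ∂μ ∂ν := by
  classical
  set D := {z : X × Y | z.2 ∈ A' ∧ z.1 ∈ B' z.2} with hDdef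
  have h1 : ∫⁻ x in A, ∫⁻ y in B x, G x y ∂ν ∂μ =
      ∫⁻ x, ∫⁻ y, D.indicator (Function.uncurry G) (x, y) ∂ν ∂μ := by
    rw [← lintegral_indicator hA]
    refine lintegral_congr fun x => ?_
    by_cases hx : x ∈ A
    · rw [Set.indicator_of_mem hx, ← lintegral_indicator (hB x)]
      refine lintegral_congr fun y => ?_
      have : y ∈ B x ↔ (x, y) ∈ D := ⟨fun hy => (h x y).1 ⟨hx, hy⟩, fun hy => ((h x y).2 hy).2⟩
      simp only [Set.indicator_apply, this]
      rfl
    · rw [Set.indicator_of_notMem hx]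
      symm
      rw [← lintegral_zero (μ := ν)]
      refine lintegral_congr fun y => ?_
      have hn : (x, y) ∉ D := fun hy => hx ((h x y).2 hy).1
      simp [hn]
  have h2 : ∫⁻ y in A', ∫⁻ x in B' y, G x y ∂μ ∂ν =
      ∫⁻ y, ∫⁻ x, D.indicator (Function.uncurry G) (x, y) ∂μ ∂ν := by
    rw [← lintegral_indicator hA']
    refine lintegral_congr fun y => ?_
    by_cases hy : y ∈ A'
    · rw [Set.indicator_of_mem hy, ← lintegral_indicator (hB' y)]
      refine lintegral_congr fun x => ?_
      have : x ∈ B' y ↔ (x, y) ∈ D := ⟨fun hx => ⟨hy, hx⟩, fun hx => hx.2⟩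
      simp only [Set.indicator_apply, this]
      rfl
    · rw [Set.indicator_of_notMem hy]
      symm
      rw [← lintegral_zero (μ := μ)]
      refine lintegral_congr fun x => ?_
      exact Set.indicator_of_notMem (fun hx => hy hx.1) _
  rw [h1, h2, lintegral_lintegral_swap]
  exact (hG.indicator hD).aemeasurable

/-- The total mass of the interlacing density with all exponents `-1/2`. -/
theorem lintegral_interlace_half {k : ℕ} {b : Fin (k + 1) → ℝ} (hb : StrictAnti b) :
    ∫⁻ x in interlace b, ENNReal.ofReal
      (vdm x / vdm b * ∏ l, ∏ j, ratio b x l j ^ ((1 : ℝ) / 2 - 1)) =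
    ENNReal.ofReal (Real.Gamma (1 / 2) ^ (k + 1) / Real.Gamma (((k : ℝ) + 1) / 2)) := by
  -- The Dixon–Anderson integral with all shapes `1/2` and constant integrand: the left side is the
  -- mass of a probability measure, so the mass of the density is read off.
  have h := lintegral_pi_gammaMeasure (s := fun _ => (1 : ℝ) / 2) hb (fun _ => by norm_num)
    (F := fun _ => 1) (φ := fun _ => 1) measurable_const (fun _ _ => rfl)
  have hp : IsProbabilityMeasure
      (Measure.pi fun _ : Fin (k + 1) => ProbabilityTheory.gammaMeasure ((1 : ℝ) / 2) 1) := by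
    have : IsProbabilityMeasure (ProbabilityTheory.gammaMeasure ((1 : ℝ) / 2) 1) :=
      ProbabilityTheory.isProbabilityMeasure_gammaMeasure (by norm_num) one_pos
    infer_instance
  simp only [lintegral_const, measure_univ, one_mul, Finset.sum_const, Finset.prod_const,
    Finset.card_univ, Fintype.card_fin] at h
  have hsum : (k + 1) • ((1 : ℝ) / 2) = ((k : ℝ) + 1) / 2 := by
    rw [nsmul_eq_mul]; push_cast; ring
  rw [hsum] at h
  have hG : 0 < Real.Gamma (((k : ℝ) + 1) / 2) := Real.Gamma_pos_of_pos (by positivity)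
  have hG' : 0 < Real.Gamma ((1 : ℝ) / 2) := Real.Gamma_pos_of_pos (by positivity)
  calc _ = ENNReal.ofReal (Real.Gamma (1 / 2) ^ (k + 1) / Real.Gamma (((k : ℝ) + 1) / 2)) *
        (ENNReal.ofReal (Real.Gamma (((k : ℝ) + 1) / 2) / Real.Gamma (1 / 2) ^ (k + 1)) *
        ∫⁻ x in interlace b, ENNReal.ofReal
          (vdm x / vdm b * ∏ l, ∏ j, ratio b x l j ^ ((1 : ℝ) / 2 - 1))) := by
        rw [← mul_assoc, ← ENNReal.ofReal_mul (by positivity),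
          div_mul_div_cancel₀ hG.ne', div_self (by positivity), ENNReal.ofReal_one, one_mul]
    _ = _ := by rw [← h, mul_one]

/-- The transition from `k` to `k + 1` angles maps Jacobi ensembles to Jacobi ensembles. -/
theorem lintegral_jacobi_step {k : ℕ} (p q : ℝ) (s : Fin (k + 2) → ℝ) (hs0 : s 0 = p)
    (hs : ∀ j : Fin k, s j.castSucc.succ = 1) (hsl : s (Fin.last k).succ = q)
    {φ : (Fin (k + 1) → ℝ) → ENNReal} (hφ : Measurable φ) :
    ∫⁻ x in openSimplex k, (∫⁻ b in interlace (pad x), φ b * ENNReal.ofReal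
      (vdm b / vdm (pad x) * ∏ j, ∏ l, ratio (pad x) b j l ^ (s j / 2 - 1))) *
        ENNReal.ofReal (jac ((q - 1) / 2) ((p - 1) / 2) x) =
    ENNReal.ofReal (Real.Gamma (1 / 2) ^ (k + 1) / Real.Gamma (((k : ℝ) + 1) / 2)) *
      ∫⁻ b in openSimplex (k + 1), φ b * ENNReal.ofReal (jac (q / 2 - 1) (p / 2 - 1) b) := by
  have hjac : ∀ {m : ℕ} {α β : ℝ} {x : Fin m → ℝ}, x ∈ openSimplex m → 0 ≤ jac α β x := by
    intro m α β x hx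
    refine mul_nonneg (vdm_pos hx.1).le (Finset.prod_nonneg fun j _ => ?_)
    exact mul_nonneg (Real.rpow_nonneg (hx.2 j).1.le _)
      (Real.rpow_nonneg (sub_pos.2 (hx.2 j).2).le _)
  set G : (Fin k → ℝ) → (Fin (k + 1) → ℝ) → ENNReal := fun x b => φ b * (ENNReal.ofReal
    (jac (q / 2 - 1) (p / 2 - 1) b) * ENNReal.ofReal
      (vdm x / vdm b * ∏ l, ∏ j, ratio b x l j ^ ((1 : ℝ) / 2 - 1))) with hGdef
  have hmeas : Measurable fun z : (Fin k → ℝ) × (Fin (k + 1) → ℝ) =>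
      vdm z.1 / vdm z.2 * ∏ l, ∏ j, ratio z.2 z.1 l j ^ ((1 : ℝ) / 2 - 1) := by
    unfold vdm ratio
    fun_prop
  have hG : Measurable (Function.uncurry G) := by
    have h2 : Measurable fun z : (Fin k → ℝ) × (Fin (k + 1) → ℝ) =>
        jac (q / 2 - 1) (p / 2 - 1) z.2 := (measurable_jac _ _).comp measurable_snd
    exact (hφ.comp measurable_snd).mul (h2.ennreal_ofReal.mul hmeas.ennreal_ofReal)
  have hL : ∫⁻ x in openSimplex k, (∫⁻ b in interlace (pad x), φ b * ENNReal.ofReal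
      (vdm b / vdm (pad x) * ∏ j, ∏ l, ratio (pad x) b j l ^ (s j / 2 - 1))) *
        ENNReal.ofReal (jac ((q - 1) / 2) ((p - 1) / 2) x) =
      ∫⁻ x in openSimplex k, ∫⁻ b in interlace (pad x), G x b := by
    refine setLIntegral_congr_fun (isOpen_openSimplex k).measurableSet fun x hx => ?_
    rw [← lintegral_mul_const' _ _ ENNReal.ofReal_ne_top]
    refine setLIntegral_congr_fun (isOpen_interlace _).measurableSet fun b hb => ?_
    have hb' := (openSimplex_interlace_iff.1 ⟨hx, hb⟩).1
    simp only [hGdef]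
    rw [← ENNReal.ofReal_mul (hjac hb'), ← jac_mul_transition hx hb p q s hs0 hs hsl,
      ENNReal.ofReal_mul (hjac hx), mul_assoc, mul_comm (ENNReal.ofReal (jac _ _ x))]
  rw [hL, setLIntegral_swap (A' := openSimplex (k + 1)) (B' := interlace)
    (isOpen_openSimplex k).measurableSet (fun _ => (isOpen_interlace _).measurableSet)
    (isOpen_openSimplex _).measurableSet (fun _ => (isOpen_interlace _).measurableSet) ?_
    (fun x b => openSimplex_interlace_iff) hG,
    ← lintegral_const_mul' _ _ ENNReal.ofReal_ne_top]
  · refine setLIntegral_congr_fun (isOpen_openSimplex _).measurableSet fun b hb => ?_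
    simp only [hGdef]
    have hm : Measurable fun x : Fin k → ℝ =>
        ENNReal.ofReal (vdm x / vdm b * ∏ l, ∏ j, ratio b x l j ^ ((1 : ℝ) / 2 - 1)) :=
      (hmeas.comp (measurable_id.prodMk measurable_const)).ennreal_ofReal
    simp only [← mul_assoc]
    -- Only the reversed kernel depends on `x`, and its mass is the same for every `b`. This is why
    -- the Jacobi form survives the step.
    rw [lintegral_const_mul _ hm, lintegral_interlace_half hb.1]
    ring
  · refine IsOpen.measurableSet (IsOpen.inter ?_ ?_)
    · exact (isOpen_openSimplex _).preimage continuous_snd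
    · have : {z : (Fin k → ℝ) × (Fin (k + 1) → ℝ) | z.1 ∈ interlace z.2} =
          ⋂ l, {z | z.2 l.succ < z.1 l} ∩ {z | z.1 l < z.2 l.castSucc} := by
        ext z
        simp [interlace]
      change IsOpen {z : (Fin k → ℝ) × (Fin (k + 1) → ℝ) | z.1 ∈ interlace z.2}
      rw [this]
      refine isOpen_iInter_of_finite fun l => IsOpen.inter ?_ ?_ <;>
        exact isOpen_lt (by fun_prop) (by fun_prop)

end InvGrass

end

/-! ### Induction on the number of angles -/

noncomputable section

namespace InvGrass

open Polynomial

/-- Transports the corner law to sizes that are consecutive only propositionally, as `n - (k + 1)`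
and `n - k` are. -/
theorem lintegral_corner_castLE {K N N' : ℕ} (hN : N' + 1 = N) {δ : Fin (K + 1) → ℝ}
    (hδ : StrictAnti δ) {m : Fin (K + 1) → ℕ} (hm : ∀ j, 0 < m j)
    {A : Matrix (Fin N) (Fin N) ℝ} (hA : A.IsHermitian)
    (hχ : A.charpoly = ∏ j, (X - C (δ j)) ^ m j)
    {e : On N → Fin K → ℝ} (he : ∀ h, Antitone (e h))
    (heχ : ∀ h : On N, (((h : Matrix (Fin N) (Fin N) ℝ) * A *
      (h : Matrix (Fin N) (Fin N) ℝ)ᵀ).submatrix (Fin.castLE (by omega : N' ≤ N))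
        (Fin.castLE (by omega : N' ≤ N))).charpoly =
        (∏ j, (X - C (δ j)) ^ (m j - 1)) * ∏ l, (X - C (e h l)))
    {φ : (Fin K → ℝ) → ENNReal} (hφ : Measurable φ) :
    ∫⁻ h, φ (e h) ∂(haarOn N) =
      ENNReal.ofReal (Real.Gamma (∑ j, (m j : ℝ) / 2) / ∏ j, Real.Gamma ((m j : ℝ) / 2)) *
        ∫⁻ b in interlace δ, φ b *
          ENNReal.ofReal (vdm b / vdm δ * ∏ j, ∏ l, ratio δ b j l ^ ((m j : ℝ) / 2 - 1)) := by
  subst hN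
  exact lintegral_corner_eigenvalues hδ hm hA hχ he heχ hφ

/-- The multiplicities `p, 1, …, 1, q`. -/
def multip (p q k : ℕ) : Fin (k + 2) → ℕ := Fin.cons p (Fin.snoc (fun _ => 1) q : Fin (k + 1) → ℕ)

theorem multip_zero (p q k : ℕ) : multip p q k 0 = p := rfl

theorem multip_mid (p q k : ℕ) (j : Fin k) : multip p q k j.castSucc.succ = 1 := by
  simp [multip]

theorem multip_last (p q k : ℕ) : multip p q k (Fin.last k).succ = q := by
  rw [multip, Fin.cons_succ, Fin.snoc_last]

theorem sub_conj_On {N : ℕ} (γ : On N) (P : Matrix (Fin N) (Fin N) ℝ) :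
    1 - (γ : Matrix (Fin N) (Fin N) ℝ) * P * (γ : Matrix (Fin N) (Fin N) ℝ)ᵀ =
      (γ : Matrix (Fin N) (Fin N) ℝ) * (1 - P) * (γ : Matrix (Fin N) (Fin N) ℝ)ᵀ := by
  rw [Matrix.mul_sub, Matrix.sub_mul, Matrix.mul_one, On_mul_transpose]

/-- The law of the `k + 1` angles, given the `k` angles, when the first `n - k` coordinates are
rotated at random. -/
theorem lintegral_spec_embK {n i k : ℕ} (hk : k ≤ n) (hki : k + 1 ≤ i) (hkn : k + 1 + i ≤ n)
    (ξ : Gr n i) {x : Fin k → ℝ} (hx : IsSpec (projMatrix ξ.1) x) (hxo : x ∈ openSimplex k)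
    {e : On (n - k) → Fin (k + 1) → ℝ}
    (he : ∀ h, IsSpec (projMatrix (embK hk h 1 • ξ).1) (e h))
    {φ : (Fin (k + 1) → ℝ) → ENNReal} (hφ : Measurable φ) :
    ∫⁻ h, φ (e h) ∂(haarOn (n - k)) =
      ENNReal.ofReal (Real.Gamma (((n : ℝ) - k) / 2) / (Real.Gamma (((n : ℝ) - i - k) / 2) *
        (Real.Gamma (1 / 2) ^ k * Real.Gamma (((i : ℝ) - k) / 2)))) *
        ∫⁻ b in interlace (pad x), φ b * ENNReal.ofReal (vdm b / vdm (pad x) *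
          ∏ j, ∏ l, ratio (pad x) b j l ^ ((multip (n - i - k) (i - k) k j : ℝ) / 2 - 1)) := by
  have hN : n - (k + 1) + 1 = n - k := by omega
  have hp : 0 < n - i - k := by omega
  have hq : 0 < i - k := by omega
  have cp : ((n - i - k : ℕ) : ℝ) = (n : ℝ) - i - k := by
    rw [Nat.cast_sub (by omega), Nat.cast_sub (by omega)]
  have cq : ((i - k : ℕ) : ℝ) = (i : ℝ) - k := by rw [Nat.cast_sub (by omega)]
  have hm : ∀ j, 0 < multip (n - i - k) (i - k) k j := by
    intro j
    refine Fin.cases hp (fun j => Fin.lastCases ?_ (fun j => ?_) j) j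
    · rw [multip_last]; exact hq
    · rw [multip_mid]; exact one_pos
  have hsplit : ∀ {R : Type} [CommMonoid R] (f : Fin (k + 2) → R),
      ∏ j, f j = f 0 * ((∏ j : Fin k, f j.castSucc.succ) * f (Fin.last k).succ) := by
    intro R _ f
    rw [Fin.prod_univ_succ, Fin.prod_univ_castSucc]
  have hsplit' : ∀ f : Fin (k + 2) → ℝ,
      ∑ j, f j = f 0 + ((∑ j : Fin k, f j.castSucc.succ) + f (Fin.last k).succ) := by
    intro f
    rw [Fin.sum_univ_succ, Fin.sum_univ_castSucc]
  set A := (1 - projMatrix ξ.1).submatrix (Fin.castLE (Nat.sub_le n k))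
      (Fin.castLE (Nat.sub_le n k)) with hA
  have hAh : A.IsHermitian :=
    ((Matrix.isHermitian_one).sub (projMatrix_isHermitian ξ.1)).submatrix _
  have hχ : A.charpoly = ∏ j, (X - C (pad x j)) ^ multip (n - i - k) (i - k) k j := by
    rw [hA, charpoly_corner (by omega) (by omega) ξ hx, hsplit]
    simp only [pad_zero, pad_mid, pad_last, multip_zero, multip_mid, multip_last, pow_one, C_1,
      C_0, sub_zero]
    ring
  have hstep := lintegral_corner_castLE hN (strictAnti_pad hxo) hm hAh hχ (e := e)
    (fun h => (he h).1.1) (fun h => ?_) hφ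
  · rw [hstep]
    congr 4
    · rw [hsplit']
      simp only [multip_zero, multip_mid, multip_last, cp, cq, Finset.sum_const, Finset.card_univ,
        Fintype.card_fin, nsmul_eq_mul, Nat.cast_one]
      ring
    · rw [hsplit]
      simp only [multip_zero, multip_mid, multip_last, cp, cq, Finset.prod_const,
        Finset.card_univ, Fintype.card_fin, Nat.cast_one]
  -- Going from `k` to `k + 1` lowers the multiplicities of `0` and `1` by one and makes those of
  -- the `x_j` zero, which is precisely the factor `∏ (X - δ_j) ^ (m_j - 1)` of the corner law.
  · have h1 := charpoly_corner hki hkn (embK hk h 1 • ξ) (he h)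
    rw [projMatrix_smul, sub_conj_On] at h1
    rw [hA, ← corner_embK_conj hk h 1 (1 - projMatrix ξ.1)]
    refine Eq.trans h1 ?_
    rw [hsplit]
    simp only [pad_zero, pad_mid, pad_last, multip_zero, multip_mid, multip_last, C_1,
      C_0, sub_zero, Nat.sub_self, pow_zero, Finset.prod_const_one, one_mul, Nat.sub_sub, add_assoc]
    ring

theorem exists_isSpec {n k : ℕ} (hk : k ≤ n) (V : Submodule ℝ (EuclideanSpace ℝ (Fin n))) :
    ∃ x : Fin k → ℝ, IsSpec (projMatrix V) x :=
  ⟨_, isSpec_eigs ((stdOrthonormalBasis ℝ (coordSubspace n k)).reindex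
    (finCongr (finrank_coordSubspace hk))) V⟩

theorem continuous_projMatrix_orbit {n i : ℕ} (ξ : Gr n i) :
    Continuous fun γ : On n => projMatrix (γ • ξ).1 :=
  (continuous_induced_dom (f := fun ξ : Gr n i => projMatrix ξ.1)).comp (continuous_orbit ξ)

theorem siegelGamma_succ (m : ℕ) (a : ℝ) :
    siegelGamma (m + 1) a =
      siegelGamma m a * (Real.pi ^ ((m : ℝ) / 2) * Real.Gamma (a - (m : ℝ) / 2)) := by
  have h : ((m + 1 : ℕ) : ℝ) * (((m + 1 : ℕ) : ℝ) - 1) / 4 =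
      (m : ℝ) * ((m : ℝ) - 1) / 4 + (m : ℝ) / 2 := by push_cast; ring
  rw [siegelGamma, siegelGamma, Finset.prod_range_succ, h, Real.rpow_add Real.pi_pos]
  ring

/-- The smallest gamma argument is `a - (m - 1) / 2`, and the hypothesis says that it is positive.
-/
theorem siegelGamma_pos {m : ℕ} {a : ℝ} (h : (m : ℝ) < 2 * a + 1) : 0 < siegelGamma m a := by
  refine mul_pos (Real.rpow_pos_of_pos Real.pi_pos _) (Finset.prod_pos fun j hj => ?_)
  have : (j : ℝ) + 1 ≤ m := by exact_mod_cast Finset.mem_range.1 hj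
  exact Real.Gamma_pos_of_pos (by linarith)

theorem cOrd_succ (m : ℕ) : cOrd (m + 1) = cOrd m *
    (Real.pi ^ ((m : ℝ) / 2) * Real.Gamma (1 / 2) / Real.Gamma (((m : ℝ) + 1) / 2)) := by
  have h : (((m + 1 : ℕ) : ℝ) ^ 2 + ((m + 1 : ℕ) : ℝ)) / 4 =
      ((m : ℝ) ^ 2 + m) / 4 + ((m : ℝ) / 2 + 1 / 2) := by push_cast; ring
  rw [cOrd, cOrd, Finset.prod_Icc_succ_top (by omega), h, Real.rpow_add Real.pi_pos,
    Real.rpow_add Real.pi_pos, Real.Gamma_one_half_eq, Real.sqrt_eq_rpow]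
  push_cast
  rw [mul_div_mul_comm]

theorem cOrd_pos (m : ℕ) : 0 < cOrd m :=
  div_pos (Real.rpow_pos_of_pos Real.pi_pos _) (Finset.prod_pos fun j hj =>
    Real.Gamma_pos_of_pos (by
      have : (0 : ℝ) < j := by exact_mod_cast (Finset.mem_Icc.1 hj).1
      positivity))

/-- The normalizing constant of the law of the `k` angles. -/
def lawConst (n i k : ℕ) : ℝ :=
  cOrd k * (siegelGamma k (n / 2) / (siegelGamma k (i / 2) * siegelGamma k (((n : ℝ) - i) / 2)))

theorem lawConst_zero (n i : ℕ) : lawConst n i 0 = 1 := by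
  simp [lawConst, cOrd, siegelGamma]

theorem lawConst_pos {n i k : ℕ} (hki : k ≤ i) (hkn : k + i ≤ n) : 0 < lawConst n i k := by
  have h1 : (k : ℝ) ≤ i := by exact_mod_cast hki
  have h2 : (k : ℝ) + i ≤ n := by exact_mod_cast hkn
  have h3 : (0 : ℝ) ≤ i := Nat.cast_nonneg i
  refine mul_pos (cOrd_pos k) (div_pos (siegelGamma_pos (by linarith)) (mul_pos
    (siegelGamma_pos (by linarith)) (siegelGamma_pos (by linarith))))

/-- The new factor is the normalization of the transition density times the mass of the reversed
kernel. The powers of `π` from the Siegel gamma functions cancel against the one from `cOrd`. -/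
theorem lawConst_succ {n i k : ℕ} (hki : k + 1 ≤ i) (hkn : k + 1 + i ≤ n) :
    lawConst n i (k + 1) = lawConst n i k *
      (Real.Gamma (((n : ℝ) - k) / 2) / (Real.Gamma (((n : ℝ) - i - k) / 2) *
        (Real.Gamma (1 / 2) ^ k * Real.Gamma (((i : ℝ) - k) / 2))) *
      (Real.Gamma (1 / 2) ^ (k + 1) / Real.Gamma (((k : ℝ) + 1) / 2))) := by
  have h1 : (k : ℝ) + 1 ≤ i := by exact_mod_cast hki
  have h2 : (k : ℝ) + 1 + i ≤ n := by exact_mod_cast hkn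
  have h3 : (0 : ℝ) ≤ k := Nat.cast_nonneg k
  have e1 : (n : ℝ) / 2 - (k : ℝ) / 2 = ((n : ℝ) - k) / 2 := by ring
  have e2 : (i : ℝ) / 2 - (k : ℝ) / 2 = ((i : ℝ) - k) / 2 := by ring
  have e3 : ((n : ℝ) - i) / 2 - (k : ℝ) / 2 = ((n : ℝ) - i - k) / 2 := by ring
  have g1 : Real.Gamma (((i : ℝ) - k) / 2) ≠ 0 := (Real.Gamma_pos_of_pos (by linarith)).ne'
  have g2 : Real.Gamma (((n : ℝ) - i - k) / 2) ≠ 0 := (Real.Gamma_pos_of_pos (by linarith)).ne'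
  have g3 : Real.Gamma (((k : ℝ) + 1) / 2) ≠ 0 := (Real.Gamma_pos_of_pos (by linarith)).ne'
  have g4 : Real.Gamma ((1 : ℝ) / 2) ≠ 0 := (Real.Gamma_pos_of_pos (by norm_num)).ne'
  have s1 : siegelGamma k ((i : ℝ) / 2) ≠ 0 := (siegelGamma_pos (by linarith)).ne'
  have s2 : siegelGamma k (((n : ℝ) - i) / 2) ≠ 0 := (siegelGamma_pos (by linarith)).ne'
  have t0 : Real.pi ^ ((k : ℝ) / 2) ≠ 0 := (Real.rpow_pos_of_pos Real.pi_pos _).ne'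
  rw [lawConst, lawConst, siegelGamma_succ, siegelGamma_succ, siegelGamma_succ, cOrd_succ,
    e1, e2, e3]
  generalize Real.pi ^ ((k : ℝ) / 2) = t at *
  generalize Real.Gamma (((i : ℝ) - k) / 2) = a1 at *
  generalize Real.Gamma (((n : ℝ) - i - k) / 2) = a2 at *
  generalize Real.Gamma (((k : ℝ) + 1) / 2) = a3 at *
  generalize Real.Gamma ((1 : ℝ) / 2) = a4 at *
  generalize siegelGamma k ((i : ℝ) / 2) = b1 at *
  generalize siegelGamma k (((n : ℝ) - i) / 2) = b2 at *
  field_simp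
  ring

theorem continuous_pad (k : ℕ) : Continuous (pad (k := k)) := by
  refine continuous_pi fun j => Fin.cases ?_ (fun j => Fin.lastCases ?_ (fun j => ?_) j) j
  · simpa using continuous_const
  · simp only [pad_last]
    exact continuous_const
  · simpa using continuous_apply j

theorem isOpen_pair_interlace_pad (k : ℕ) :
    IsOpen {z : (Fin k → ℝ) × (Fin (k + 1) → ℝ) | z.2 ∈ interlace (pad z.1)} := by
  have hc : Continuous fun z : (Fin k → ℝ) × (Fin (k + 1) → ℝ) => pad z.1 :=
    (continuous_pad k).comp continuous_fst
  have : {z : (Fin k → ℝ) × (Fin (k + 1) → ℝ) | z.2 ∈ interlace (pad z.1)} =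
      ⋂ l, {z | pad z.1 l.succ < z.2 l} ∩ {z | z.2 l < pad z.1 l.castSucc} := by
    ext z
    simp [interlace]
  rw [this]
  refine isOpen_iInter_of_finite fun l => IsOpen.inter ?_ ?_
  · exact isOpen_lt ((continuous_apply _).comp hc) ((continuous_apply _).comp continuous_snd)
  · exact isOpen_lt ((continuous_apply _).comp continuous_snd) ((continuous_apply _).comp hc)

/-- The slices `interlace (pad x)` vary with `x`, so the inner integral is rewritten as that of an
indicator over an open set of pairs. -/
theorem measurable_transition {k : ℕ} {φ : (Fin (k + 1) → ℝ) → ENNReal} (hφ : Measurable φ)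
    (s : Fin (k + 2) → ℝ) :
    Measurable fun x : Fin k → ℝ => ∫⁻ b in interlace (pad x), φ b * ENNReal.ofReal
      (vdm b / vdm (pad x) * ∏ j, ∏ l, ratio (pad x) b j l ^ s j) := by
  have hpad : Measurable fun z : (Fin k → ℝ) × (Fin (k + 1) → ℝ) => pad z.1 :=
    (continuous_pad k).measurable.comp measurable_fst
  have hr : ∀ (j : Fin (k + 2)), Measurable fun z : (Fin k → ℝ) × (Fin (k + 1) → ℝ) =>
      pad z.1 j := fun j => (measurable_pi_apply j).comp hpad
  have hF : Measurable fun z : (Fin k → ℝ) × (Fin (k + 1) → ℝ) => φ z.2 * ENNReal.ofReal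
      (vdm z.2 / vdm (pad z.1) * ∏ j, ∏ l, ratio (pad z.1) z.2 j l ^ s j) := by
    refine (hφ.comp measurable_snd).mul (Measurable.ennreal_ofReal ?_)
    unfold vdm ratio
    fun_prop
  have := (hF.indicator (isOpen_pair_interlace_pad k).measurableSet).lintegral_prod_right'
    (ν := (volume : Measure (Fin (k + 1) → ℝ)))
  convert this using 2 with x
  rw [← lintegral_indicator (isOpen_interlace _).measurableSet]
  rfl

/-- The law of the squared cosines of the canonical angles between `γ ℝ^i` and `ℝ^k`, for `γ`
distributed according to the Haar measure of `O(n)`. -/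
theorem lintegral_spec_haarOn {n i : ℕ} (hin : i ≤ n) (k : ℕ) (hki : k ≤ i) (hkn : k + i ≤ n)
    {d : On n → Fin k → ℝ} (hd : ∀ γ, IsSpec (projMatrix (γ • basePoint hin).1) (d γ))
    {φ : (Fin k → ℝ) → ENNReal} (hφ : Measurable φ) :
    ∫⁻ γ, φ (d γ) ∂(haarOn n) = ENNReal.ofReal (lawConst n i k) *
      ∫⁻ x, φ x ∂(nu k (((i : ℝ) - k - 1) / 2) (((n : ℝ) - i - k - 1) / 2)) := by
  induction k with
  | zero =>
    rw [lintegral_nu _ _ hφ, lawConst_zero, ENNReal.ofReal_one, one_mul]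
    have ho : openSimplex 0 = Set.univ :=
      Set.eq_univ_of_forall fun x => ⟨fun a => a.elim0, fun a => a.elim0⟩
    have hd0 : ∀ γ, d γ = 0 := fun γ => Subsingleton.elim _ _
    rw [ho, Measure.restrict_univ, Measure.volume_pi_eq_dirac (0 : Fin 0 → ℝ), lintegral_dirac]
    simp [hd0, jac, vdm]
  | succ k ih =>
    have hk : k ≤ n := by omega
    choose d' hd' using fun γ : On n => exists_isSpec hk (γ • basePoint hin).1
    have hdc : Continuous d := continuous_of_isSpec (continuous_projMatrix_orbit _) hd
    have hd'c : Continuous d' := continuous_of_isSpec (continuous_projMatrix_orbit _) hd'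
    have hih := fun {ψ : (Fin k → ℝ) → ENNReal} (hψ : Measurable ψ) =>
      ih (by omega) (by omega) hd' hψ
    -- The induction hypothesis itself shows that the boundary of the simplex is almost never hit.
    -- The corner law requires distinct nodes `1, x_1, …, x_k, 0`.
    have hopen : ∀ᵐ γ ∂(haarOn n), d' γ ∈ openSimplex k := by
      have hm : MeasurableSet (openSimplex k)ᶜ := (isOpen_openSimplex k).measurableSet.compl
      have hm' : Measurable fun γ => (openSimplex k)ᶜ.indicator (1 : (Fin k → ℝ) → ENNReal) (d' γ) :=
        (measurable_one.indicator hm).comp hd'c.measurable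
      have h0 := hih (ψ := (openSimplex k)ᶜ.indicator 1) (measurable_one.indicator hm)
      rw [lintegral_nu _ _ (measurable_one.indicator hm),
        setLIntegral_congr_fun (g := fun _ => 0) (isOpen_openSimplex k).measurableSet
          (fun x hx => by
            have hx' : x ∉ (openSimplex k)ᶜ := fun h => h hx
            simp only [Set.indicator_of_notMem hx', zero_mul]), lintegral_zero, mul_zero,
        lintegral_eq_zero_iff hm'] at h0
      filter_upwards [h0] with γ hγ
      by_contra hn
      have hn' : d' γ ∈ (openSimplex k)ᶜ := hn
      simp [hn'] at hγ
    set s : Fin (k + 2) → ℝ := fun j => (multip (n - i - k) (i - k) k j : ℝ) with hs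
    have cp : ((n - i - k : ℕ) : ℝ) = (n : ℝ) - i - k := by
      rw [Nat.cast_sub (by omega), Nat.cast_sub (by omega)]
    have cq : ((i - k : ℕ) : ℝ) = (i : ℝ) - k := by rw [Nat.cast_sub (by omega)]
    set c : ℝ := Real.Gamma (((n : ℝ) - k) / 2) / (Real.Gamma (((n : ℝ) - i - k) / 2) *
        (Real.Gamma (1 / 2) ^ k * Real.Gamma (((i : ℝ) - k) / 2))) with hc
    set Φ : (Fin k → ℝ) → ENNReal := fun x => ∫⁻ b in interlace (pad x), φ b * ENNReal.ofReal
      (vdm b / vdm (pad x) * ∏ j, ∏ l, ratio (pad x) b j l ^ (s j / 2 - 1)) with hΦ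
    have hΦm : Measurable Φ := measurable_transition hφ fun j => s j / 2 - 1
    have hemb : Continuous fun z : On (n - k) × On n => embK hk z.1 1 * z.2 :=
      ((continuous_embK hk).comp (continuous_fst.prodMk continuous_const)).mul continuous_snd
    have hmeas : Measurable fun z : On (n - k) × On n => φ (d (embK hk z.1 1 * z.2)) :=
      (hφ.comp hdc.measurable).comp hemb.measurable
    -- Left invariance allows an extra average over rotations of the first `n - k` coordinates. For
    -- fixed `γ` this average is the corner law started at `d' γ`.
    have h1 : ∫⁻ γ, φ (d γ) ∂(haarOn n) =
        ∫⁻ γ, ∫⁻ h, φ (d (embK hk h 1 * γ)) ∂(haarOn (n - k)) ∂(haarOn n) := by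
      rw [← lintegral_lintegral_swap hmeas.aemeasurable]
      simp only [lintegral_mul_left_eq_self (μ := haarOn n) (fun γ => φ (d γ))]
      simp
    have h2 : ∫⁻ γ, ∫⁻ h, φ (d (embK hk h 1 * γ)) ∂(haarOn (n - k)) ∂(haarOn n) =
        ∫⁻ γ, ENNReal.ofReal c * Φ (d' γ) ∂(haarOn n) := by
      refine lintegral_congr_ae ?_
      filter_upwards [hopen] with γ hγ
      refine lintegral_spec_embK hk hki hkn (γ • basePoint hin) (hd' γ) hγ (fun h => ?_) hφ
      rw [← mul_smul]
      exact hd _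
    rw [h1, h2, lintegral_const_mul' _ _ ENNReal.ofReal_ne_top, hih hΦm, lintegral_nu _ _ hΦm,
      lintegral_nu _ _ hφ]
    have h3 := lintegral_jacobi_step ((n : ℝ) - i - k) ((i : ℝ) - k) s
      (by rw [hs, ← cp]; rfl) (fun j => by simp [hs, multip_mid])
      (by simp only [hs, multip_last, cq]) hφ
    rw [h3, lawConst_succ hki hkn, ENNReal.ofReal_mul (lawConst_pos (by omega) (by omega)).le,
      ENNReal.ofReal_mul']
    · have e1 : ((i : ℝ) - ((k + 1 : ℕ) : ℝ) - 1) / 2 = ((i : ℝ) - k) / 2 - 1 := by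
        push_cast; ring
      have e2 : ((n : ℝ) - i - ((k + 1 : ℕ) : ℝ) - 1) / 2 = ((n : ℝ) - i - k) / 2 - 1 := by
        push_cast; ring
      rw [e1, e2]
      ring
    · exact div_nonneg (pow_nonneg (Real.Gamma_pos_of_pos (by norm_num)).le _)
        (Real.Gamma_pos_of_pos (by positivity)).le

end InvGrass

end

/-! ### Canonical angles separate the orbits of `K_ℓ` -/

noncomputable section

namespace InvGrass

open Polynomial

theorem starProjection_eq_toEuclideanLin {n : ℕ} (V : Submodule ℝ (EuclideanSpace ℝ (Fin n)))
    (x : EuclideanSpace ℝ (Fin n)) :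
    V.starProjection x = Matrix.toEuclideanLin (projMatrix V) x := by
  suffices h : (V.starProjection : EuclideanSpace ℝ (Fin n) →ₗ[ℝ] EuclideanSpace ℝ (Fin n)) =
      Matrix.toEuclideanLin (projMatrix V) from LinearMap.congr_fun h x
  refine (EuclideanSpace.basisFun (Fin n) ℝ).toBasis.ext fun b => ?_
  ext a
  simp [projMatrix, Matrix.toLpLin_apply]

theorem projMatrix_injective {n : ℕ} :
    Function.Injective (projMatrix : Submodule ℝ (EuclideanSpace ℝ (Fin n)) → _) := by
  intro U V h
  refine Submodule.starProjection_inj.1 (ContinuousLinearMap.ext fun x => ?_)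
  rw [starProjection_eq_toEuclideanLin, starProjection_eq_toEuclideanLin, h]

/-- A linear isometry of Euclidean space is given by an orthogonal matrix. -/
theorem exists_On_of_linearIsometry {p : ℕ}
    (M : EuclideanSpace ℝ (Fin p) →ₗᵢ[ℝ] EuclideanSpace ℝ (Fin p)) :
    ∃ b : On p, ∀ v, M v = Matrix.toEuclideanLin (b : Matrix (Fin p) (Fin p) ℝ) v := by
  set B : Matrix (Fin p) (Fin p) ℝ :=
    Matrix.of fun a c => M (EuclideanSpace.single c (1 : ℝ)) a with hB
  have hMB : ∀ v, M v = Matrix.toEuclideanLin B v := by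
    suffices h : M.toLinearMap = Matrix.toEuclideanLin B from fun v => LinearMap.congr_fun h v
    refine (EuclideanSpace.basisFun (Fin p) ℝ).toBasis.ext fun b => ?_
    ext a
    simp [hB, Matrix.toLpLin_apply]
  refine ⟨⟨B, (Matrix.mem_orthogonalGroup_iff' (Fin p) ℝ).2 ?_⟩, hMB⟩
  ext c c'
  have h := M.inner_map_map (EuclideanSpace.single c (1 : ℝ)) (EuclideanSpace.single c' (1 : ℝ))
  rw [EuclideanSpace.inner_eq_star_dotProduct, EuclideanSpace.inner_single_left] at h
  rw [Matrix.mul_apply]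
  simp only [Matrix.transpose_apply, hB, Matrix.of_apply]
  simp only [dotProduct, star_trivial, map_one, one_mul, PiLp.single_apply] at h
  rw [Matrix.one_apply, ← h]
  exact Finset.sum_congr rfl fun a _ => mul_comm _ _

/-- Two families of vectors with the same Gram matrix differ by an orthogonal matrix. -/
theorem exists_On_mul_eq_of_gram_eq {p k : ℕ} {Y Z : Matrix (Fin p) (Fin k) ℝ}
    (h : Yᵀ * Y = Zᵀ * Z) : ∃ b : On p, Z = (b : Matrix (Fin p) (Fin p) ℝ) * Y := by
  let L : EuclideanSpace ℝ (Fin k) →ₗ[ℝ] EuclideanSpace ℝ (Fin p) := Matrix.toEuclideanLin Y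
  let L' : EuclideanSpace ℝ (Fin k) →ₗ[ℝ] EuclideanSpace ℝ (Fin p) := Matrix.toEuclideanLin Z
  have hnorm : ∀ v, ‖L' v‖ = ‖L v‖ := by
    intro v
    have hsq : ∀ W : Matrix (Fin p) (Fin k) ℝ, ‖Matrix.toEuclideanLin W v‖ ^ 2 =
        v.ofLp ⬝ᵥ ((Wᵀ * W) *ᵥ v.ofLp) := by
      intro W
      rw [← real_inner_self_eq_norm_sq, EuclideanSpace.inner_eq_star_dotProduct]
      simp [Matrix.toLpLin_apply, ← Matrix.mulVec_mulVec, Matrix.dotProduct_mulVec,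
        Matrix.vecMul_transpose]
    rw [← sq_eq_sq₀ (norm_nonneg _) (norm_nonneg _)]
    exact (hsq Z).trans ((hsq Y).trans (by rw [h])).symm |>.trans rfl
  -- Equal Gram matrices mean `|Z v| = |Y v|` for all `v`. Hence `Y v ↦ Z v` is a well-defined
  -- isometry on the range of `Y`, and it extends to the whole space.
  have hker : LinearMap.ker L ≤ LinearMap.ker L' := by
    intro v hv
    rw [LinearMap.mem_ker] at hv ⊢
    rw [← norm_eq_zero, hnorm, hv, norm_zero]
  let S : LinearMap.range L →ₗ[ℝ] EuclideanSpace ℝ (Fin p) :=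
    ((LinearMap.ker L).liftQ L' hker) ∘ₗ (L.quotKerEquivRange.symm : _ →ₗ[ℝ] _)
  have hS : ∀ v, S ⟨L v, LinearMap.mem_range_self L v⟩ = L' v := by
    intro v
    have hv : L.quotKerEquivRange.symm ⟨L v, LinearMap.mem_range_self L v⟩ =
        (LinearMap.ker L).mkQ v := by
      rw [LinearEquiv.symm_apply_eq]
      rfl
    simp only [S, LinearMap.comp_apply, LinearEquiv.coe_coe, hv]
    rfl
  let T : LinearMap.range L →ₗᵢ[ℝ] EuclideanSpace ℝ (Fin p) := ⟨S, by
    rintro ⟨_, v, rfl⟩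
    rw [hS, hnorm]
    rfl⟩
  obtain ⟨b, hb⟩ := exists_On_of_linearIsometry T.extend
  refine ⟨b, ?_⟩
  have hcol : ∀ v, Matrix.toEuclideanLin Z v =
      Matrix.toEuclideanLin (b : Matrix (Fin p) (Fin p) ℝ) (Matrix.toEuclideanLin Y v) := by
    intro v
    rw [← hb]
    have := LinearIsometry.extend_apply T ⟨L v, LinearMap.mem_range_self L v⟩
    exact ((this.trans (hS v))).symm
  ext a c
  have := congrArg (fun w : EuclideanSpace ℝ (Fin p) => w a) (hcol (EuclideanSpace.single c 1))
  simp only [Matrix.toLpLin_apply, PiLp.ofLp_single,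
    Matrix.mulVec_single_one] at this
  exact this

/-- Symmetric matrices with the same characteristic polynomial are orthogonally conjugate. -/
theorem exists_conj_of_charpoly_eq {N : ℕ} {A B : Matrix (Fin N) (Fin N) ℝ} (hA : A.IsHermitian)
    (hB : B.IsHermitian) (h : A.charpoly = B.charpoly) :
    ∃ U : On N, A = (U : Matrix (Fin N) (Fin N) ℝ)ᵀ * B * (U : Matrix (Fin N) (Fin N) ℝ) := by
  have key : ∀ {D : Matrix (Fin N) (Fin N) ℝ} (hD : D.IsHermitian), ∃ W : On N,
      D = (W : Matrix (Fin N) (Fin N) ℝ) * Matrix.diagonal hD.eigenvalues *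
        (W : Matrix (Fin N) (Fin N) ℝ)ᵀ := by
    intro D hD
    refine ⟨hD.eigenvectorUnitary, ?_⟩
    have := hD.spectral_theorem
    simpa [Unitary.conjStarAlgAut_apply, Matrix.star_eq_conjTranspose] using this
  obtain ⟨W, hW⟩ := key hA
  obtain ⟨W', hW'⟩ := key hB
  have he : hA.eigenvalues = hB.eigenvalues := (hA.eigenvalues_eq_eigenvalues_iff hB).2 h
  refine ⟨W' * W⁻¹, ?_⟩
  have hU : ((W' * W⁻¹ : On N) : Matrix (Fin N) (Fin N) ℝ) =
      (W' : Matrix (Fin N) (Fin N) ℝ) * (W : Matrix (Fin N) (Fin N) ℝ)ᵀ := rfl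
  rw [hU, Matrix.transpose_mul, Matrix.transpose_transpose]
  set w : Matrix (Fin N) (Fin N) ℝ := W.1 with hw
  set w' : Matrix (Fin N) (Fin N) ℝ := W'.1 with hw'
  have h1 : w'ᵀ * w' = 1 := On_transpose_mul W'
  calc A = w * Matrix.diagonal hB.eigenvalues * wᵀ := by rw [← he]; exact hW
    _ = w * ((w'ᵀ * w') * Matrix.diagonal hB.eigenvalues * (w'ᵀ * w')) * wᵀ := by
        rw [h1, one_mul, mul_one]
    _ = w * w'ᵀ * (w' * Matrix.diagonal hB.eigenvalues * w'ᵀ) * (w' * wᵀ) := by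
        simp only [Matrix.mul_assoc]
    _ = _ := by rw [← hW']

/-- Subspaces with the same canonical angles to `ℝ^ℓ` lie in the same orbit of `K_ℓ`. -/
theorem exists_memK_smul_eq {n i ℓ : ℕ} (hℓ : ℓ ≤ n) (ξ ξ' : Gr n i)
    (h : (projMatrix (coordSubspace n ℓ) * projMatrix ξ.1).charpoly =
      (projMatrix (coordSubspace n ℓ) * projMatrix ξ'.1).charpoly) :
    ∃ γ : On n, MemK hℓ γ ∧ γ • ξ = ξ' := by
  set R := projMatrix (coordSubspace n ℓ) with hR
  set e := splitEquiv hℓ with he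
  let b : OrthonormalBasis (Fin i) ℝ ξ.1 := (stdOrthonormalBasis ℝ ξ.1).reindex (finCongr ξ.2)
  let b' : OrthonormalBasis (Fin i) ℝ ξ'.1 :=
    (stdOrthonormalBasis ℝ ξ'.1).reindex (finCongr ξ'.2)
  have hM : (compress b (coordSubspace n ℓ)).charpoly =
      (compress b' (coordSubspace n ℓ)).charpoly := by
    refine mul_left_cancel₀ (pow_ne_zero n X_ne_zero) ?_
    rw [← X_pow_mul_charpoly_projMatrix_mul, ← X_pow_mul_charpoly_projMatrix_mul,
      Matrix.charpoly_mul_comm, h, Matrix.charpoly_mul_comm]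
  obtain ⟨U, hU⟩ := exists_conj_of_charpoly_eq (compress_isHermitian b _)
    (compress_isHermitian b' _) hM
  set u : Matrix (Fin i) (Fin i) ℝ := U.1 with hu
  set Θ := frameMatrix b with hΘ
  -- The basis of `ξ'` is rotated so that the two compressions become equal matrices, and not only
  -- matrices with the same spectrum.
  set Θ' := frameMatrix b' * u with hΘ'
  have hRΘ : Θᵀ * R * Θ = Θ'ᵀ * R * Θ' := by
    rw [compress, compress] at hU
    rw [hΘ', Matrix.transpose_mul]
    simpa only [Matrix.mul_assoc] using hU
  have h1 : Θᵀ * Θ = 1 := frameMatrix_transpose_mul b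
  have h1' : Θ'ᵀ * Θ' = 1 := by
    rw [hΘ', Matrix.transpose_mul, Matrix.mul_assoc, ← Matrix.mul_assoc _ (frameMatrix b'),
      frameMatrix_transpose_mul, Matrix.one_mul]
    exact On_transpose_mul U
  have hP : Θ * Θᵀ = projMatrix ξ.1 := frameMatrix_mul_transpose b
  have hP' : Θ' * Θ'ᵀ = projMatrix ξ'.1 := by
    rw [hΘ', Matrix.transpose_mul, Matrix.mul_assoc, ← Matrix.mul_assoc u, On_mul_transpose,
      Matrix.one_mul, frameMatrix_mul_transpose]
  have hrows : ∀ W : Matrix (Fin n) (Fin i) ℝ, W.submatrix e id =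
      Matrix.fromRows (W.submatrix e id).toRows₁ (W.submatrix e id).toRows₂ :=
    fun W => (Matrix.fromRows_toRows _).symm
  have hlow : ∀ W : Matrix (Fin n) (Fin i) ℝ, Wᵀ * R * W =
      ((W.submatrix e id).toRows₂)ᵀ * (W.submatrix e id).toRows₂ := by
    intro W
    have h2 : Wᵀ * R * W = (W.submatrix e id)ᵀ * R.submatrix e e * W.submatrix e id := by
      rw [Matrix.transpose_submatrix, Matrix.submatrix_mul_equiv, Matrix.submatrix_mul_equiv,
        Matrix.submatrix_id_id]
    rw [h2, hR, projMatrix_coordSubspace_submatrix, Matrix.mul_assoc, hrows W,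
      Matrix.fromBlocks_mul_fromRows, Matrix.transpose_fromRows, Matrix.fromCols_mul_fromRows]
    simp
  have hup : ∀ W : Matrix (Fin n) (Fin i) ℝ, Wᵀ * W =
      ((W.submatrix e id).toRows₁)ᵀ * (W.submatrix e id).toRows₁ +
      ((W.submatrix e id).toRows₂)ᵀ * (W.submatrix e id).toRows₂ := by
    intro W
    have h2 : Wᵀ * W = (W.submatrix e id)ᵀ * W.submatrix e id := by
      rw [Matrix.transpose_submatrix, Matrix.submatrix_mul_equiv, Matrix.submatrix_id_id]
    rw [h2]
    conv_lhs => rw [hrows W]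
    rw [Matrix.transpose_fromRows, Matrix.fromCols_mul_fromRows]
  -- The compression is the Gram matrix of the last `ℓ` rows, which yields the block in `O(ℓ)`.
  -- Since the full Gram matrices are both `1`, subtraction shows that the first `n - ℓ` rows have
  -- equal Gram matrices too, which yields the other block.
  obtain ⟨c, hc⟩ := exists_On_mul_eq_of_gram_eq (p := ℓ) (Y := (Θ.submatrix e id).toRows₂)
    (Z := (Θ'.submatrix e id).toRows₂) (by rw [← hlow, ← hlow, hRΘ])
  obtain ⟨a, ha⟩ := exists_On_mul_eq_of_gram_eq (p := n - ℓ) (Y := (Θ.submatrix e id).toRows₁)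
    (Z := (Θ'.submatrix e id).toRows₁) (by
      refine add_right_cancel (b := ((Θ.submatrix e id).toRows₂)ᵀ * (Θ.submatrix e id).toRows₂) ?_
      rw [← hup, ← hlow, hRΘ, hlow, ← hup, h1, h1'])
  refine ⟨embK hℓ a c, memK_embK hℓ a c, Subtype.ext (projMatrix_injective ?_)⟩
  have hγ : Θ' = (embK hℓ a c : Matrix (Fin n) (Fin n) ℝ) * Θ := by
    have h3 : Θ'.submatrix e id =
        ((embK hℓ a c : Matrix (Fin n) (Fin n) ℝ) * Θ).submatrix e id := by
      rw [← Matrix.submatrix_mul_equiv _ _ _ e]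
      have h4 : (embK hℓ a c : Matrix (Fin n) (Fin n) ℝ).submatrix e e =
          Matrix.fromBlocks (a : Matrix (Fin (n - ℓ)) (Fin (n - ℓ)) ℝ) 0 0
            (c : Matrix (Fin ℓ) (Fin ℓ) ℝ) := by
        simp [embK, he]
      rw [h4, hrows Θ', hc, ha]
      conv_rhs => rw [hrows Θ, Matrix.fromBlocks_mul_fromRows]
      simp
    have h5 := congrArg (fun W => Matrix.submatrix W e.symm id) h3
    simpa using h5
  rw [projMatrix_smul, ← hP', hγ, Matrix.transpose_mul, ← hP]
  simp only [Matrix.mul_assoc]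

end InvGrass

end

/-! ### The law of the angles on the Grassmannian, and measurability of the factor -/

noncomputable section

namespace InvGrass

open Polynomial

/-- By `charpoly (A * B) = charpoly (B * A)`, up to powers of `X`, both cases of `lam` give the
spectrum of the same product of projections. This form is independent of the chosen bases and is all
that is used about `lam`. -/
theorem lam_spec {n i ℓ : ℕ} (ξ : Gr n i) (Θ : OrthonormalBasis (Fin i) ℝ ξ.1)
    (Ψ : OrthonormalBasis (Fin ℓ) ℝ (coordSubspace n ℓ)) :
    lam ξ Θ Ψ ∈ simplex (min i ℓ) ∧
      X ^ min i ℓ * (projMatrix (coordSubspace n ℓ) * projMatrix ξ.1).charpoly =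
        X ^ n * ∏ j, (X - C (lam ξ Θ Ψ j)) := by
  have hcast : ∀ {m k : ℕ} (h : m = k) {x : Fin k → ℝ} {p : ℝ[X]},
      (x ∈ simplex k ∧ X ^ k * p = X ^ n * ∏ j, (X - C (x j))) →
      (fun j : Fin m => x (Fin.cast h j)) ∈ simplex m ∧
        X ^ m * p = X ^ n * ∏ j : Fin m, (X - C (x (Fin.cast h j))) := by
    rintro m k rfl x p hx
    exact hx
  by_cases h : i ≤ ℓ
  · have hl : lam ξ Θ Ψ = fun j => eigs (compress_isHermitian Θ (coordSubspace n ℓ))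
        (Fin.cast (min_eq_left h) j) := by
      funext j
      simp [lam, h]
    rw [hl]
    refine hcast (min_eq_left h) ⟨compress_eigs_mem_simplex Θ _, ?_⟩
    rw [Matrix.charpoly_mul_comm, X_pow_mul_charpoly_projMatrix_mul Θ,
      charpoly_eq_prod_eigs (compress_isHermitian Θ _)]
  · have hl : lam ξ Θ Ψ = fun j => eigs (compress_isHermitian Ψ ξ.1)
        (Fin.cast (min_eq_right (le_of_not_ge h)) j) := by
      funext j
      simp [lam, h]
    rw [hl]
    exact hcast (min_eq_right (le_of_not_ge h)) (isSpec_eigs Ψ ξ.1)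

/-- The law of the canonical angles between `ℝ^ℓ` and a random subspace. -/
theorem map_angles_grMeasure {n i ℓ m : ℕ} (hin : i ≤ n) (hℓn : ℓ ≤ n) (hiℓ : i + ℓ ≤ n)
    (hm : m = min i ℓ) {L : Gr n i → Fin m → ℝ}
    (hL : ∀ ξ, L ξ ∈ simplex m ∧
      X ^ m * (projMatrix (coordSubspace n ℓ) * projMatrix ξ.1).charpoly =
        X ^ n * ∏ j, (X - C (L ξ j))) :
    (grMeasure hin).map L = ENNReal.ofReal (cConst n i ℓ) •
      nu m ((|(ℓ : ℝ) - i| - 1) / 2) (((n : ℝ) - ℓ - i - 1) / 2) := by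
  have hLc : Continuous L := continuous_of_isSpec continuous_induced_dom hL
  refine Measure.ext_of_lintegral _ fun φ hφ => ?_
  have hφL : Measurable fun ξ => φ (L ξ) := hφ.comp hLc.measurable
  rw [lintegral_map hφ hLc.measurable, grMeasure,
    lintegral_map hφL (continuous_orbit _).measurable,
    lintegral_smul_measure, smul_eq_mul]
  rcases le_total i ℓ with h | h
  · rw [min_eq_left h] at hm
    subst hm
    -- If `i ≤ ℓ` the two subspaces change places: the angles between `γ⁻¹ ℝ^i` and `ℝ^ℓ` are those
    -- between `ℝ^i` and `γ ℝ^ℓ`. The inverse is then absorbed by inversion invariance of Haar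
    -- measure.
    have hd : ∀ γ : On n, IsSpec (projMatrix (γ • basePoint hℓn).1) (L (γ⁻¹ • basePoint hin)) := by
      intro γ
      refine ⟨(hL _).1, ?_⟩
      rw [← (hL _).2, projMatrix_smul, projMatrix_smul]
      have hinv : ((γ⁻¹ : On n) : Matrix (Fin n) (Fin n) ℝ) =
          (γ : Matrix (Fin n) (Fin n) ℝ)ᵀ := rfl
      rw [hinv, Matrix.transpose_transpose]
      congr 1
      change (projMatrix (coordSubspace n m) * ((γ : Matrix (Fin n) (Fin n) ℝ) *
        projMatrix (coordSubspace n ℓ) * _)).charpoly =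
        (projMatrix (coordSubspace n ℓ) * (_ * projMatrix (coordSubspace n m) * _)).charpoly
      rw [Matrix.charpoly_mul_comm, Matrix.mul_assoc (γ : Matrix (Fin n) (Fin n) ℝ),
        Matrix.mul_assoc (γ : Matrix (Fin n) (Fin n) ℝ), Matrix.charpoly_mul_comm]
      simp only [Matrix.mul_assoc]
    have h1 := lintegral_spec_haarOn hℓn m h hiℓ hd hφ
    have h2 := lintegral_inv_eq_self (μ := haarOn n) fun γ => φ (L (γ • basePoint hin))
    refine h2.symm.trans (h1.trans ?_)
    have hc : lawConst n ℓ m = cConst n m ℓ := by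
      rw [lawConst, cConst, min_eq_left h, if_pos h]
    have ha : |(ℓ : ℝ) - m| = (ℓ : ℝ) - m :=
      abs_of_nonneg (sub_nonneg.2 (by exact_mod_cast h))
    rw [hc, ha]
  · rw [min_eq_right h] at hm
    subst hm
    refine (lintegral_spec_haarOn hin m h (by omega) (d := fun γ => L (γ • basePoint hin))
      (fun γ => hL _) hφ).trans ?_
    have hc : lawConst n i m = cConst n i m := by
      -- For `i = ℓ` the definition of `cConst` takes its first branch, where both expressions
      -- coincide.
      rcases h.eq_or_lt with rfl | hlt
      · simp [lawConst, cConst]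
      · rw [lawConst, cConst, min_eq_right h, if_neg (not_le.2 hlt)]
    have ha : |(m : ℝ) - i| = (i : ℝ) - m := by
      rw [abs_sub_comm]
      exact abs_of_nonneg (sub_nonneg.2 (by exact_mod_cast h))
    rw [hc, ha, sub_right_comm (n : ℝ)]

theorem cConst_pos {n i ℓ : ℕ} (hiℓ : i + ℓ ≤ n) : 0 < cConst n i ℓ := by
  by_cases h : i ≤ ℓ
  · have := lawConst_pos (n := n) h hiℓ
    rw [cConst, min_eq_left h, if_pos h]
    exact this
  · have := lawConst_pos (n := n) (le_of_not_ge h) (by omega)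
    rw [cConst, min_eq_right (le_of_not_ge h), if_neg h]
    exact this

/-- Elements of `K_ℓ` commute with the projection onto `ℝ^ℓ`, so the product of projections is
merely conjugated. -/
theorem charpoly_memK_smul {n i ℓ : ℕ} {hℓ : ℓ ≤ n} {γ : On n} (hγ : MemK hℓ γ) (ξ : Gr n i) :
    (projMatrix (coordSubspace n ℓ) * projMatrix (γ • ξ).1).charpoly =
      (projMatrix (coordSubspace n ℓ) * projMatrix ξ.1).charpoly := by
  obtain ⟨a, b, rfl⟩ := exists_embK_of_memK hγ
  set g : Matrix (Fin n) (Fin n) ℝ := (embK hℓ a b).1 with hg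
  have hcomm : projMatrix (coordSubspace n ℓ) * g = g * projMatrix (coordSubspace n ℓ) := by
    have h1 : g = (Matrix.fromBlocks (a : Matrix (Fin (n - ℓ)) (Fin (n - ℓ)) ℝ) 0 0
        (b : Matrix (Fin ℓ) (Fin ℓ) ℝ)).submatrix (splitEquiv hℓ).symm (splitEquiv hℓ).symm := rfl
    have h2 : projMatrix (coordSubspace n ℓ) =
        (Matrix.fromBlocks 0 0 0 1 : Matrix (Fin (n - ℓ) ⊕ Fin ℓ) _ ℝ).submatrix
          (splitEquiv hℓ).symm (splitEquiv hℓ).symm := by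
      rw [← projMatrix_coordSubspace_submatrix hℓ]
      simp
    rw [h1, h2, Matrix.submatrix_mul_equiv, Matrix.submatrix_mul_equiv,
      Matrix.fromBlocks_multiply, Matrix.fromBlocks_multiply]
    simp
  rw [projMatrix_smul, ← Matrix.mul_assoc, ← Matrix.mul_assoc, hcomm, Matrix.charpoly_mul_comm,
    Matrix.mul_assoc g, ← Matrix.mul_assoc, On_transpose_mul, Matrix.one_mul]

/-- A set whose preimage under a continuous map is null measurable is null measurable for the
image measure. -/
theorem nullMeasurableSet_map_of_preimage {X Y : Type*} [TopologicalSpace X] [MeasurableSpace X]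
    [BorelSpace X] [TopologicalSpace Y] [T2Space Y] [MeasurableSpace Y] [BorelSpace Y]
    {μ : Measure X} [IsFiniteMeasure μ] [μ.InnerRegularCompactLTTop] {h : X → Y}
    (hh : Continuous h) {E : Set Y} (hE : NullMeasurableSet (h ⁻¹' E) μ) :
    NullMeasurableSet E (μ.map h) := by
  -- Compact sets exhausting the preimage have compact, hence Borel, images inside `D`. Their union
  -- is a Borel subset of `D` whose preimage has full measure in that of `D`.
  have inner : ∀ {D : Set Y}, NullMeasurableSet (h ⁻¹' D) μ →
      ∃ B ⊆ D, MeasurableSet B ∧ μ (h ⁻¹' D) ≤ μ (h ⁻¹' B) := by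
    intro D hD
    obtain ⟨t, htD, ht, hte⟩ := hD.exists_measurable_subset_ae_eq
    have hK : ∀ N : ℕ, ∃ K ⊆ t, IsCompact K ∧ μ t < μ K + ((N : ENNReal) + 1)⁻¹ := fun N =>
      ht.exists_isCompact_lt_add (measure_ne_top μ t) (by simp)
    choose K hKt hKc hKμ using hK
    refine ⟨⋃ N, h '' K N, Set.iUnion_subset fun N => ?_, MeasurableSet.iUnion fun N =>
      ((hKc N).image hh).isClosed.measurableSet, ?_⟩
    · exact Set.image_subset_iff.2 ((hKt N).trans htD)
    · rw [← measure_congr hte]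
      have hle : ∀ N : ℕ, μ t ≤ μ (h ⁻¹' ⋃ N, h '' K N) + ((N : ENNReal) + 1)⁻¹ := fun N =>
        (hKμ N).le.trans (add_le_add (measure_mono fun x hx =>
          Set.mem_iUnion.2 ⟨N, x, hx, rfl⟩) le_rfl)
      have hlim : Filter.Tendsto (fun N : ℕ => μ (h ⁻¹' ⋃ N, h '' K N) + ((N : ENNReal) + 1)⁻¹)
          Filter.atTop (nhds (μ (h ⁻¹' ⋃ N, h '' K N) + 0)) := by
        refine tendsto_const_nhds.add ?_
        have := (Filter.tendsto_add_atTop_iff_nat 1).2 ENNReal.tendsto_inv_nat_nhds_zero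
        simpa using this
      rw [add_zero] at hlim
      exact ge_of_tendsto' hlim hle
  obtain ⟨B, hBE, hB, hBμ⟩ := inner hE
  obtain ⟨B', hBE', hB', hBμ'⟩ := inner (D := Eᶜ) hE.compl
  refine ⟨B, hB, ?_⟩
  have hsub : E \ B ⊆ B'ᶜ \ B := fun y hy => ⟨fun hy' => hBE' hy' hy.1, hy.2⟩
  have hBB' : B ⊆ B'ᶜ := fun y hy hy' => hBE' hy' (hBE hy)
  -- `E` is squeezed between the Borel sets `B` and `B'ᶜ`. They have the same measure because `B`
  -- and `B'` exhaust the preimages of `E` and of its complement.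
  have hzero : μ.map h (B'ᶜ \ B) = 0 := by
    rw [Measure.map_apply hh.measurable (hB'.compl.diff hB), Set.preimage_sdiff,
      measure_sdiff (Set.preimage_mono hBB')
        (hB.preimage hh.measurable).nullMeasurableSet (measure_ne_top _ _),
      Set.preimage_compl, measure_compl (hB'.preimage hh.measurable) (measure_ne_top _ _),
      tsub_tsub, tsub_eq_zero_iff_le, ← measure_add_measure_compl₀ hE, add_comm]
    exact add_le_add hBμ' hBμ
  refine ae_eq_set.2 ⟨measure_mono_null hsub hzero, ?_⟩
  rw [Set.sdiff_eq_empty.2 hBE, measure_empty]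

theorem aestronglyMeasurable_map_of_comp {X Y 𝕜 : Type*} [TopologicalSpace X] [MeasurableSpace X]
    [BorelSpace X] [TopologicalSpace Y] [T2Space Y] [MeasurableSpace Y] [BorelSpace Y]
    [RCLike 𝕜] {μ : Measure X} [IsFiniteMeasure μ] [μ.InnerRegularCompactLTTop] {h : X → Y}
    (hh : Continuous h) {f : Y → 𝕜} (hf : AEStronglyMeasurable (f ∘ h) μ) :
    AEStronglyMeasurable f (μ.map h) := by
  have : NullMeasurable f (μ.map h) := fun s hs =>
    nullMeasurableSet_map_of_preimage hh (hf.aemeasurable.nullMeasurable hs)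
  exact this.aemeasurable.aestronglyMeasurable

end InvGrass

end

/-! ### Averaging over `K_ℓ` -/

noncomputable section

namespace InvGrass

instance (n : ℕ) : (haarOn n).InnerRegularCompactLTTop := by
  unfold haarOn
  infer_instance

instance (n i : ℕ) : SecondCountableTopology (Gr n i) :=
  have : SecondCountableTopology (Matrix (Fin n) (Fin n) ℝ) :=
    inferInstanceAs (SecondCountableTopology (Fin n → Fin n → ℝ))
  Topology.IsInducing.secondCountableTopology (f := fun ξ : Gr n i => projMatrix ξ.1) ⟨rfl⟩

theorem continuous_smul_of_continuous {Y : Type*} [TopologicalSpace Y] {n i : ℕ} {a : Y → On n}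
    {x : Y → Gr n i} (ha : Continuous a) (hx : Continuous x) : Continuous fun y => a y • x y := by
  refine continuous_induced_rng.2 ?_
  have h : Continuous fun ξ : Gr n i => projMatrix ξ.1 := continuous_induced_dom
  have h1 : Continuous fun y => (a y : Matrix (Fin n) (Fin n) ℝ) :=
    continuous_subtype_val.comp ha
  simp only [Function.comp_def, projMatrix_smul]
  exact (h1.matrix_mul (h.comp hx)).matrix_mul h1.matrix_transpose

theorem continuous_embK_smul {n i ℓ : ℕ} (hℓn : ℓ ≤ n) :
    Continuous fun z : (On (n - ℓ) × On ℓ) × Gr n i => embK hℓn z.1.1 z.1.2 • z.2 :=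
  continuous_smul_of_continuous ((continuous_embK hℓn).comp continuous_fst) continuous_snd

theorem quasiMeasurePreserving_smul {n i : ℕ} (hin : i ≤ n) (γ : On n) :
    Measure.QuasiMeasurePreserving (fun ξ : Gr n i => γ • ξ) (grMeasure hin) (grMeasure hin) :=
  ⟨(continuous_smul_left γ).measurable, (grMeasure_map_smul hin γ).le.absolutelyContinuous⟩

/-- A function that is almost everywhere invariant under each of a measurable family of maps agrees
almost everywhere with its average over the family. -/
theorem ae_eq_average {X G 𝕜 : Type*} [MeasurableSpace X] [MeasurableSpace G] [RCLike 𝕜]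
    {μ : Measure X} [SFinite μ] {κ : Measure G} [IsProbabilityMeasure κ] {act : G → X → X}
    (hact : Measurable fun z : G × X => act z.1 z.2)
    (hq : ∀ k, Measure.QuasiMeasurePreserving (act k) μ μ) {f g : X → 𝕜}
    (hg : Measurable g) (hfg : f =ᵐ[μ] g) (hinv : ∀ k, ∀ᵐ x ∂μ, f (act k x) = f x) :
    f =ᵐ[μ] fun x => ∫ k, g (act k x) ∂κ := by
  -- The exceptional null set depends on `k`. Passing to the measurable representative `g` makes the
  -- set of good pairs measurable, so Fubini can exchange the two quantifiers.
  have hall : ∀ᵐ k ∂κ, ∀ᵐ x ∂μ, g (act k x) = g x := by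
    refine Filter.Eventually.of_forall fun k => ?_
    filter_upwards [hinv k, hfg, (hq k).ae hfg] with x h1 h2 h3
    rw [← h3, h1, h2]
  have hset : MeasurableSet {z : G × X | g (act z.1 z.2) = g z.2} :=
    measurableSet_eq_fun (hg.comp hact) (hg.comp measurable_snd)
  filter_upwards [(Measure.ae_ae_comm hset).1 hall, hfg] with x h1 h2
  rw [integral_congr_ae h1, h2]
  simp

/-- Right invariance of the product Haar measure makes the average invariant at every point, even
though `g` is arbitrary. -/
theorem integral_embK_smul {𝕜 : Type*} [RCLike 𝕜] {n i ℓ : ℕ} (hℓn : ℓ ≤ n) (g : Gr n i → 𝕜)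
    (a : On (n - ℓ)) (b : On ℓ) (ξ : Gr n i) :
    ∫ k : On (n - ℓ) × On ℓ, g (embK hℓn k.1 k.2 • embK hℓn a b • ξ)
        ∂((haarOn (n - ℓ)).prod (haarOn ℓ)) =
      ∫ k : On (n - ℓ) × On ℓ, g (embK hℓn k.1 k.2 • ξ) ∂((haarOn (n - ℓ)).prod (haarOn ℓ)) := by
  have h := integral_mul_right_eq_self (μ := (haarOn (n - ℓ)).prod (haarOn ℓ))
    (fun k : On (n - ℓ) × On ℓ => g (embK hℓn k.1 k.2 • ξ)) (a, b)
  rw [← h]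
  refine integral_congr_ae (Filter.Eventually.of_forall fun k => ?_)
  simp only [Prod.fst_mul, Prod.snd_mul, embK_mul, mul_smul]

/-- A function that is almost everywhere invariant under each element of `K_ℓ` agrees almost
everywhere with an invariant one. -/
theorem exists_invariant_ae_eq {𝕜 : Type*} [RCLike 𝕜] {n i ℓ : ℕ} (hin : i ≤ n) (hℓn : ℓ ≤ n)
    {f : Gr n i → 𝕜} (hf : AEStronglyMeasurable f (grMeasure hin))
    (hinv : ∀ γ : On n, MemK hℓn γ → ∀ᵐ ξ ∂(grMeasure hin), f (γ • ξ) = f ξ) :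
    ∃ F : Gr n i → 𝕜, (∀ γ : On n, MemK hℓn γ → ∀ ξ, F (γ • ξ) = F ξ) ∧
      f =ᵐ[grMeasure hin] F := by
  have := isProbabilityMeasure_grMeasure hin
  obtain ⟨g, hgm, hfg⟩ := hf
  have hcont : Continuous fun z : (On (n - ℓ) × On ℓ) × Gr n i => embK hℓn z.1.1 z.1.2 • z.2 :=
    continuous_embK_smul hℓn
  refine ⟨fun ξ => ∫ k, g (embK hℓn k.1 k.2 • ξ) ∂((haarOn (n - ℓ)).prod (haarOn ℓ)),
    fun γ hγ ξ => ?_, ?_⟩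
  · obtain ⟨a, b, rfl⟩ := exists_embK_of_memK hγ
    exact integral_embK_smul hℓn g a b ξ
  · exact ae_eq_average (act := fun (k : On (n - ℓ) × On ℓ) ξ => embK hℓn k.1 k.2 • ξ)
      hcont.measurable (fun k => quasiMeasurePreserving_smul hin _) hgm.measurable hfg
      fun k => hinv _ (memK_embK hℓn k.1 k.2)

end InvGrass

end

/-! ### The theorem -/

open InvGrass in
theorem theorem1p1 {𝕜 : Type*} [RCLike 𝕜] {n i ℓ : ℕ}
    (hi : 1 ≤ i) (hin : i < n) (hℓ : 1 ≤ ℓ) (hℓn : ℓ < n) (hiℓ : i + ℓ ≤ n)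
    (α β : ℝ) (hα : α = (|(ℓ : ℝ) - i| - 1) / 2) (hβ : β = ((n : ℝ) - ℓ - i - 1) / 2)
    (Θ : ∀ ξ : Gr n i, OrthonormalBasis (Fin i) ℝ ξ.1)
    (Ψ : OrthonormalBasis (Fin ℓ) ℝ (coordSubspace n ℓ)) :
    (∀ f : Gr n i → 𝕜, Integrable f (grMeasure hin.le) →
      ((∀ γ : On n, MemK hℓn.le γ → ∀ ξ, f (γ • ξ) = f ξ) ↔
        ∃ f₀ : (Fin (min i ℓ) → ℝ) → 𝕜, Integrable f₀ (nu (min i ℓ) α β) ∧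
          ∀ ξ, f ξ = f₀ (lam ξ (Θ ξ) Ψ))) ∧
    (∀ f : Gr n i → 𝕜, Integrable f (grMeasure hin.le) →
      ((∀ γ : On n, MemK hℓn.le γ → ∀ᵐ ξ ∂(grMeasure hin.le), f (γ • ξ) = f ξ) ↔
        ∃ f₀ : (Fin (min i ℓ) → ℝ) → 𝕜, Integrable f₀ (nu (min i ℓ) α β) ∧
          ∀ᵐ ξ ∂(grMeasure hin.le), f ξ = f₀ (lam ξ (Θ ξ) Ψ))) ∧
    (∀ (f : Gr n i → 𝕜) (f₀ : (Fin (min i ℓ) → ℝ) → 𝕜),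
      Integrable f₀ (nu (min i ℓ) α β) →
      (∀ᵐ ξ ∂(grMeasure hin.le), f ξ = f₀ (lam ξ (Θ ξ) Ψ)) →
        Integrable f (grMeasure hin.le) ∧
          ∫ ξ, f ξ ∂(grMeasure hin.le) =
            (cConst n i ℓ : 𝕜) * ∫ x, f₀ x ∂(nu (min i ℓ) α β)) := by
  have hspec := fun ξ : Gr n i => lam_spec ξ (Θ ξ) Ψ
  set L : Gr n i → Fin (min i ℓ) → ℝ := fun ξ => lam ξ (Θ ξ) Ψ with hL
  have hLc : Continuous L := continuous_of_isSpec continuous_induced_dom hspec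
  have hmap : (grMeasure hin.le).map L = ENNReal.ofReal (cConst n i ℓ) • nu (min i ℓ) α β := by
    rw [hα, hβ]
    exact map_angles_grMeasure hin.le hℓn.le hiℓ rfl hspec
  have hc : 0 < cConst n i ℓ := cConst_pos hiℓ
  have hiff : ∀ f₀ : (Fin (min i ℓ) → ℝ) → 𝕜,
      Integrable f₀ ((grMeasure hin.le).map L) ↔ Integrable f₀ (nu (min i ℓ) α β) := by
    intro f₀
    rw [hmap]
    exact integrable_smul_measure (ENNReal.ofReal_pos.2 hc).ne' ENNReal.ofReal_ne_top
  have hLK : ∀ γ : On n, MemK hℓn.le γ → ∀ ξ, L (γ • ξ) = L ξ := by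
    intro γ hγ ξ
    refine eq_of_prod_X_sub_C_eq (hspec _).1.1 (hspec _).1.1
      (mul_left_cancel₀ (pow_ne_zero n Polynomial.X_ne_zero) ?_)
    rw [← (hspec _).2, ← (hspec _).2, charpoly_memK_smul hγ]
  have horbit : ∀ ξ ξ', L ξ = L ξ' → ∃ γ : On n, MemK hℓn.le γ ∧ γ • ξ = ξ' := by
    intro ξ ξ' h
    refine exists_memK_smul_eq hℓn.le ξ ξ'
      (mul_left_cancel₀ (pow_ne_zero (min i ℓ) Polynomial.X_ne_zero) ?_)
    have h' : lam ξ (Θ ξ) Ψ = lam ξ' (Θ ξ') Ψ := h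
    rw [(hspec _).2, (hspec _).2, h']
  have hforward : ∀ f : Gr n i → 𝕜, Integrable f (grMeasure hin.le) →
      (∀ γ : On n, MemK hℓn.le γ → ∀ ξ, f (γ • ξ) = f ξ) →
        ∃ f₀ : (Fin (min i ℓ) → ℝ) → 𝕜, Integrable f₀ (nu (min i ℓ) α β) ∧
          ∀ ξ, f ξ = f₀ (L ξ) := by
    intro f hf hinv
    -- Points with the same angles lie in one `K_ℓ`-orbit, on which `f` is constant. The extension
    -- by `0` off the range of `L` is harmless, since the image measure sees only the composition
    -- with `L`.
    have hfac : Function.FactorsThrough f L := by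
      intro ξ ξ' h
      obtain ⟨γ, hγ, rfl⟩ := horbit ξ ξ' h
      exact (hinv γ hγ ξ).symm
    refine ⟨Function.extend L f 0, ?_, fun ξ => (hfac.extend_apply 0 ξ).symm⟩
    have hcomp : Function.extend L f 0 ∘ L = f := funext fun ξ => hfac.extend_apply 0 ξ
    rw [← hiff]
    -- Measurability of the factor is checked after pulling back to `O(n)`, where Haar measure is
    -- inner regular for compact sets and the composite map to the simplex is continuous.
    have hae : AEStronglyMeasurable (Function.extend L f 0) ((grMeasure hin.le).map L) := by
      rw [grMeasure, Measure.map_map hLc.measurable (continuous_orbit _).measurable]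
      refine aestronglyMeasurable_map_of_comp (hLc.comp (continuous_orbit _)) ?_
      rw [← Function.comp_assoc, hcomp]
      exact hf.aestronglyMeasurable.comp_measurable (continuous_orbit _).measurable
    rw [integrable_map_measure hae hLc.measurable.aemeasurable, hcomp]
    exact hf
  refine ⟨fun f hf => ⟨hforward f hf, ?_⟩, fun f hf => ⟨fun hinv => ?_, ?_⟩, fun f f₀ hf₀ hff => ?_⟩
  · rintro ⟨f₀, -, h⟩ γ hγ ξ
    have h1 : lam (γ • ξ) (Θ (γ • ξ)) Ψ = lam ξ (Θ ξ) Ψ := hLK γ hγ ξ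
    rw [h, h, h1]
  · obtain ⟨F, hF, hfF⟩ := exists_invariant_ae_eq hin.le hℓn.le hf.aestronglyMeasurable hinv
    obtain ⟨f₀, hf₀, h⟩ := hforward F (hf.congr hfF) hF
    exact ⟨f₀, hf₀, hfF.mono fun ξ hξ => hξ.trans (h ξ)⟩
  · rintro ⟨f₀, -, h⟩ γ hγ
    filter_upwards [h, (quasiMeasurePreserving_smul hin.le γ).ae h] with ξ h1 h2
    have h3 : lam (γ • ξ) (Θ (γ • ξ)) Ψ = lam ξ (Θ ξ) Ψ := hLK γ hγ ξ
    rw [h1, h2, h3]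
  · have hf₀' : Integrable f₀ ((grMeasure hin.le).map L) := (hiff f₀).2 hf₀
    have h1 : Integrable (f₀ ∘ L) (grMeasure hin.le) := hf₀'.comp_measurable hLc.measurable
    refine ⟨h1.congr (Filter.EventuallyEq.symm hff), ?_⟩
    have h2 : ∫ ξ, f ξ ∂(grMeasure hin.le) = ∫ ξ, f₀ (L ξ) ∂(grMeasure hin.le) :=
      integral_congr_ae hff
    rw [h2, ← integral_map hLc.measurable.aemeasurable hf₀'.aestronglyMeasurable, hmap,
      integral_smul_measure, ENNReal.toReal_ofReal hc.le, RCLike.real_smul_eq_coe_mul]
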